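/- **Conventions.** Graphs are finite and may have loops and parallel edges. A *2-complex* $C=(V,E,F)$ is a finite graph $(V,E)$ together with a finite family $F$ of closed trails (closed walks using no edge twice), its *faces*; every edge has a fixed direction. The *link graph* $L(v)$ at a vertex $v$ has as vertices the half-edges of $C$ attached at $v$ (one for each non-loop edge at $v$, two for each loop at $v$), and has one edge for each traversal of $v$ by a face, joining the half-edge by which the face arrives at $v$ to the half-edge by which it leaves $v$. As a face uses an edge at most once, the edges of $L(v)$ at a half-edge of $e$ correspond bijectively to the faces traversing $e$. $C$ is *locally 3-connected* if every link graph is connected, has no loops and no parallel edges, and is not disconnected by the deletion of at most two vertices. A *rotation system* of a graph is a family $(\sigma_v)$ of cyclic orientations $\sigma_v$ (*rotators*) of the edges at each vertex $v$; it is *planar* if the oriented surface obtained by gluing discs along its face walks is a disjoint union of spheres, i.e. every component has Euler characteristic $2$. A *rotation system* of $C$ is a family $(\sigma_e)_{e\in E}$ of cyclic orientations $\sigma_e$ of the faces traversing $e$. It induces a rotation system on each $L(v)$, using $\sigma_e$ at a half-edge of $e$ where $e$ is directed towards $v$ and the reverse of $\sigma_e$ otherwise; it is *planar* if all induced rotation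 systems of link graphs are planar. $C$ is *locally planar* if every link graph $L(v)$ has a planar rotation system such that for every loop $\ell$ at $v$ the rotators at the two vertices of $L(v)$ given by $\ell$ are reverse to each other, where the edges of $L(v)$ at these two vertices are identified via the faces they belong to. For a set $X$ of edges, $C/X$ is obtained from $C$ by identifying the endvertices of each edge in $X$ and deleting the edges of $X$ from the graph and from all faces. A *chord* of a cycle $o$ is an edge not in $o$ that joins two distinct vertices of $o$ and is not parallel to an edge of $o$; a cycle without chords is *chordless*. A cycle is *non-loop* if it has at least two edges (two parallel edges form a cycle). **Lemma.** Let $C$ be a locally 3-connected 2-complex. Suppose that $C$ is locally planar, that $C/e$ is locally planar for every non-loop edge $e$ of $C$, and that for every non-loop chordless cycle $o$ of $C$ there is some edge $e\in o$ such that $C/(o-e)$ is locally planar. Then $C$ has a planar rotation system. -/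

import Mathlib

/-- A graph with vertex set `V` and edge set `E`; loops and parallel edges are allowed.
Every edge `e` has the two half-edges `(e, false)` and `(e, true)`, and `inc` gives the vertex at
which a half-edge is attached. If the graph is viewed as a directed graph, then `e` is directed
from the vertex of `(e, false)` to the vertex of `(e, true)`. -/
structure MultiGraph (V E : Type*) where
  inc : E × Bool → V

namespace MultiGraph

variable {V E : Type*}

/-- The other half of the same edge. -/
def opp : Equiv.Perm (E × Bool) where
  toFun h := (h.1, !h.2)
  invFun h := (h.1, !h.2)
  left_inv h := by simp
  right_inv h := by simp

variable (G : MultiGraph V E)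

def Adj (v w : V) : Prop := ∃ h : E × Bool, G.inc h = v ∧ G.inc (opp h) = w

def IsLoop (e : E) : Prop := G.inc (e, false) = G.inc (e, true)

/-- The edges `e` and `e'` have the same endvertices. -/
def Parallel (e e' : E) : Prop :=
  s(G.inc (e, false), G.inc (e, true)) = s(G.inc (e', false), G.inc (e', true))

/-- `w` can be reached from `v` by a walk that avoids the vertices in `X`
(apart from the trivial walk, if `v = w`). -/
def ReachableAvoiding (X : Set V) (v w : V) : Prop :=
  Relation.ReflTransGen (fun a b => G.Adj a b ∧ a ∉ X ∧ b ∉ X) v w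

def Reachable (v w : V) : Prop := G.ReachableAvoiding ∅ v w

/-- The graph is connected, has no loops and no parallel edges, and the deletion of at most two
vertices does not disconnect it. No lower bound is put on the number of vertices: besides the
graphs with at least four vertices that are 3-connected, this holds just for the
complete graphs with one, two or three vertices. -/
structure ThreeConnected : Prop where
  nonempty : Nonempty V
  no_loop : ∀ e, ¬ G.IsLoop e
  no_parallel : ∀ e e', G.Parallel e e' → e = e'
  no_separator : ∀ X : Finset V, X.card < 3 →
    ∀ v w : V, v ∉ X → w ∉ X → G.ReachableAvoiding (X : Set V) v w

/-! ### Rotation systems of graphs -/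

/-- A rotation system: a cyclic orientation of the half-edges at every vertex. -/
structure RotationSystem where
  rot : ∀ v : V, Equiv.Perm {h : E × Bool // G.inc h = v}
  cyclic : ∀ v : V, (rot v).IsCycleOn Set.univ

variable {G}

/-- All rotators together, as one permutation of the half-edges. -/
def RotationSystem.total (S : G.RotationSystem) : Equiv.Perm (E × Bool) :=
  (Equiv.sigmaFiberEquiv G.inc).permCongr (Equiv.Perm.sigmaCongrRight S.rot)

/-- The successor function on directed edges along the boundary walks of the faces of the surface
given by the rotation system. A half-edge `h` stands for its edge, directed away from `h`; this
directed edge arrives at the half-edge `opp h`, and is followed by the directed edge that leaves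
at the half-edge just after `opp h` in the rotator. -/
def RotationSystem.faceNext (S : G.RotationSystem) : Equiv.Perm (E × Bool) :=
  opp.trans S.total

/-- The faces of the surface: the cycles of `faceNext`. -/
def RotationSystem.SurfaceFace (S : G.RotationSystem) : Type _ :=
  Quotient (Equiv.Perm.SameCycle.setoid S.faceNext)

def RotationSystem.surfaceFace (S : G.RotationSystem) (h : E × Bool) : S.SurfaceFace :=
  Quotient.mk _ h

/-- The closed oriented surface obtained by gluing a disc to `G` along every face walk is a disjoint
union of spheres: every component has Euler characteristic 2. The component is given
by a half-edge `h` in it (components without edges need no condition).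
Used for finite graphs only. -/
def RotationSystem.Planar (S : G.RotationSystem) : Prop :=
  ∀ h : E × Bool,
    ({v | G.Reachable (G.inc h) v}.ncard : ℤ)
      - ({e | G.Reachable (G.inc h) (G.inc (e, false))}.ncard : ℤ)
      + (({f | ∃ k, G.Reachable (G.inc h) (G.inc k) ∧ S.surfaceFace k = f} :
          Set S.SurfaceFace).ncard : ℤ) = 2

/-! ### Closed trails and cycles -/

variable (G)

/-- A walk from `v` to `w`, as a list of directed edges; the entry `d` stands for the edge
`d.1`, traversed from its half-edge `d` to its half-edge `opp d`. -/
def IsWalk : V → List (E × Bool) → V → Prop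
  | v, [], w => v = w
  | v, d :: l, w => G.inc d = v ∧ IsWalk (G.inc (opp d)) l w

/-- A closed walk that uses no edge twice. -/
def IsClosedTrail (l : List (E × Bool)) : Prop :=
  (∃ v, G.IsWalk v l v) ∧ (l.map Prod.fst).Nodup

/-- A cycle: a nonempty closed trail that visits no vertex twice. A cycle of length one is a loop;
one of length two consists of two parallel edges. -/
def IsCycle (o : List (E × Bool)) : Prop :=
  o ≠ [] ∧ G.IsClosedTrail o ∧ (o.map G.inc).Nodup

/-- A chord of the cycle `o`: an edge not in `o` that joins two distinct vertices of `o` and is not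
parallel to an edge of `o`. -/
def IsChord (o : List (E × Bool)) (x : E) : Prop :=
  x ∉ o.map Prod.fst ∧ ¬ G.IsLoop x ∧
    G.inc (x, false) ∈ o.map G.inc ∧ G.inc (x, true) ∈ o.map G.inc ∧
    ∀ y ∈ o.map Prod.fst, ¬ G.Parallel x y

def Chordless (o : List (E × Bool)) : Prop := ∀ x, ¬ G.IsChord o x

variable {G}

theorem IsWalk.succ {l : List (E × Bool)} : ∀ {v w : V}, G.IsWalk v l w →
    ∀ (i : ℕ) (h : i + 1 < l.length), G.inc (opp l[i]) = G.inc l[i + 1] := by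
  induction l with
  | nil => intro v w _ i h; simp at h
  | cons d l ih =>
    intro v w hw i h
    cases i with
    | zero =>
      cases l with
      | nil => simp at h
      | cons d' l => exact hw.2.1.symm
    | succ i => exact ih hw.2 i (by simpa using h)

theorem IsWalk.last {l : List (E × Bool)} : ∀ {v w : V}, G.IsWalk v l w →
    ∀ (h : l ≠ []), G.inc (opp (l.getLast h)) = w := by
  induction l with
  | nil => intro v w _ h; exact absurd rfl h
  | cons d l ih =>
    intro v w hw h
    cases l with
    | nil => exact hw.2
    | cons d' l => exact ih hw.2 (by simp)

/-- In a closed trail, every directed edge ends where the cyclically next one starts. -/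
theorem IsClosedTrail.next {l : List (E × Bool)} (hl : G.IsClosedTrail l) (i : Fin l.length) :
    G.inc (opp (l.get i)) = G.inc (l.get (finRotate _ i)) := by
  obtain ⟨⟨v, hw⟩, -⟩ := hl
  obtain ⟨i, hi⟩ := i
  cases l with
  | nil => simp at hi
  | cons d l =>
    rcases Nat.lt_or_ge (i + 1) (d :: l).length with h | h
    · have hr : finRotate (d :: l).length ⟨i, hi⟩ = ⟨i + 1, h⟩ :=
        finRotate_of_lt (n := l.length) (by simpa using h)
      rw [hr]
      exact hw.succ i h
    · have hi' : i = l.length := by simp at hi h; omega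
      subst hi'
      have hr : finRotate (d :: l).length ⟨l.length, hi⟩ = ⟨0, by simp⟩ :=
        finRotate_last' (n := l.length)
      rw [hr]
      have h1 := hw.last (by simp)
      rw [List.getLast_eq_getElem] at h1
      have h2 : G.inc d = v := hw.1
      rw [← h2] at h1
      simpa using h1

end MultiGraph

open MultiGraph in
/-- A (directed) 2-complex: a graph with vertex set `V` and edge set `E`, together with a family of
closed trails, the faces, indexed by `F`. The convention that every vertex and every edge
is incident with a face, and that a face has at least one edge, is not imposed. -/
structure TwoComplex (V E F : Type*) extends MultiGraph V E where
  face : F → List (E × Bool)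
  closedTrail : ∀ f, toMultiGraph.IsClosedTrail (face f)

namespace TwoComplex

open MultiGraph

variable {V E F : Type*} (C : TwoComplex V E F)

/-- The faces that traverse the edge `e`. -/
abbrev FacesAt (e : E) : Type _ := {f : F // e ∈ (C.face f).map Prod.fst}

/-! ### Link graphs -/

/-- A traversal of a vertex by a face: the face `f` traverses a vertex between its directed
edge number `i` and the cyclically next one. -/
abbrev Corner : Type _ := Σ f : F, Fin (C.face f).length

/-- The half-edge at which a face arrives at a corner. -/
def Corner.arrive {C : TwoComplex V E F} (c : C.Corner) : E × Bool :=
  opp ((C.face c.1).get c.2)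

/-- The half-edge at which a face leaves a corner. -/
def Corner.leave {C : TwoComplex V E F} (c : C.Corner) : E × Bool :=
  (C.face c.1).get (finRotate _ c.2)

/-- The link graph at `v`: its vertices are the half-edges at `v` (so a loop gives two
vertices); its edges are the traversals of faces at `v`, each joining the half-edge at which the
face arrives to the one at which it leaves. -/
def link (v : V) :
    MultiGraph {h : E × Bool // C.inc h = v} {c : C.Corner // C.inc c.leave = v} where
  inc k := bif k.2 then ⟨k.1.1.leave, k.1.2⟩
    else ⟨k.1.1.arrive, ((C.closedTrail _).next _).trans k.1.2⟩

def LocallyThreeConnected : Prop := ∀ v, (C.link v).ThreeConnected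

variable {C}

theorem fst_injective (f : F) {i j : Fin (C.face f).length}
    (h : ((C.face f).get i).1 = ((C.face f).get j).1) : i = j := by
  have hn := (C.closedTrail f).2
  have := List.nodup_iff_injective_get.1 hn
    (a₁ := ⟨i, by simp⟩) (a₂ := ⟨j, by simp⟩) (by simpa using h)
  ext
  simpa using this

/-- The face to which an edge of the link graph belongs, for the edges of the link graph
at its vertex `h`. -/
def faceOf {v : V} (h : {h : E × Bool // C.inc h = v})
    (k : {k : {c : C.Corner // C.inc c.leave = v} × Bool // (C.link v).inc k = h}) :
    C.FacesAt h.1.1 :=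
  ⟨k.1.1.1.1, by
    obtain ⟨⟨⟨c, hc⟩, b⟩, rfl⟩ := k
    cases b
    · exact List.mem_map.2 ⟨_, List.get_mem _ c.2, rfl⟩
    · exact List.mem_map.2 ⟨_, List.get_mem _ _, rfl⟩⟩

theorem faceOf_bijective {v : V} (h : {h : E × Bool // C.inc h = v}) :
    Function.Bijective (faceOf h) := by
  constructor
  · rintro ⟨⟨⟨⟨f, i⟩, hi⟩, b⟩, hk⟩ ⟨⟨⟨⟨f', i'⟩, hi'⟩, b'⟩, hk'⟩ hf
    obtain rfl : f = f' := congrArg Subtype.val hf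
    have e := congrArg Subtype.val (hk.trans hk'.symm)
    have key : i = i' ∧ b = b' := by
      cases b <;> cases b'
      · have e' := opp.injective e
        exact ⟨fst_injective f (congrArg Prod.fst e'), rfl⟩
      · have e' : opp ((C.face f).get i) = (C.face f).get (finRotate _ i') := e
        rw [← fst_injective f (congrArg Prod.fst e' :)] at e'
        simpa [opp] using congrArg Prod.snd e'
      · have e' : (C.face f).get (finRotate _ i) = opp ((C.face f).get i') := e
        rw [fst_injective f (congrArg Prod.fst e' :)] at e'
        simpa [opp] using congrArg Prod.snd e'
      · have e' : (C.face f).get (finRotate _ i) = (C.face f).get (finRotate _ i') := e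
        exact ⟨(finRotate _).injective (fst_injective f (congrArg Prod.fst e')), rfl⟩
    obtain ⟨rfl, rfl⟩ := key
    rfl
  · rintro ⟨f, hf⟩
    obtain ⟨⟨e, b⟩, hv⟩ := h
    obtain ⟨d, hd, rfl⟩ := List.mem_map.1 hf
    obtain ⟨i, rfl⟩ := List.mem_iff_get.1 hd
    by_cases hb : ((C.face f).get i).2 = b
    · refine ⟨⟨(⟨⟨f, (finRotate _).symm i⟩, ?_⟩, true), ?_⟩, rfl⟩
      · simp only [Corner.leave, Equiv.apply_symm_apply]
        subst hb
        exact hv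
      · apply Subtype.ext
        simp only [link, cond_true, Corner.leave, Equiv.apply_symm_apply]
        exact Prod.ext rfl hb
    · have ha : opp ((C.face f).get i) = (((C.face f).get i).1, b) := by
        refine Prod.ext rfl ?_
        revert hb
        cases b <;> simp [opp]
      refine ⟨⟨(⟨⟨f, i⟩, ?_⟩, false), ?_⟩, rfl⟩
      · have := (C.closedTrail f).next i
        rw [ha] at this
        exact this.symm.trans hv
      · exact Subtype.ext ha

/-- Since a face traverses an edge at most once, the edges of the link graph at its
vertex `h` correspond to the faces that traverse the edge of `h`. -/
noncomputable def faceEquiv {v : V} (h : {h : E × Bool // C.inc h = v}) :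
    {k : {c : C.Corner // C.inc c.leave = v} × Bool // (C.link v).inc k = h} ≃
      C.FacesAt h.1.1 :=
  Equiv.ofBijective (faceOf h) (faceOf_bijective h)

/-! ### Rotation systems of 2-complexes, local planarity -/

variable (C)

/-- A rotation system of a 2-complex: a cyclic orientation of the faces at every edge. -/
structure RotationSystem where
  rot : ∀ e : E, Equiv.Perm (C.FacesAt e)
  cyclic : ∀ e : E, (rot e).IsCycleOn Set.univ

variable {C}

theorem isCycleOn_permCongr {α β : Type*} (φ : α ≃ β) {s : Equiv.Perm α}
    (h : s.IsCycleOn Set.univ) : (φ.permCongr s).IsCycleOn Set.univ := by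
  refine ⟨(φ.permCongr s).bijective.bijOn_univ, fun x _ y _ => ?_⟩
  obtain ⟨n, hn⟩ := h.2 (Set.mem_univ (φ.symm x)) (Set.mem_univ (φ.symm y))
  refine ⟨n, ?_⟩
  have : (φ.permCongr s) ^ n = φ.permCongr (s ^ n) :=
    (map_zpow φ.permCongrHom s n).symm
  rw [this, Equiv.permCongr_apply, hn, Equiv.apply_symm_apply]

/-- The rotation system of the link graph at `v` induced by a rotation system of the 2-complex:
at a half-edge of `e` it is the rotator of `e` if `e` is directed towards `v` there, and
the reverse of the rotator otherwise. -/
noncomputable def RotationSystem.induced (S : C.RotationSystem) (v : V) :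
    (C.link v).RotationSystem where
  rot h := (faceEquiv h).symm.permCongr (bif h.1.2 then S.rot h.1.1 else (S.rot h.1.1)⁻¹)
  cyclic h := by
    apply isCycleOn_permCongr
    cases h.1.2
    · exact (S.cyclic _).inv
    · exact S.cyclic _

def RotationSystem.Planar (S : C.RotationSystem) : Prop := ∀ v, (S.induced v).Planar

variable (C)

/-- The link graph at `v` has a planar rotation system such that, for every loop `e` at `v`, the
rotators at its two half-edges are reverse to each other, where the edges of the link graph at
these two half-edges are identified if they belong to the same face. -/
def LoopPlanar (v : V) : Prop :=
  ∃ T : (C.link v).RotationSystem, T.Planar ∧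
    ∀ (e : E) (h₀ : C.inc (e, false) = v) (h₁ : C.inc (e, true) = v),
      (faceEquiv ⟨(e, true), h₁⟩).permCongr (T.rot ⟨(e, true), h₁⟩) =
        ((faceEquiv ⟨(e, false), h₀⟩).permCongr (T.rot ⟨(e, false), h₀⟩))⁻¹

def LocallyPlanar : Prop := ∀ v, C.LoopPlanar v

/-! ### Contractions -/

/-- The vertices of the graph obtained by contracting the edges in `X`. -/
def ContractedVertex (X : Set E) : Type _ :=
  Quot fun v w => ∃ e ∈ X, C.inc (e, false) = v ∧ C.inc (e, true) = w

variable {C}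

def ContractedVertex.mk (X : Set E) (v : V) : C.ContractedVertex X := Quot.mk _ v

variable (C)

def contractGraph (X : Set E) : MultiGraph (C.ContractedVertex X) {e : E // e ∉ X} where
  inc h := ContractedVertex.mk X (C.inc (h.1.1, h.2))

open Classical in
/-- Delete the edges in `X` from a list of directed edges. -/
noncomputable def deleteEdges (X : Set E) (l : List (E × Bool)) : List ({e : E // e ∉ X} × Bool) :=
  l.filterMap fun d => if h : d.1 ∉ X then some (⟨d.1, h⟩, d.2) else none

variable {C}

theorem isWalk_deleteEdges (X : Set E) {l : List (E × Bool)} : ∀ {v w : V}, C.IsWalk v l w →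
    (C.contractGraph X).IsWalk (ContractedVertex.mk X v) (deleteEdges X l)
      (ContractedVertex.mk X w) := by
  induction l with
  | nil => rintro v w rfl; rfl
  | cons d l ih =>
    rintro v w ⟨rfl, hw⟩
    obtain ⟨e, b⟩ := d
    by_cases h : e ∈ X
    · have h1 : deleteEdges X ((e, b) :: l) = deleteEdges X l := by simp [deleteEdges, h]
      have h2 : (ContractedVertex.mk X (C.inc (e, b)) : C.ContractedVertex X) =
          ContractedVertex.mk X (C.inc (opp (e, b))) := by
        cases b
        · exact Quot.sound ⟨e, h, rfl, rfl⟩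
        · exact (Quot.sound ⟨e, h, rfl, rfl⟩).symm
      rw [h1, h2]
      exact ih hw
    · have h1 : deleteEdges X ((e, b) :: l) = (⟨e, h⟩, b) :: deleteEdges X l := by
        simp [deleteEdges, h]
      rw [h1]
      exact ⟨rfl, ih hw⟩

theorem mem_deleteEdges (X : Set E) {l : List (E × Bool)} {e : {e : E // e ∉ X}}
    (h : e ∈ (deleteEdges X l).map Prod.fst) : e.1 ∈ l.map Prod.fst := by
  obtain ⟨d, hd, rfl⟩ := List.mem_map.1 h
  obtain ⟨d', hd', h'⟩ := List.mem_filterMap.1 hd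
  split_ifs at h'
  cases h'
  exact List.mem_map.2 ⟨d', hd', rfl⟩

theorem nodup_deleteEdges (X : Set E) {l : List (E × Bool)} (h : (l.map Prod.fst).Nodup) :
    ((deleteEdges X l).map Prod.fst).Nodup := by
  induction l with
  | nil => simp [deleteEdges]
  | cons d l ih =>
    rw [List.map_cons, List.nodup_cons] at h
    by_cases hd : d.1 ∈ X
    · have h1 : deleteEdges X (d :: l) = deleteEdges X l := by simp [deleteEdges, hd]
      rw [h1]
      exact ih h.2
    · have h1 : deleteEdges X (d :: l) = (⟨d.1, hd⟩, d.2) :: deleteEdges X l := by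
        simp [deleteEdges, hd]
      rw [h1, List.map_cons, List.nodup_cons]
      exact ⟨fun hm => h.1 (mem_deleteEdges X hm), ih h.2⟩

variable (C)

/-- The 2-complex obtained by contracting the edges in `X`: the endvertices of every edge in `X` are
identified, and the edges in `X` are deleted from the graph and from all faces. It is used where
`X` consists of one non-loop edge or is the edge set of a path, and then it is the
result of contracting the edges of `X` one after the other. -/
noncomputable def contract (X : Set E) :
    TwoComplex (C.ContractedVertex X) {e : E // e ∉ X} F where
  toMultiGraph := C.contractGraph X
  face f := deleteEdges X (C.face f)
  closedTrail f := by
    obtain ⟨⟨v, hw⟩, hn⟩ := C.closedTrail f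
    exact ⟨⟨_, isWalk_deleteEdges X hw⟩, nodup_deleteEdges X hn⟩

end TwoComplex

/-!
A rotation system of a 2-complex amounts to planar rotation systems of the link graphs for which
the two rotators at every edge are reverse to each other (`exists_planar_of_reverseAt`). The link
graphs are 3-connected, so by Whitney's theorem (`FiberwiseThreeConnected.eq_or_reverse`) their
planar rotation systems are unique up to reversal. Start with the ones that local planarity
provides; they are right at all loops. At any other edge `e` a planar rotation system of the link
graph of `C / e` at the contracted vertex splits into planar rotation systems of the link graphs
at the two endvertices that are reverse to each other at `e`. Hence the rotators at `e` are
reverse to each other either as they are or after reversing one of the two link graphs; say that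
`e` has defect 0 or 1. It remains to reverse some of the link graphs so that the edges of defect 1
are just those at which one of the two link graphs is reversed: the defect has to be the cut of a
vertex set, i.e. it has to be even on all cycles. A shortest closed walk of odd defect is a loop
or a chordless cycle (`exists_cut_of_even`). For a chordless cycle `o`, contract the path `o - e`
such that `C / (o - e)` is locally planar; now `e` is a loop, and splitting the rotation system of
the link graph at the contracted vertex gives planar rotation systems of the link graphs which are
right at all edges of `o` at once (`IsForest.exists_rotation`). By Whitney's theorem they differ
from the ones chosen at first by reversing some link graphs, and so the defect is even on `o`.

All link graphs are treated together, as one graph `C.links` with the half-edges of `C` as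
vertices, and a rotation system is one permutation of its half-edges. Planarity is used in the
form of `TrivialCohomology`: every set of edges that meets the boundary of every union of faces
evenly is a cut. This follows from Euler's formula by counting dimensions over `ZMod 2`
(`Planar.trivialCohomology`), its dual is the Jordan curve theorem for the surface
(`TrivialCohomology.exists_faces`), on which the proof of Whitney's theorem rests, and it passes
from the link graphs of a contraction to those of `C`. So no converse from cohomology to Euler
characteristic is needed: the planar rotation systems in the end are reversals of the given ones.
-/

namespace MultiGraph

variable {V E : Type*}

/-! ### Rotations and vanishing cohomology mod 2 -/

theorem opp_opp (d : E × Bool) : opp (opp d) = d := by simp [opp]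

theorem opp_ne (d : E × Bool) : opp d ≠ d := by
  obtain ⟨e, b⟩ := d
  cases b <;> simp [opp]

theorem eq_or_eq_opp_of_fst_eq {d d' : E × Bool} (h : d.1 = d'.1) : d = d' ∨ d = opp d' := by
  obtain ⟨e, b⟩ := d
  obtain ⟨e', b'⟩ := d'
  obtain rfl : e = e' := h
  cases b <;> cases b' <;> simp [opp]

theorem sum_halfEdges [Fintype E] (F : E × Bool → ZMod 2) :
    ∑ d, F d = ∑ e, (F (e, true) + F (e, false)) := by
  rw [Fintype.sum_prod_type]
  simp

theorem sum_opp [Fintype E] (F : E × Bool → ZMod 2) : ∑ d, F (opp d) = ∑ d, F d :=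
  Equiv.sum_comp opp F

variable (G : MultiGraph V E)

/-- The permutation `σ` of the half-edges is a rotation system: its cycles are the sets of
half-edges at the vertices. -/
def IsRotation (σ : Equiv.Perm (E × Bool)) : Prop :=
  ∀ d d', σ.SameCycle d d' ↔ G.inc d = G.inc d'

/-- The surface given by the rotation `σ` has no first cohomology mod 2: every set `g` of edges that
every face walk traverses an even number of times is a cut `p`. Functions that are constant on
face walks (those invariant under `d ↦ σ (opp d)`) stand for sets of faces, so that the sum over
a face walk need not be mentioned. -/
def TrivialCohomology [Fintype E] (σ : Equiv.Perm (E × Bool)) : Prop :=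
  ∀ g : E → ZMod 2,
    (∀ q : E × Bool → ZMod 2, (∀ d, q (σ (opp d)) = q d) → ∑ d, q d * g d.1 = 0) →
    ∃ p : V → ZMod 2, ∀ d, g d.1 = p (G.inc d) + p (G.inc (opp d))

variable {G}

theorem IsRotation.inc_eq {σ : Equiv.Perm (E × Bool)} (hσ : G.IsRotation σ) (d : E × Bool) :
    G.inc (σ d) = G.inc d :=
  (hσ _ _).1 (Equiv.Perm.sameCycle_apply_left.2 (Equiv.Perm.SameCycle.refl _ _))

theorem IsRotation.inc_symm_eq {σ : Equiv.Perm (E × Bool)} (hσ : G.IsRotation σ)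
    (d : E × Bool) : G.inc (σ.symm d) = G.inc d := by
  rw [← hσ.inc_eq (σ.symm d), Equiv.apply_symm_apply]

/-- A function that does not change along the rotation is constant at every vertex. -/
theorem IsRotation.eq_of_forall {σ : Equiv.Perm (E × Bool)} (hσ : G.IsRotation σ) [Finite E]
    {α : Type*} {F : E × Bool → α} {v : V} (hF : ∀ d, G.inc d = v → F (σ d) = F d)
    {d d' : E × Bool} (hd : G.inc d = v) (hd' : G.inc d' = v) : F d = F d' := by
  obtain ⟨n, -, rfl⟩ := ((hσ d d').2 (hd.trans hd'.symm)).exists_pow_eq'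
  have : ∀ n, G.inc ((σ ^ n) d) = v ∧ F d = F ((σ ^ n) d) := by
    intro n
    induction n with
    | zero => exact ⟨hd, rfl⟩
    | succ n ih =>
      rw [pow_succ', Equiv.Perm.mul_apply, hσ.inc_eq, hF _ ih.1]
      exact ih
  exact (this n).2

/-- Duality: where the first cohomology vanishes, so does the first homology, i.e. every set `g` of
edges that has even degree at all vertices is the boundary of a set `q` of faces. In other words,
the Jordan curve theorem holds. -/
theorem TrivialCohomology.exists_faces [Fintype E] {σ : Equiv.Perm (E × Bool)}
    (h : G.TrivialCohomology σ) (g : E → ZMod 2)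
    (hg : ∀ p : V → ZMod 2, ∑ d, p (G.inc d) * g d.1 = 0) :
    ∃ q : E × Bool → ZMod 2, (∀ d, q (σ (opp d)) = q d) ∧ ∀ d, g d.1 = q d + q (opp d) := by
  -- Otherwise a linear functional would vanish on all boundaries but not at `g`; it is given by an
  -- edge set, which is a cut by assumption, and `g` is even on all cuts.
  let B : Submodule (ZMod 2) (E → ZMod 2) :=
    { carrier := {x | ∃ q : E × Bool → ZMod 2, (∀ d, q (σ (opp d)) = q d) ∧
        ∀ d, x d.1 = q d + q (opp d)}
      add_mem' := by
        rintro x y ⟨q, hq, hx⟩ ⟨r, hr, hy⟩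
        refine ⟨q + r, fun d => ?_, fun d => ?_⟩
        · simp [hq, hr]
        · simp only [Pi.add_apply, hx, hy]
          ring
      zero_mem' := ⟨0, fun d => rfl, fun d => by simp⟩
      smul_mem' := by
        rintro c x ⟨q, hq, hx⟩
        refine ⟨c • q, fun d => ?_, fun d => ?_⟩
        · simp [hq]
        · simp [hx, mul_add] }
  by_contra hcon
  have hgB : g ∉ B := hcon
  obtain ⟨ψ, hψ, hB⟩ := Submodule.exists_le_ker_of_notMem hgB
  classical
  have hψsum : ∀ x, ψ x = ∑ e, x e * ψ (Pi.single e 1) := by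
    intro x
    rw [LinearMap.pi_apply_eq_sum_univ ψ x]
    refine Finset.sum_congr rfl fun e _ => ?_
    rw [smul_eq_mul]
    congr 2
    ext j
    simp [Pi.single_apply, eq_comm]
  obtain ⟨p, hp⟩ := h (fun e => ψ (Pi.single e 1)) (by
    intro q hq
    have h0 : ψ (fun e => q (e, true) + q (e, false)) = 0 := by
      apply hB
      refine ⟨q, hq, ?_⟩
      rintro ⟨e, b⟩
      cases b
      · exact add_comm _ _
      · rfl
    rw [hψsum] at h0
    rw [sum_halfEdges, ← h0]
    exact Finset.sum_congr rfl fun e _ => by ring)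
  apply hψ
  rw [hψsum, ← hg p, sum_halfEdges]
  refine Finset.sum_congr rfl fun e _ => ?_
  have := hp (e, true)
  simp only [opp, Equiv.coe_fn_mk, Bool.not_true] at this
  rw [this]
  ring

/-! ### Rotation systems as permutations -/

theorem RotationSystem.total_coe (S : G.RotationSystem) {v : V} (k : {h // G.inc h = v}) :
    S.total k.1 = (S.rot v k).1 := by
  obtain ⟨h, rfl⟩ := k
  rfl

theorem RotationSystem.inc_total (S : G.RotationSystem) (d : E × Bool) :
    G.inc (S.total d) = G.inc d := by
  rw [S.total_coe ⟨d, rfl⟩]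
  exact (S.rot _ _).2

theorem isRotation_of {σ : Equiv.Perm (E × Bool)} (h1 : ∀ d, G.inc (σ d) = G.inc d)
    (h2 : ∀ d d', G.inc d = G.inc d' → σ.SameCycle d d') : G.IsRotation σ := by
  refine fun d d' => ⟨?_, h2 d d'⟩
  rintro ⟨n, rfl⟩
  have : ∀ n : ℤ, G.inc ((σ ^ n) d) = G.inc d := by
    intro n
    induction n using Int.induction_on with
    | zero => rfl
    | succ n ih => rw [add_comm, zpow_add, Equiv.Perm.mul_apply, zpow_one, h1, ih]
    | pred n ih =>
      rw [← h1, ← Equiv.Perm.mul_apply, ← zpow_one_add, ← ih]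
      congr 3
      ring
  exact (this n).symm

theorem RotationSystem.isRotation_total (S : G.RotationSystem) : G.IsRotation S.total := by
  refine isRotation_of S.inc_total fun d d' h => ?_
  have key : S.total.subtypePerm (p := fun k => G.inc k = G.inc d')
      (fun k => by rw [S.inc_total]) = S.rot (G.inc d') := by
    ext1 k
    exact Subtype.ext (S.total_coe k)
  have := (S.cyclic (G.inc d')).2 (x := ⟨d, h⟩) (Set.mem_univ _) (y := ⟨d', rfl⟩) (Set.mem_univ _)
  rw [← key] at this
  exact Equiv.Perm.sameCycle_subtypePerm.1 this

theorem Adj.symm {v w : V} (h : G.Adj v w) : G.Adj w v := by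
  obtain ⟨k, rfl, rfl⟩ := h
  exact ⟨opp k, rfl, by rw [opp_opp]⟩

theorem ReachableAvoiding.symm {X : Set V} {v w : V} (h : G.ReachableAvoiding X v w) :
    G.ReachableAvoiding X w v := by
  induction h with
  | refl => exact .refl
  | tail _ h ih => exact .head ⟨h.1.symm, h.2.2, h.2.1⟩ ih

theorem Reachable.symm {v w : V} (h : G.Reachable v w) : G.Reachable w v :=
  ReachableAvoiding.symm h

theorem Reachable.trans {u v w : V} (h : G.Reachable u v) (h' : G.Reachable v w) :
    G.Reachable u w :=
  Relation.ReflTransGen.trans h h'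

theorem reachable_opp (d : E × Bool) : G.Reachable (G.inc d) (G.inc (opp d)) :=
  .single ⟨⟨d, rfl, rfl⟩, by simp, by simp⟩

theorem finrank_le_one_of_constant {ι : Type*} {i₀ : ι} (W : Submodule (ZMod 2) (ι → ZMod 2))
    (h : ∀ q ∈ W, ∀ i, q i = q i₀) : Module.finrank (ZMod 2) W ≤ 1 := by
  by_cases hz : ∃ q ∈ W, q ≠ 0
  · obtain ⟨q, hq, hq0⟩ := hz
    have hq1 : q i₀ = 1 := by
      by_contra hne
      apply hq0
      ext i
      rw [h q hq i]
      exact ((Fin.exists_fin_two (p := fun x : Fin 2 => q i₀ = x)).1 ⟨_, rfl⟩).resolve_right hne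
    refine finrank_le_one ⟨q, hq⟩ ?_
    rintro ⟨r, hr⟩
    refine ⟨r i₀, Subtype.ext ?_⟩
    ext i
    simp [h q hq i, h r hr i, hq1]
  · push Not at hz
    rw [(Submodule.eq_bot_iff W).2 hz, finrank_bot]
    exact zero_le_one

/-! ### Euler characteristic two implies vanishing cohomology -/

theorem RotationSystem.surfaceFace_eq_iff (S : G.RotationSystem) {d d' : E × Bool} :
    S.surfaceFace d = S.surfaceFace d' ↔ S.faceNext.SameCycle d d' :=
  Quotient.eq (r := Equiv.Perm.SameCycle.setoid S.faceNext)

theorem RotationSystem.surfaceFace_next (S : G.RotationSystem) (d : E × Bool) :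
    S.surfaceFace (S.total (opp d)) = S.surfaceFace d :=
  S.surfaceFace_eq_iff.2 (Equiv.Perm.sameCycle_apply_left.2 (Equiv.Perm.SameCycle.refl _ _))

open Matrix in
/-- The dimension count in one component: the cuts form a space of dimension at least `V - 1`, and
the edge sets that all faces traverse evenly a space of dimension at most `E - (F - 1) = V - 1`. -/
theorem RotationSystem.Planar.exists_cut_on_component [Fintype E] [Finite V]
    {S : G.RotationSystem} (hS : S.Planar) (g : E → ZMod 2)
    (hg : ∀ q : E × Bool → ZMod 2, (∀ d, q (S.total (opp d)) = q d) → ∑ d, q d * g d.1 = 0)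
    (h : E × Bool) :
    ∃ p : V → ZMod 2, ∀ d, G.Reachable (G.inc h) (G.inc d) →
      g d.1 = p (G.inc d) + p (G.inc (opp d)) := by
  classical
  have hE := hS h
  set Vs : Set V := {v | G.Reachable (G.inc h) v}
  set Es : Set E := {e | G.Reachable (G.inc h) (G.inc (e, false))}
  set Fs : Set S.SurfaceFace :=
    {f | ∃ k, G.Reachable (G.inc h) (G.inc k) ∧ S.surfaceFace k = f}
  have : Finite S.SurfaceFace := Quotient.finite _
  have : Fintype Vs := Fintype.ofFinite _
  have : Fintype Es := Fintype.ofFinite _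
  have : Fintype Fs := Fintype.ofFinite _
  rw [← Nat.card_coe_set_eq, ← Nat.card_coe_set_eq, ← Nat.card_coe_set_eq,
    Nat.card_eq_fintype_card, Nat.card_eq_fintype_card, Nat.card_eq_fintype_card] at hE
  have hmemE : ∀ d : E × Bool, d.1 ∈ Es ↔ G.Reachable (G.inc h) (G.inc d) := by
    rintro ⟨e, b⟩
    cases b
    · rfl
    · exact ⟨fun h' => h'.trans (reachable_opp (e, false)),
        fun h' => h'.trans (reachable_opp (e, true))⟩
  let M : Matrix Es Fs (ZMod 2) := fun e f =>
    (if S.surfaceFace (e.1, true) = f.1 then 1 else 0) +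
      (if S.surfaceFace (e.1, false) = f.1 then 1 else 0)
  let fc : ∀ d : E × Bool, d.1 ∈ Es → Fs := fun d hd =>
    ⟨S.surfaceFace d, d, (hmemE d).1 hd, rfl⟩
  let vx : ∀ d : E × Bool, d.1 ∈ Es → Vs := fun d hd => ⟨G.inc d, (hmemE d).1 hd⟩
  have hM : ∀ (q : Fs → ZMod 2) (e : Es),
      (M *ᵥ q) e = q (fc (e.1, true) e.2) + q (fc (e.1, false) e.2) := by
    intro q e
    have : ∀ d (hd : d.1 ∈ Es), ∑ f : Fs, (if S.surfaceFace d = f.1 then 1 else 0) * q f =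
        q (fc d hd) := by
      intro d hd
      rw [Finset.sum_eq_single (fc d hd)]
      · simp [fc]
      · intro f _ hf
        rw [if_neg, zero_mul]
        intro h'
        exact hf (Subtype.ext h'.symm)
      · simp
    simp only [Matrix.mulVec, dotProduct, M, add_mul, Finset.sum_add_distrib]
    rw [this (e.1, true) e.2, this (e.1, false) e.2]
  -- A set of faces without boundary consists of all faces or of none.
  have hkerM : Module.finrank (ZMod 2) (LinearMap.ker M.mulVecLin) ≤ 1 := by
    have hh : h.1 ∈ Es := (hmemE h).2 .refl
    have hconst : ∀ q ∈ LinearMap.ker M.mulVecLin, ∀ f, q f = q (fc h hh) := by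
      intro q hq
      have hq' : ∀ d (hd : d.1 ∈ Es), q (fc d hd) = q (fc (opp d) hd) := by
        rintro ⟨e, b⟩ hd
        have := congrFun (LinearMap.mem_ker.1 hq) ⟨e, hd⟩
        rw [Matrix.mulVecLin_apply, hM] at this
        have := CharTwo.add_eq_zero.1 this
        cases b
        · exact this.symm
        · exact this
      have hrot : ∀ d (hd : d.1 ∈ Es) (hd' : (S.total d).1 ∈ Es),
          q (fc (S.total d) hd') = q (fc d hd) := by
        intro d hd hd'
        rw [hq' d hd]
        congr 1
        apply Subtype.ext
        have := S.surfaceFace_next (opp d)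
        rwa [opp_opp] at this
      let Q : E × Bool → ZMod 2 := fun d => if hd : d.1 ∈ Es then q (fc d hd) else 0
      have hQ : ∀ v, G.Reachable (G.inc h) v → ∀ d, G.inc d = v → Q d = q (fc h hh) := by
        have hQv : ∀ v, G.Reachable (G.inc h) v → ∀ d d', G.inc d = v → G.inc d' = v →
            Q d = Q d' := by
          intro v hv d d' hd hd'
          refine S.isRotation_total.eq_of_forall (v := v) ?_ hd hd'
          rintro k rfl
          have h1 : k.1 ∈ Es := (hmemE k).2 hv
          have h2 : (S.total k).1 ∈ Es := (hmemE _).2 (by rw [S.inc_total]; exact hv)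
          simp only [Q, dif_pos h1, dif_pos h2]
          exact hrot k h1 h2
        intro v hv
        induction hv with
        | refl =>
          intro d hd
          rw [hQv _ .refl d h hd rfl]
          simp [Q, hh]
        | tail hv hvw ih =>
          obtain ⟨k, rfl, rfl⟩ := hvw.1
          intro d hd
          have hr : G.Reachable (G.inc h) (G.inc k) := hv
          rw [hQv _ (hr.trans (reachable_opp k)) d (opp k) hd rfl, ← ih k rfl]
          have h1 : k.1 ∈ Es := (hmemE k).2 hr
          have h2 : (opp k).1 ∈ Es := h1
          simp only [Q, dif_pos h1, dif_pos h2, hq' k h1]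
      rintro ⟨f, k, hk, rfl⟩
      rw [← hQ _ hk k rfl]
      simp [Q, (hmemE k).2 hk, fc]
    exact finrank_le_one_of_constant _ hconst
  -- The coboundary map; its kernel consists of the constant functions.
  let δ : (Vs → ZMod 2) →ₗ[ZMod 2] (Es → ZMod 2) :=
    { toFun := fun p e => p (vx (e.1, true) e.2) + p (vx (e.1, false) e.2)
      map_add' := fun p p' => by ext e; simp only [Pi.add_apply]; ring
      map_smul' := fun c p => by ext e; simp [mul_add] }
  have hkerδ : Module.finrank (ZMod 2) (LinearMap.ker δ) ≤ 1 := by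
    let v₀ : Vs := ⟨G.inc h, .refl⟩
    have hconst : ∀ p ∈ LinearMap.ker δ, ∀ v, p v = p v₀ := by
      intro p hp
      have hp' : ∀ d (hd : d.1 ∈ Es), p (vx d hd) = p (vx (opp d) hd) := by
        rintro ⟨e, b⟩ hd
        have := CharTwo.add_eq_zero.1 (congrFun (LinearMap.mem_ker.1 hp) ⟨e, hd⟩)
        cases b
        · exact this.symm
        · exact this
      rintro ⟨v, hv⟩
      have : ∀ v, G.Reachable (G.inc h) v → ∀ hv : v ∈ Vs, p ⟨v, hv⟩ = p v₀ := by
        intro v hv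
        induction hv with
        | refl => intro _; rfl
        | tail hv hvw ih =>
          obtain ⟨k, rfl, rfl⟩ := hvw.1
          intro _
          rw [← ih hv]
          exact (hp' k ((hmemE k).2 hv)).symm
      exact this v hv hv
    exact finrank_le_one_of_constant _ hconst
  have hMT : ∀ (x : Es → ZMod 2), x ∈ LinearMap.ker Mᵀ.mulVecLin ↔
      ∀ q : Fs → ZMod 2, ∑ e, x e * (q (fc (e.1, true) e.2) + q (fc (e.1, false) e.2)) = 0 := by
    intro x
    have hx : ∀ q : Fs → ZMod 2, ∑ e, x e * (q (fc (e.1, true) e.2) + q (fc (e.1, false) e.2)) =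
        (Mᵀ *ᵥ x) ⬝ᵥ q := by
      intro q
      rw [Matrix.mulVec_transpose, ← Matrix.dotProduct_mulVec]
      simp only [dotProduct, hM]
    rw [LinearMap.mem_ker, Matrix.mulVecLin_apply]
    simp only [hx]
    constructor
    · intro h q
      rw [h, zero_dotProduct]
    · intro h
      exact dotProduct_eq_zero_iff.1 h
  -- Every vertex is passed by face walks an even number of times in total.
  have hle : LinearMap.range δ ≤ LinearMap.ker Mᵀ.mulVecLin := by
    rintro _ ⟨p, rfl⟩
    rw [hMT]
    intro q
    let P : E × Bool → ZMod 2 := fun d => if hd : d.1 ∈ Es then p (vx d hd) else 0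
    let Q : E × Bool → ZMod 2 := fun d => if hd : d.1 ∈ Es then q (fc d hd) else 0
    have hP : ∀ d, P (S.total d) = P d := by
      intro d
      have : (S.total d).1 ∈ Es ↔ d.1 ∈ Es := by rw [hmemE, hmemE, S.inc_total]
      by_cases hd : d.1 ∈ Es
      · simp only [P, dif_pos hd, dif_pos (this.2 hd)]
        congr 1
        exact Subtype.ext (S.inc_total d)
      · simp only [P, dif_neg hd, dif_neg (mt this.1 hd)]
    have hQ : ∀ d, Q (S.total d) = Q (opp d) := by
      intro d
      have : (S.total d).1 ∈ Es ↔ (opp d).1 ∈ Es := by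
        rw [hmemE, S.inc_total, ← hmemE]
        rfl
      by_cases hd : (opp d).1 ∈ Es
      · simp only [Q, dif_pos hd, dif_pos (this.2 hd)]
        congr 1
        apply Subtype.ext
        have := S.surfaceFace_next (opp d)
        rwa [opp_opp] at this
      · simp only [Q, dif_neg hd, dif_neg (mt this.1 hd)]
    have h1 : ∑ d, P d * (Q d + Q (opp d)) = 0 := by
      have h2 : ∑ d, P d * Q d = ∑ d, P d * Q (opp d) := by
        rw [← Equiv.sum_comp S.total]
        exact Finset.sum_congr rfl fun d _ => by rw [hP, hQ]
      simp only [mul_add, Finset.sum_add_distrib]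
      rw [h2, CharTwo.add_self_eq_zero]
    rw [sum_halfEdges] at h1
    rw [← h1]
    refine Fintype.sum_of_injective (fun e : Es => e.1) Subtype.val_injective _ _ ?_ ?_
    · intro e he
      have : e ∉ Es := fun h' => he ⟨⟨e, h'⟩, rfl⟩
      simp [P, this]
    · rintro ⟨e, he⟩
      simp only [P, Q, opp, Equiv.coe_fn_mk, Bool.not_true, Bool.not_false, dif_pos he]
      rw [add_comm (q (fc (e, false) he)), ← add_mul]
      rfl
  have hfin : Module.finrank (ZMod 2) (LinearMap.ker Mᵀ.mulVecLin) ≤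
      Module.finrank (ZMod 2) (LinearMap.range δ) := by
    have r1 := LinearMap.finrank_range_add_finrank_ker M.mulVecLin
    have r2 := LinearMap.finrank_range_add_finrank_ker Mᵀ.mulVecLin
    have r3 := LinearMap.finrank_range_add_finrank_ker δ
    have r4 : Module.finrank (ZMod 2) (LinearMap.range Mᵀ.mulVecLin) =
      Module.finrank (ZMod 2) (LinearMap.range M.mulVecLin) := Matrix.rank_transpose M
    simp only [Module.finrank_fintype_fun_eq_card] at r1 r2 r3
    omega
  have heq := Submodule.eq_of_le_of_finrank_le hle hfin
  have hgmem : (fun e : Es => g e.1) ∈ LinearMap.ker Mᵀ.mulVecLin := by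
    rw [hMT]
    intro q
    let Q : E × Bool → ZMod 2 := fun d =>
      if hd : S.surfaceFace d ∈ Fs then q ⟨S.surfaceFace d, hd⟩ else 0
    have hQ : ∀ d, Q (S.total (opp d)) = Q d := fun d => by simp only [Q, S.surfaceFace_next]
    have hQ0 : ∀ d, d.1 ∉ Es → Q d = 0 := by
      intro d hd
      refine dif_neg ?_
      rintro ⟨k, hk, hkd⟩
      have hφ : ∀ k, G.Reachable (G.inc h) (G.inc (S.faceNext k)) ↔
          G.Reachable (G.inc h) (G.inc k) := by
        intro k
        have h1 : G.inc (S.faceNext k) = G.inc (opp k) := S.inc_total (opp k)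
        rw [h1]
        exact ⟨fun h' => h'.trans (reachable_opp k).symm, fun h' => h'.trans (reachable_opp k)⟩
      obtain ⟨n, -, rfl⟩ := (S.surfaceFace_eq_iff.1 hkd).exists_pow_eq'
      apply hd
      rw [hmemE]
      clear hkd hd
      induction n with
      | zero => exact hk
      | succ n ih =>
        rw [pow_succ', Equiv.Perm.mul_apply, hφ]
        exact ih
    rw [← hg Q hQ, sum_halfEdges]
    refine Fintype.sum_of_injective (fun e : Es => e.1) Subtype.val_injective _ _ ?_ ?_
    · intro e he
      have : e ∉ Es := fun h' => he ⟨⟨e, h'⟩, rfl⟩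
      simp [hQ0 (e, true) this, hQ0 (e, false) this]
    · rintro ⟨e, he⟩
      have h1 : ∀ b, Q (e, b) = q (fc (e, b) he) := fun b =>
        dif_pos (⟨(e, b), (hmemE (e, b)).1 he, rfl⟩ : S.surfaceFace (e, b) ∈ Fs)
      simp only [h1]
      ring
  rw [← heq] at hgmem
  obtain ⟨p, hp⟩ := hgmem
  refine ⟨fun v => if hv : v ∈ Vs then p ⟨v, hv⟩ else 0, ?_⟩
  intro d hd
  have hd1 := (hmemE d).2 hd
  have h1 : G.inc d ∈ Vs := hd
  have h2 : G.inc (opp d) ∈ Vs := hd.trans (reachable_opp d)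
  have h3 := congrFun hp ⟨d.1, hd1⟩
  simp only [dif_pos h1, dif_pos h2]
  obtain ⟨e, b⟩ := d
  cases b
  · exact h3.symm.trans (add_comm _ _)
  · exact h3.symm

theorem RotationSystem.Planar.trivialCohomology [Fintype E] [Finite V]
    {S : G.RotationSystem} (hS : S.Planar) : G.TrivialCohomology S.total := by
  classical
  intro g hg
  choose p hp using hS.exists_cut_on_component g hg
  let A : V → Set (E × Bool) := fun v => {h | G.Reachable (G.inc h) v}
  have hA : ∀ v w, G.Reachable v w → A v = A w := fun v w hvw =>
    Set.ext fun h => ⟨fun h' => Reachable.trans h' hvw, fun h' => Reachable.trans h' hvw.symm⟩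
  let P : Set (E × Bool) → V → ZMod 2 := fun B => if hB : B.Nonempty then p hB.some else 0
  refine ⟨fun v => P (A v) v, fun d => ?_⟩
  have hne : (A (G.inc d)).Nonempty := ⟨d, .refl⟩
  simp only [← hA _ _ (reachable_opp d), P, dif_pos hne]
  exact hp _ d hne.some_mem

/-! ### Reversing a rotation system -/

/-- The mirror image of a rotation system. -/
def RotationSystem.reverse (S : G.RotationSystem) : G.RotationSystem where
  rot v := (S.rot v)⁻¹
  cyclic v := (S.cyclic v).inv

theorem RotationSystem.total_reverse (S : G.RotationSystem) (d : E × Bool) :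
    S.reverse.total d = S.total.symm d := by
  rw [Equiv.eq_symm_apply, S.reverse.total_coe ⟨d, rfl⟩, S.total_coe]
  exact congrArg Subtype.val ((S.rot (G.inc d)).apply_symm_apply ⟨d, rfl⟩)

theorem RotationSystem.surfaceFace_reverse_eq_iff (S : G.RotationSystem) {d d' : E × Bool} :
    S.reverse.surfaceFace d = S.reverse.surfaceFace d' ↔
      S.surfaceFace (opp d) = S.surfaceFace (opp d') := by
  rw [surfaceFace_eq_iff, surfaceFace_eq_iff]
  have : S.reverse.faceNext = opp * S.faceNext⁻¹ * opp⁻¹ := by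
    ext1 d
    refine (S.total_reverse (opp d)).trans ?_
    exact (opp.apply_symm_apply _).symm
  rw [this, Equiv.Perm.sameCycle_conj, Equiv.Perm.sameCycle_inv]
  rfl

theorem RotationSystem.Planar.reverse {S : G.RotationSystem} (hS : S.Planar) :
    S.reverse.Planar := by
  intro h
  rw [← hS h]
  congr 2
  let φ : S.reverse.SurfaceFace → S.SurfaceFace :=
    Quotient.lift (fun d => S.surfaceFace (opp d)) fun d d' hd =>
      S.surfaceFace_reverse_eq_iff.1 (S.reverse.surfaceFace_eq_iff.2 hd)
  have hφ : Function.Injective φ := by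
    rintro ⟨d⟩ ⟨d'⟩ hd
    exact S.surfaceFace_reverse_eq_iff.2 hd
  rw [← Set.ncard_image_of_injective _ hφ]
  congr 1
  ext f
  constructor
  · rintro ⟨_, ⟨k, hk, rfl⟩, rfl⟩
    exact ⟨opp k, hk.trans (reachable_opp k), rfl⟩
  · rintro ⟨k, hk, rfl⟩
    refine ⟨_, ⟨opp k, hk.trans (reachable_opp k), rfl⟩, ?_⟩
    change S.surfaceFace (opp (opp k)) = _
    rw [opp_opp]

end MultiGraph

namespace MultiGraph

variable {V E I : Type*}

/-! ### Face walks in 3-connected graphs -/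

/-- The graph consists of disjoint parts, the fibres of `cl`, each of which is simple and remains
connected after the deletion of at most two vertices. -/
structure FiberwiseThreeConnected (G : MultiGraph V E) (cl : V → I) : Prop where
  cl_opp : ∀ d, cl (G.inc (opp d)) = cl (G.inc d)
  no_loop : ∀ d, G.inc (opp d) ≠ G.inc d
  simple : ∀ d d', G.inc d = G.inc d' → G.inc (opp d) = G.inc (opp d') → d = d'
  conn : ∀ X : Finset V, X.card < 3 → ∀ v w : V, cl v = cl w → v ∉ X → w ∉ X →
    G.ReachableAvoiding (X : Set V) v w

variable {G : MultiGraph V E} {cl : V → I} {σ τ : Equiv.Perm (E × Bool)}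

theorem ReachableAvoiding.eq_of_forall {α : Type*} {p : V → α} {X : Set V} {v w : V}
    (h : G.ReachableAvoiding X v w)
    (hp : ∀ d, G.inc d ∉ X → G.inc (opp d) ∉ X → p (G.inc (opp d)) = p (G.inc d)) :
    p v = p w := by
  induction h with
  | refl => rfl
  | tail _ h ih =>
    obtain ⟨⟨d, rfl, rfl⟩, hv, hw⟩ := h
    rw [ih, hp d hv hw]

/-- The successor function along the face walks of the surface given by the rotation `σ`. -/
def faceStep (σ : Equiv.Perm (E × Bool)) : Equiv.Perm (E × Bool) := opp.trans σ

theorem faceStep_apply (σ : Equiv.Perm (E × Bool)) (d : E × Bool) :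
    faceStep σ d = σ (opp d) := rfl

/-- For half-edges `x` and `x'` at the same vertex, the indicator function of the half-edges from
`x` up to just before `x'` in the rotation `σ`. -/
theorem exists_arc [Fintype E] (hσ : G.IsRotation σ) {x x' : E × Bool}
    (hx : G.inc x = G.inc x') :
    ∃ u : E × Bool → ZMod 2, (∀ d, G.inc d ≠ G.inc x → u d = 0) ∧
      (∀ F : E × Bool → ZMod 2, ∑ d, u d * (F d + F (σ d)) = F x + F x') ∧
      (∀ d, x ≠ x' → d = x ∨ d = x' → u d ≠ u (σ.symm d)) := by
  classical
  obtain ⟨k, -, rfl⟩ := ((hσ x x').2 hx).exists_pow_eq'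
  obtain ⟨u, hu0, hu⟩ : ∃ u : E × Bool → ZMod 2, (∀ d, G.inc d ≠ G.inc x → u d = 0) ∧
      (∀ F : E × Bool → ZMod 2, ∑ d, u d * (F d + F (σ d)) = F x + F ((σ ^ k) x)) := by
    clear hx
    induction k with
    | zero => exact ⟨0, fun _ _ => rfl, fun F => by simp [CharTwo.add_self_eq_zero]⟩
    | succ k ih =>
      obtain ⟨u, hu0, hu⟩ := ih
      have hk : G.inc ((σ ^ k) x) = G.inc x :=
        ((hσ _ _).1 (Equiv.Perm.sameCycle_pow_left.2 (.refl _ _)))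
      refine ⟨u + Pi.single ((σ ^ k) x) 1, fun d hd => ?_, fun F => ?_⟩
      · have : d ≠ (σ ^ k) x := by rintro rfl; exact hd hk
        simp [hu0 d hd, Pi.single_eq_of_ne this]
      · simp only [Pi.add_apply, add_mul, Finset.sum_add_distrib, hu, Pi.single_apply, ite_mul,
          one_mul, zero_mul, Finset.sum_ite_eq', Finset.mem_univ, if_true]
        rw [pow_succ', Equiv.Perm.mul_apply]
        linear_combination (CharTwo.add_self_eq_zero (F ((σ ^ k) x)))
  refine ⟨u, hu0, hu, ?_⟩
  rintro d hne hd heq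
  have h := hu (Pi.single d 1)
  have h1 : ∀ d', u d' * ((Pi.single d 1 : E × Bool → ZMod 2) d' +
      (Pi.single d 1 : E × Bool → ZMod 2) (σ d')) =
      (if d' = d then u d' else 0) + (if d' = σ.symm d then u d' else 0) := by
    intro d'
    have : σ d' = d ↔ d' = σ.symm d := (Equiv.eq_symm_apply σ).symm
    simp only [Pi.single_apply, this, mul_add, mul_ite, mul_one, mul_zero]
  simp only [h1, Finset.sum_add_distrib, Finset.sum_ite_eq', Finset.mem_univ, if_true, heq,
    CharTwo.add_self_eq_zero] at h
  rcases hd with rfl | rfl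
  · simp [Pi.single_eq_of_ne hne.symm] at h
  · simp [Pi.single_eq_of_ne hne] at h

/-- The sum over the faces `q` of the edges given by the indicator function `u` of an arc. -/
theorem sum_arc [Fintype E] {u q : E × Bool → ZMod 2} (hq : ∀ d, q (σ (opp d)) = q d) :
    ∑ d, q d * (u d + u (opp d)) = ∑ d, u d * (q d + q (σ d)) := by
  have h1 : ∀ d, q (opp d) = q (σ d) := fun d => by rw [← hq (opp d), opp_opp]
  have h2 : ∑ d, q d * u (opp d) = ∑ d, q (opp d) * u d := by
    rw [← sum_opp]
    exact Finset.sum_congr rfl fun d _ => by rw [opp_opp]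
  simp only [mul_add, Finset.sum_add_distrib]
  rw [h2]
  simp only [h1, mul_comm]

/-- A set of faces is constant on face walks. -/
theorem eq_of_sameCycle_face [Finite E] {α : Type*} {q : E × Bool → α}
    (hq : ∀ d, q (σ (opp d)) = q d)
    {d d' : E × Bool} (h : (faceStep σ).SameCycle d d') : q d' = q d := by
  obtain ⟨n, -, rfl⟩ := h.exists_pow_eq'
  clear h
  induction n with
  | zero => rfl
  | succ n ih => rw [pow_succ', Equiv.Perm.mul_apply, ← ih]; exact hq _

namespace FiberwiseThreeConnected

variable (hG : FiberwiseThreeConnected G cl)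
include hG

theorem conn_eq {α : Type*} {p : V → α} (X : Finset V) (hX : X.card < 3)
    (hp : ∀ d, G.inc d ∉ X → G.inc (opp d) ∉ X → p (G.inc (opp d)) = p (G.inc d))
    {v w : V} (hvw : cl v = cl w) (hv : v ∉ X) (hw : w ∉ X) : p v = p w :=
  (hG.conn X hX v w hvw hv hw).eq_of_forall fun d h h' =>
    hp d (by simpa using h) (by simpa using h')

variable [Fintype E]

/-- A face walk visits every vertex at most once: otherwise this vertex would separate the graph. -/
theorem eq_of_sameFace (hσ : G.IsRotation σ) (hc : G.TrivialCohomology σ) {b y : E × Bool}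
    (hby : G.inc b = G.inc y) (hf : (faceStep σ).SameCycle b y) : b = y := by
  by_contra hne
  obtain ⟨u, hu0, hu, hu1⟩ := exists_arc hσ hby
  obtain ⟨p, hp⟩ := hc (fun e => u (e, true) + u (e, false)) (by
    intro q hq
    have h1 : ∀ d : E × Bool, u (d.1, true) + u (d.1, false) = u d + u (opp d) := by
      rintro ⟨e, b⟩
      cases b
      · exact add_comm _ _
      · rfl
    simp only [h1]
    rw [sum_arc hq, hu, eq_of_sameCycle_face hq hf, CharTwo.add_self_eq_zero])
  have hp' : ∀ d, u d + u (opp d) = p (G.inc d) + p (G.inc (opp d)) := by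
    intro d
    rw [← hp d]
    obtain ⟨e, b⟩ := d
    cases b
    · exact add_comm _ _
    · rfl
  set v := G.inc b
  have hp2 : ∀ d, G.inc d = v → u d = p v + p (G.inc (opp d)) := by
    intro d hd
    have := hp' d
    rwa [hu0 (opp d) (by rw [← hd]; exact hG.no_loop d), add_zero, hd] at this
  have hconst : ∀ d d', G.inc d = v → G.inc d' = v → u d = u d' := by
    intro d d' hd hd'
    rw [hp2 d hd, hp2 d' hd']
    congr 1
    refine hG.conn_eq {v} (by simp) ?_ ?_ ?_ ?_
    · intro k hk hk'
      have := hp' k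
      rw [hu0 k (by simpa using hk), hu0 _ (by simpa using hk'), add_zero] at this
      exact (CharTwo.add_eq_zero.1 this.symm).symm
    · rw [hG.cl_opp, hG.cl_opp, hd, hd']
    · simpa [← hd] using hG.no_loop d
    · simpa [← hd'] using hG.no_loop d'
  exact hu1 b hne (Or.inl rfl) (hconst _ _ rfl (hσ.inc_symm_eq b))

/-- If the faces after `σ.symm b` and after `σ.symm x'` at `v` meet in another vertex `z`, then
`{v, z}` would separate the graph, unless one of the two arcs at `v` between these faces consists
just of one edge to `z`; in particular an edge to `z` is next to each of the two faces. -/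
theorem opp_eq_of_faces_meet (hσ : G.IsRotation σ) (hc : G.TrivialCohomology σ)
    {b x' y y' : E × Bool} (hbx : G.inc b = G.inc x') (hyy : G.inc y = G.inc y')
    (hby : (faceStep σ).SameCycle b y) (hxy : (faceStep σ).SameCycle x' y')
    (hz : G.inc y ≠ G.inc b) (hne : b ≠ x') {d : E × Bool} (hd : d = b ∨ d = x') :
    G.inc (opp d) = G.inc y ∨ G.inc (opp (σ.symm d)) = G.inc y := by
  classical
  obtain ⟨u, hu0, hu, hu1⟩ := exists_arc hσ hbx
  obtain ⟨u', hu0', hu', -⟩ := exists_arc hσ hyy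
  have h1 : ∀ (u : E × Bool → ZMod 2) (d : E × Bool),
      u (d.1, true) + u (d.1, false) = u d + u (opp d) := by
    rintro u ⟨e, b⟩
    cases b
    · exact add_comm _ _
    · rfl
  obtain ⟨p, hp⟩ := hc (fun e => (u (e, true) + u (e, false)) + (u' (e, true) + u' (e, false))) (by
    intro q hq
    simp only [h1, mul_add (q _) (u _ + _), Finset.sum_add_distrib]
    rw [sum_arc hq, hu, sum_arc hq, hu', eq_of_sameCycle_face hq hby, eq_of_sameCycle_face hq hxy,
      CharTwo.add_self_eq_zero])
  simp only [h1] at hp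
  set v := G.inc b
  set z := G.inc y
  have hp2 : ∀ d, G.inc d = v → G.inc (opp d) ≠ z → u d = p v + p (G.inc (opp d)) := by
    intro d hd hdz
    have := hp d
    rwa [hu0 (opp d) (by rw [← hd]; exact hG.no_loop d), add_zero,
      hu0' d (by rw [hd]; exact hz.symm),
      hu0' _ hdz, add_zero, add_zero, hd] at this
  have hconst : ∀ d d', G.inc d = v → G.inc d' = v → G.inc (opp d) ≠ z →
      G.inc (opp d') ≠ z → u d = u d' := by
    intro d d' hd hd' hdz hdz'
    rw [hp2 d hd hdz, hp2 d' hd' hdz']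
    congr 1
    refine hG.conn_eq {v, z} (lt_of_le_of_lt Finset.card_le_two (by norm_num)) ?_ ?_ ?_ ?_
    · intro k hk hk'
      have := hp k
      simp only [Finset.mem_insert, Finset.mem_singleton, not_or] at hk hk'
      rw [hu0 k hk.1, hu0 _ hk'.1, hu0' k hk.2, hu0' _ hk'.2, add_zero, add_zero] at this
      exact (CharTwo.add_eq_zero.1 this.symm).symm
    · rw [hG.cl_opp, hG.cl_opp, hd, hd']
    · have := hG.no_loop d
      rw [hd] at this
      simp [this, hdz]
    · have := hG.no_loop d'
      rw [hd'] at this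
      simp [this, hdz']
  by_contra hcon
  rw [not_or] at hcon
  have hdv : G.inc d = v := by
    rcases hd with rfl | rfl
    · rfl
    · exact hbx.symm
  exact hu1 d hne hd (hconst _ _ hdv ((hσ.inc_symm_eq d).trans hdv) hcon.1 hcon.2)

end FiberwiseThreeConnected

/-- If `q` changes along no vertex that the face walk from `x'` to `y` visits in between, then it
does not change between the first and the last edge of this walk. -/
theorem transport_along_face [Finite E] {α : Type*} {q : E × Bool → α} {x' y : E × Bool}
    (hf : (faceStep σ).SameCycle x' y)
    (hq : ∀ t, (faceStep σ).SameCycle x' (σ t) → σ t ≠ x' → σ t ≠ y → q (opp (σ t)) = q t) :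
    q (opp x') = q (σ.symm y) := by
  classical
  have hex : ∃ n, ((faceStep σ) ^ (n + 1)) x' = y := by
    obtain ⟨n, hn, -, hy⟩ := hf.exists_pow_eq''
    exact ⟨n - 1, by rwa [Nat.sub_add_cancel hn]⟩
  have hmin := fun m => Nat.find_min (m := m) hex
  have hspec := Nat.find_spec hex
  set N := Nat.find hex
  have hx : ∀ j, 0 < j → j ≤ N → ((faceStep σ) ^ j) x' ≠ x' := by
    intro j hj hjN h
    refine hmin (N - j) (by omega) ?_
    rw [← hspec, show N + 1 = (N - j + 1) + j by omega, pow_add _ _ j, Equiv.Perm.mul_apply, h]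
  have key : ∀ j, j ≤ N → q (opp (((faceStep σ) ^ j) x')) = q (opp x') := by
    intro j
    induction j with
    | zero => intro _; rfl
    | succ j ih =>
      intro hj
      have h1 : ((faceStep σ) ^ (j + 1)) x' = σ (opp (((faceStep σ) ^ j) x')) := by
        rw [pow_succ', Equiv.Perm.mul_apply]
        rfl
      rw [← ih (by omega)]
      rw [h1]
      apply hq
      · rw [← h1]
        exact Equiv.Perm.sameCycle_pow_right.2 (.refl _ _)
      · rw [← h1]
        exact hx _ (by omega) hj
      · rw [← h1]
        exact hmin j (by omega)
  rw [← key N le_rfl]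
  congr 1
  rw [Equiv.eq_symm_apply, ← hspec, pow_succ', Equiv.Perm.mul_apply]
  rfl

end MultiGraph

namespace MultiGraph

variable {V E I : Type*} {G : MultiGraph V E} {cl : V → I} {σ τ : Equiv.Perm (E × Bool)}

/-! ### Whitney's theorem -/

theorem IsRotation.induction (hσ : G.IsRotation σ) [Finite E] {P : E × Bool → Prop}
    {d : E × Bool} (hd : P d) (hP : ∀ k, G.inc k = G.inc d → P k → P (σ k)) {d' : E × Bool}
    (h : G.inc d = G.inc d') : P d' := by
  obtain ⟨n, -, rfl⟩ := ((hσ d d').2 h).exists_pow_eq'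
  clear h
  have : G.inc ((σ ^ n) d) = G.inc d ∧ P ((σ ^ n) d) := by
    induction n with
    | zero => exact ⟨rfl, hd⟩
    | succ n ih =>
      rw [pow_succ', Equiv.Perm.mul_apply, hσ.inc_eq]
      exact ⟨ih.1, hP _ ih.1 ih.2⟩
  exact this.2

/-- A function that changes at most at one step of the rotation at a vertex does not change at all:
one can go the other way round. -/
theorem IsRotation.eq_of_forall_ne (hσ : G.IsRotation σ) [Finite E]
    {α : Type*} {F : E × Bool → α} {d₀ : E × Bool}
    (hF : ∀ d, G.inc d = G.inc d₀ → d ≠ d₀ → F (σ d) = F d)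
    {d : E × Bool} (hd : G.inc d₀ = G.inc d) : F d = F (σ d₀) := by
  refine hσ.induction (P := fun k => F k = F (σ d₀)) (d := σ d₀) rfl ?_
    ((hσ.inc_eq d₀).trans hd)
  intro k hk hFk
  by_cases hkd : k = d₀
  · rw [hkd]
  · rw [hF k (hk.trans (hσ.inc_eq d₀)) hkd, hFk]

theorem IsRotation.eq_of_apply_eq (hσ : G.IsRotation σ) [Finite E] {d d' : E × Bool}
    (h : σ d = d) (hd : G.inc d = G.inc d') : d' = d :=
  hσ.induction (P := fun k => k = d) rfl (fun k _ hk => by rw [hk, h]) hd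

theorem IsRotation.eq_or_eq_of_apply_apply_eq (hσ : G.IsRotation σ) [Finite E] {d d' : E × Bool}
    (h : σ (σ d) = d) (hd : G.inc d = G.inc d') : d' = d ∨ d' = σ d :=
  hσ.induction (P := fun k => k = d ∨ k = σ d) (Or.inl rfl)
    (fun k _ hk => by rcases hk with rfl | rfl <;> simp [h]) hd

theorem sameCycle_opp_iff {b d : E × Bool} :
    (faceStep σ).SameCycle b (opp d) ↔ (faceStep σ).SameCycle b (σ d) := by
  rw [← Equiv.Perm.sameCycle_apply_right (y := opp d), faceStep_apply, opp_opp]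

open Classical in
/-- The boundary of a face of `σ` has even degree everywhere. If the surface of `τ` satisfies the
Jordan curve theorem, it is therefore the boundary of a set `q` of faces of `τ`. -/
theorem TrivialCohomology.exists_sides [Fintype E] (hσ : G.IsRotation σ)
    (hc : G.TrivialCohomology τ) (b : E × Bool) {o : E × Bool → ZMod 2}
    (ho : o = fun d => if (faceStep σ).SameCycle b d then 1 else 0) :
    ∃ q : E × Bool → ZMod 2, (∀ d, q (τ d) = q d + (o d + o (opp d))) ∧
      ∀ d, q (opp d) = q d + (o d + o (opp d)) := by
  have h1 : ∀ (d : E × Bool), o (d.1, true) + o (d.1, false) = o d + o (opp d) := by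
    rintro ⟨e, b⟩
    cases b
    · exact add_comm _ _
    · rfl
  have h2 : ∀ d, o (opp d) = o (σ d) := fun d => by simp only [ho, sameCycle_opp_iff]
  obtain ⟨q, hq, hg⟩ := hc.exists_faces (fun e => o (e, true) + o (e, false)) (by
    intro p
    simp only [h1, h2, mul_add, Finset.sum_add_distrib]
    have : ∑ d, p (G.inc d) * o (σ d) = ∑ d, p (G.inc d) * o d := by
      rw [← Equiv.sum_comp σ (fun d => p (G.inc d) * o d)]
      simp only [hσ.inc_eq]
    rw [this, CharTwo.add_self_eq_zero])
  simp only [h1] at hg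
  have h3 : ∀ d, q (opp d) = q d + (o d + o (opp d)) := by
    intro d
    rw [hg d, ← add_assoc, CharTwo.add_self_eq_zero, zero_add]
  refine ⟨q, fun d => ?_, h3⟩
  rw [← h3, ← hq (opp d), opp_opp]

namespace FiberwiseThreeConnected

variable (hG : FiberwiseThreeConnected G cl) [Fintype E]
include hG

/-- Half-edges that are consecutive in one planar rotation system are consecutive in every other
one. Otherwise the boundary of the face of `σ` between `a` and `σ a` would separate, in the
surface of `τ`, other edges at this vertex from each other. But any two of these can be joined
along other faces of `σ` at this vertex, and these are disjoint from the first face. -/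
theorem consecutive (hσ : G.IsRotation σ) (hτ : G.IsRotation τ) (hcσ : G.TrivialCohomology σ)
    (hcτ : G.TrivialCohomology τ) (a : E × Bool) : τ (σ a) = a ∨ τ a = σ a := by
  classical
  obtain ⟨b, hb⟩ : ∃ b, b = σ a := ⟨_, rfl⟩
  have hab : G.inc b = G.inc a := by rw [hb, hσ.inc_eq]
  have hba : σ.symm b = a := by rw [hb, Equiv.symm_apply_apply]
  by_cases hne : a = b
  · right
    rw [← hb, ← hne]
    exact hσ.eq_of_apply_eq (hb.symm.trans hne.symm) (hτ.inc_eq a).symm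
  obtain ⟨o, ho⟩ : ∃ o : E × Bool → ZMod 2,
    o = fun d => if (faceStep σ).SameCycle b d then 1 else 0 := ⟨_, rfl⟩
  -- The boundary of the face of `σ` that contains `b` is also the boundary of a set `q` of faces of
  -- `τ`.
  obtain ⟨q, hqτ, hqo⟩ := hcτ.exists_sides hσ b ho
  have hO : ∀ d, G.inc d = G.inc b → ((faceStep σ).SameCycle b d ↔ d = b) := by
    intro d hd
    exact ⟨fun h => (hG.eq_of_sameFace hσ hcσ hd.symm h).symm, fun h => h ▸ .refl _ _⟩
  have hod : ∀ d, G.inc d = G.inc b → o d = if d = b then 1 else 0 := by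
    intro d hd
    simp only [ho, hO d hd]
  have hoo : ∀ d, G.inc d = G.inc b → o (opp d) = if d = a then 1 else 0 := by
    intro d hd
    have : σ d = b ↔ d = a := by rw [hb]; exact σ.injective.eq_iff
    simp only [ho, sameCycle_opp_iff, hO _ ((hσ.inc_eq d).trans hd), this]
  have hoff : ∀ d, G.inc d = G.inc b → d ≠ a → d ≠ b → o d + o (opp d) = 0 := by
    intro d hd hda hdb
    rw [hod d hd, hoo d hd, if_neg hda, if_neg hdb, add_zero]
  -- Next to each other in `σ`, the edges at `x'` and `σ.symm x'` are joined along a face of `σ`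
  -- which does not meet the face of `b` in any other vertex; on the way `q` does not change.
  have hother : ∀ x', G.inc x' = G.inc b → x' ≠ a → x' ≠ b → σ.symm x' ≠ a → σ.symm x' ≠ b →
      q x' = q (σ.symm x') := by
    intro x' hx hxa hxb hxa' hxb'
    have h1 := hqo x'
    rw [hoff x' hx hxa hxb, add_zero] at h1
    rw [← h1]
    refine transport_along_face (y := x') (.refl _ _) ?_
    intro t ht htx _
    have htz : G.inc (σ t) ≠ G.inc x' := fun h =>
      htx (hG.eq_of_sameFace hσ hcσ h.symm ht).symm
    have hno : ∀ y, G.inc y = G.inc (σ t) → ¬ (faceStep σ).SameCycle b y := by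
      intro y hy hby
      have hz : G.inc y ≠ G.inc b := by rw [hy, ← hx]; exact htz
      have hm := fun d => hG.opp_eq_of_faces_meet hσ hcσ hx.symm hy hby ht hz hxb.symm (d := d)
      have hs : ∀ d d', G.inc d = G.inc b → G.inc d' = G.inc b → G.inc (opp d) = G.inc y →
          G.inc (opp d') = G.inc y → d = d' := fun d d' h1 h2 h3 h4 =>
        hG.simple d d' (h1.trans h2.symm) (h3.trans h4.symm)
      have hx' : G.inc (σ.symm x') = G.inc b := (hσ.inc_symm_eq x').trans hx
      rcases hm b (Or.inl rfl) with h1 | h1 <;> rcases hm x' (Or.inr rfl) with h2 | h2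
      · exact hxb (hs _ _ hx rfl h2 h1)
      · exact hxb' (hs _ _ hx' rfl h2 h1)
      · exact hxa (hs _ _ hx (by rw [hba, hab]) h2 h1 |>.trans hba)
      · exact hxa' (hs _ _ hx' (by rw [hba, hab]) h2 h1 |>.trans hba)
    have hz0 : ∀ d, G.inc d = G.inc (σ t) → o d + o (opp d) = 0 := by
      intro d hd
      simp only [ho, sameCycle_opp_iff, if_neg (hno d hd),
        if_neg (hno (σ d) ((hσ.inc_eq d).trans hd)), add_zero]
    rw [hqo, hz0 _ rfl, add_zero]
    refine hτ.eq_of_forall (v := G.inc (σ t)) ?_ rfl (hσ.inc_eq t).symm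
    intro d hd
    rw [hqτ, hz0 d hd, add_zero]
  have hconst : ∀ d, G.inc d = G.inc b → d ≠ a → d ≠ b → q d = q (σ b) := by
    intro d hd hda hdb
    have h := hσ.eq_of_forall_ne (F := fun d => if d = a ∨ d = b then q (σ b) else q d)
      (d₀ := σ.symm a) (d := d) ?_ (by rw [hσ.inc_symm_eq, hd, hab])
    · simpa [hda, hdb] using h
    · intro k hk hka
      have hka' : σ k ≠ a := fun h => hka (by rw [← h, Equiv.symm_apply_apply])
      have hkb : σ k = b ↔ k = a := by rw [hb]; exact σ.injective.eq_iff
      by_cases h1 : k = a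
      · simp [h1, ← hb]
      by_cases h2 : k = b
      · subst h2
        simp
      have h3 : σ k ≠ b := mt hkb.1 h1
      simp only [h1, h2, h3, hka', or_self, if_false]
      have h4 := hother (σ k) (by rw [hσ.inc_eq, hk, hσ.inc_symm_eq, hab]) hka' h3
      rw [Equiv.symm_apply_apply] at h4
      exact h4 h1 h2
  -- So `q` has one value away from `a` and `b`, but it changes by one at `a`.
  by_contra hcon
  rw [not_or, ← hb] at hcon
  have hfix : ∀ d, G.inc d = G.inc b → τ d ≠ d := by
    intro d hd h
    have h1 := hτ.eq_of_apply_eq h (d' := a) (hd.trans hab)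
    have h2 := hτ.eq_of_apply_eq h (d' := b) hd
    exact hne (h1.trans h2.symm)
  have h1 : q (τ a) = q (σ b) :=
    hconst _ (by rw [hτ.inc_eq, hab]) (hfix a hab.symm) hcon.2
  have h2 : q a = q (σ b) := by
    obtain ⟨y, hy⟩ := τ.surjective a
    have hyv : G.inc y = G.inc b := by rw [← hτ.inc_eq, hy, hab]
    have hya : y ≠ a := by
      rintro rfl
      exact hfix _ hyv hy
    have hyb : y ≠ b := by
      rintro rfl
      exact hcon.1 hy
    have := hqτ y
    rw [hy, hoff y hyv hya hyb, add_zero] at this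
    rw [this, hconst y hyv hya hyb]
  have h3 := hqτ a
  rw [h1, h2, hod a hab.symm, hoo a hab.symm, if_neg hne, if_pos rfl] at h3
  simp at h3

/-- A vertex of degree at most two has no neighbour of degree at least three. -/
theorem apply_apply_ne (hσ : G.IsRotation σ) {d : E × Bool}
    (h : σ (σ (opp d)) ≠ opp d) : σ (σ d) ≠ d := by
  classical
  intro hd
  have hv : ∀ k, G.inc k = G.inc d → k = d ∨ k = σ d := fun k hk =>
    hσ.eq_or_eq_of_apply_apply_eq hd hk.symm
  set w := G.inc (opp d) with hw
  set w' := G.inc (opp (σ d)) with hw'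
  -- If `d` is attached at a vertex of degree at most two, then its neighbours `w` and `w'` separate
  -- this vertex from some other neighbour of `w`.
  obtain ⟨k, hkw, hkd, hkw'⟩ : ∃ k, G.inc k = w ∧ k ≠ opp d ∧ G.inc (opp k) ≠ w' := by
    by_contra hcon
    push Not at hcon
    have i1 : G.inc (σ (opp d)) = w := hσ.inc_eq _
    have i2 : G.inc (σ (σ (opp d))) = w := (hσ.inc_eq _).trans i1
    have n1 : σ (opp d) ≠ opp d := fun h' => h (by rw [h', h'])
    have := hG.simple _ _ (i1.trans i2.symm)
      ((hcon _ i1 n1).trans (hcon _ i2 h).symm)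
    exact n1 (σ.injective this).symm
  have hkv : G.inc (opp k) ≠ G.inc d := by
    intro h'
    apply hkd
    exact hG.simple _ _ hkw (by rw [h', opp_opp])
  have hvw : G.inc d ≠ w := (hG.no_loop d).symm
  have hvw' : G.inc d ≠ w' := by
    rw [← hσ.inc_eq d]
    exact (hG.no_loop _).symm
  have hkw2 : G.inc (opp k) ≠ w := by
    rw [← hkw]
    exact hG.no_loop k
  have := hG.conn_eq (p := fun u => u = G.inc d) {w, w'}
    (lt_of_le_of_lt Finset.card_le_two (by norm_num)) ?_ (v := G.inc d) (w := G.inc (opp k))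
    (by rw [hG.cl_opp, hkw, hw, hG.cl_opp]) (by simp [hvw, hvw']) (by simp [hkw2, hkw'])
  · exact hkv (this.mp rfl)
  · intro k hk hk'
    have hnv : ∀ k, G.inc (opp k) ∉ ({w, w'} : Finset V) → G.inc k ≠ G.inc d := by
      intro k hk h
      rcases hv k h with rfl | rfl <;> simp [w, w'] at hk
    have h1 := hnv k hk'
    have h2 := hnv (opp k) (by rwa [opp_opp])
    simp [h1, h2]

/-- Two planar rotation systems cannot agree at one end of an edge and be reverse to each other at
the other end. -/
theorem not_eq_and_reverse (hσ : G.IsRotation σ) (hτ : G.IsRotation τ)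
    (hcσ : G.TrivialCohomology σ) (hcτ : G.TrivialCohomology τ) {d : E × Bool}
    (hv : τ d = σ d) (hw : τ (opp d) = σ.symm (opp d))
    (h2 : σ (σ (opp d)) ≠ opp d) : False := by
  classical
  have h1 := hG.apply_apply_ne hσ h2
  obtain ⟨o, ho⟩ : ∃ o : E × Bool → ZMod 2,
    o = fun k => if (faceStep σ).SameCycle d k then 1 else 0 := ⟨_, rfl⟩
  obtain ⟨q, hqτ, hqo⟩ := hcτ.exists_sides hσ d ho
  have hdσ : σ d ≠ d := fun h => h1 (by rw [h, h])
  have hdσ' : σ (opp d) ≠ opp d := fun h => h2 (by rw [h, h])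
  -- The edge `d` lies on the face of `d` and on the face of `opp d`, which contains `σ d`.
  have key : q (opp (σ d)) = q (σ.symm (opp d)) := by
    have hface : (faceStep σ).SameCycle (σ d) (opp d) := by
      rw [sameCycle_opp_iff]
    refine transport_along_face hface ?_
    intro t ht hxt hyt
    have hzv : G.inc (σ t) ≠ G.inc (σ d) := fun h =>
      hxt (hG.eq_of_sameFace hσ hcσ h.symm ht).symm
    have hzw : G.inc (opp d) ≠ G.inc (σ t) := fun h =>
      hyt (hG.eq_of_sameFace hσ hcσ h (hface.symm.trans ht)).symm
    have hno : ∀ y, G.inc y = G.inc (σ t) → ¬ (faceStep σ).SameCycle d y := by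
      intro y hy hby
      have hm := fun k => hG.opp_eq_of_faces_meet hσ hcσ (hσ.inc_eq d).symm hy hby ht
        (by rw [hy, ← hσ.inc_eq d]; exact hzv) hdσ.symm (d := k)
      have m1 := (hm d (Or.inl rfl)).resolve_left (by rw [hy]; exact hzw)
      have m2 := (hm (σ d) (Or.inr rfl)).resolve_right
        (by rw [hy, Equiv.symm_apply_apply]; exact hzw)
      have := hG.simple (σ d) (σ.symm d) (by rw [hσ.inc_eq, hσ.inc_symm_eq]) (m2.trans m1.symm)
      exact h1 (by rw [this, Equiv.apply_symm_apply])
    have hz0 : ∀ k, G.inc k = G.inc (σ t) → o k + o (opp k) = 0 := by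
      intro k hk
      simp only [ho, sameCycle_opp_iff, if_neg (hno k hk),
        if_neg (hno (σ k) ((hσ.inc_eq k).trans hk)), add_zero]
    rw [hqo, hz0 _ rfl, add_zero]
    refine hτ.eq_of_forall (v := G.inc (σ t)) ?_ rfl (hσ.inc_eq t).symm
    intro k hk
    rw [hqτ, hz0 k hk, add_zero]
  have hO : ∀ b k, (faceStep σ).SameCycle d b → G.inc k = G.inc b →
      ((faceStep σ).SameCycle d k ↔ k = b) := by
    intro b k hb hk
    exact ⟨fun h => (hG.eq_of_sameFace hσ hcσ hk.symm (hb.symm.trans h)).symm, fun h => h ▸ hb⟩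
  have hO' : (faceStep σ).SameCycle d (σ (opp d)) := by
    rw [← sameCycle_opp_iff, opp_opp]
  -- Evaluated with the rotation `τ` at the two ends of `d`, the two sides of `key` differ by one.
  have e1 : q (opp (σ d)) = q d + 1 := by
    have a1 : o d = 1 := by simp [ho, Equiv.Perm.SameCycle.refl]
    have a2 : o (opp d) = 0 := by
      simp only [ho, sameCycle_opp_iff]
      rw [if_neg]
      rwa [hO d _ (.refl _ _) (hσ.inc_eq d)]
    have a3 : o (σ d) = 0 := by
      simp only [ho]
      rw [if_neg]
      rwa [hO d _ (.refl _ _) (hσ.inc_eq d)]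
    have a4 : o (opp (σ d)) = 0 := by
      simp only [ho, sameCycle_opp_iff]
      rw [if_neg]
      rwa [hO d _ (.refl _ _) ((hσ.inc_eq _).trans (hσ.inc_eq d))]
    rw [hqo, a3, a4, ← hv, hqτ, a1, a2]
    simp
  have e2 : q (σ.symm (opp d)) = q d := by
    have a1 : o d = 1 := by simp [ho, Equiv.Perm.SameCycle.refl]
    have a2 : o (opp d) = 0 := by
      simp only [ho]
      rw [if_neg]
      rw [hO _ _ hO' (hσ.inc_eq _).symm]
      exact hdσ'.symm
    rw [← hw, hqτ, hqo, opp_opp, a1, a2, add_zero, zero_add, add_assoc, CharTwo.add_self_eq_zero,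
      add_zero]
  rw [e1, e2] at key
  simp at key

/-- Whitney's theorem at a single vertex: the rotators of two planar rotation systems agree or are
reverse to each other. -/
theorem eq_or_reverse_at (hσ : G.IsRotation σ) (hτ : G.IsRotation τ)
    (hcσ : G.TrivialCohomology σ) (hcτ : G.TrivialCohomology τ) (v : V) :
    (∀ d, G.inc d = v → τ d = σ d) ∨ (∀ d, G.inc d = v → τ d = σ.symm d) := by
  by_cases h : ∃ a, G.inc a = v ∧ τ a = σ a
  · left
    obtain ⟨a, rfl, ha⟩ := h
    intro d hd
    refine hσ.induction (P := fun d => τ d = σ d) ha ?_ hd.symm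
    intro k hk hτk
    rcases hG.consecutive hσ hτ hcσ hcτ (σ k) with h | h
    · have hk2 : σ (σ k) = k := τ.injective (h.trans hτk.symm)
      rw [hk2]
      rcases hσ.eq_or_eq_of_apply_apply_eq hk2 (d' := τ (σ k))
        (by rw [hτ.inc_eq, hσ.inc_eq]) with h' | h'
      · exact h'
      · rw [h', τ.injective (h'.trans hτk.symm)]
    · exact h
  · right
    push Not at h
    intro d hd
    have := (hG.consecutive hσ hτ hcσ hcτ (σ.symm d)).resolve_right
      (h _ ((hσ.inc_symm_eq d).trans hd))
    rwa [Equiv.apply_symm_apply] at this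

/-- Whitney's theorem: a planar rotation system of a 3-connected graph is unique up to reversal. -/
theorem eq_or_reverse (hσ : G.IsRotation σ) (hτ : G.IsRotation τ)
    (hcσ : G.TrivialCohomology σ) (hcτ : G.TrivialCohomology τ) (i : I) :
    (∀ d, cl (G.inc d) = i → τ d = σ d) ∨ (∀ d, cl (G.inc d) = i → τ d = σ.symm d) := by
  have hstep : ∀ d, (∀ k, G.inc k = G.inc d → τ k = σ k) →
      ∀ k, G.inc k = G.inc (opp d) → τ k = σ k := by
    intro d hd
    rcases hG.eq_or_reverse_at hσ hτ hcσ hcτ (G.inc (opp d)) with hw | hw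
    · exact hw
    · have h2 : σ (σ (opp d)) = opp d := by
        by_contra h2
        exact hG.not_eq_and_reverse hσ hτ hcσ hcτ (hd d rfl) (hw _ rfl) h2
      intro k hk
      rw [hw k hk, Equiv.symm_apply_eq]
      rcases hσ.eq_or_eq_of_apply_apply_eq h2 hk.symm with rfl | rfl <;> simp only [h2]
  by_cases h : ∃ v, cl v = i ∧ ∀ k, G.inc k = v → τ k = σ k
  · left
    obtain ⟨v, rfl, hv⟩ := h
    intro d hd
    have := hG.conn_eq (p := fun v => ∀ k, G.inc k = v → τ k = σ k) ∅ (by simp) ?_ hd.symm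
      (by simp) (by simp)
    · exact this.mp hv d rfl
    · intro d _ _
      refine propext ⟨fun h => ?_, hstep d⟩
      have := hstep (opp d) h
      rwa [opp_opp] at this
  · right
    push Not at h
    intro d hd
    obtain ⟨k, hk, hne⟩ := h _ hd
    exact (hG.eq_or_reverse_at hσ hτ hcσ hcτ (G.inc d)).resolve_left (fun h' => hne (h' k hk)) d rfl

end FiberwiseThreeConnected

end MultiGraph

namespace TwoComplex

open MultiGraph

variable {V E F : Type*} (C : TwoComplex V E F)

/-! ### The union of all link graphs -/

/-- The disjoint union of all link graphs: its vertices are the half-edges, and its edges the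
corners of the 2-complex. -/
def links : MultiGraph (E × Bool) C.Corner where
  inc k := bif k.2 then k.1.leave else k.1.arrive

/-- The cyclically next corner of the same face. -/
def next : Equiv.Perm C.Corner := Equiv.sigmaCongrRight fun f => finRotate (C.face f).length

/-- A half-edge of the link graph at a half-edge `h` of `C` stands for a face traversing the edge
of `h`. Its mirror image is the half-edge at the other half of this edge that
stands for the same face. -/
def mirror : Equiv.Perm (C.Corner × Bool) where
  toFun d := bif d.2 then (C.next d.1, false) else (C.next.symm d.1, true)
  invFun d := bif d.2 then (C.next d.1, false) else (C.next.symm d.1, true)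
  left_inv := by rintro ⟨c, _ | _⟩ <;> simp
  right_inv := by rintro ⟨c, _ | _⟩ <;> simp

/-- The rotators at the two halves of `e` given by the rotation `σ` of the link graphs are reverse
to each other, where faces are identified by `mirror`. -/
def ReverseAt (σ : Equiv.Perm (C.Corner × Bool)) (e : E) : Prop :=
  ∀ d, (C.links.inc d).1 = e → σ (C.mirror (σ d)) = C.mirror d

variable {C}

theorem mirror_mirror (d : C.Corner × Bool) : C.mirror (C.mirror d) = d :=
  C.mirror.left_inv d

theorem mirror_snd (d : C.Corner × Bool) : (C.mirror d).2 = !d.2 := by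
  obtain ⟨c, _ | _⟩ := d <;> rfl

theorem mirror_face (d : C.Corner × Bool) : (C.mirror d).1.1 = d.1.1 := by
  obtain ⟨c, _ | _⟩ := d <;> rfl

theorem arrive_next (c : C.Corner) : (C.next c).arrive = opp c.leave := rfl

theorem leave_next_symm (c : C.Corner) : (C.next.symm c).leave = opp c.arrive := by
  obtain ⟨c, rfl⟩ := C.next.surjective c
  rw [Equiv.symm_apply_apply, arrive_next, opp_opp]

theorem inc_mirror (d : C.Corner × Bool) : C.links.inc (C.mirror d) = opp (C.links.inc d) := by
  obtain ⟨c, _ | _⟩ := d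
  · exact leave_next_symm c
  · rfl

theorem inc_arrive (c : C.Corner) : C.inc c.arrive = C.inc c.leave :=
  (C.closedTrail c.1).next c.2

theorem inc_inc_opp (d : C.Corner × Bool) :
    C.inc (C.links.inc (opp d)) = C.inc (C.links.inc d) := by
  obtain ⟨c, _ | _⟩ := d
  · exact (inc_arrive c).symm
  · exact inc_arrive c

theorem inc_inc (d : C.Corner × Bool) : C.inc (C.links.inc d) = C.inc d.1.leave := by
  obtain ⟨c, _ | _⟩ := d
  · exact inc_arrive c
  · rfl

theorem halfEdge_ext_of_fst {d d' : C.Corner × Bool} (hf : d.1.1 = d'.1.1)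
    (he : (C.links.inc d).1 = (C.links.inc d').1) (hb : d.2 = d'.2) : d = d' := by
  obtain ⟨⟨f, i⟩, b⟩ := d
  obtain ⟨⟨f', i'⟩, b'⟩ := d'
  obtain rfl : f = f' := hf
  obtain rfl : b = b' := hb
  cases b
  · obtain rfl := fst_injective f he
    rfl
  · obtain rfl := (finRotate _).injective (fst_injective f he)
    rfl

theorem halfEdge_ext {d d' : C.Corner × Bool} (hf : d.1.1 = d'.1.1)
    (he : C.links.inc d = C.links.inc d') : d = d' := by
  by_cases hb : d.2 = d'.2
  · exact halfEdge_ext_of_fst hf (congrArg Prod.fst he) hb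
  · exfalso
    have : d = C.mirror d' := by
      apply halfEdge_ext_of_fst
      · rw [hf, mirror_face]
      · rw [inc_mirror, he]
        rfl
      · rw [mirror_snd]
        revert hb
        cases d.2 <;> cases d'.2 <;> simp
    rw [this, inc_mirror] at he
    exact opp_ne _ he

theorem coe_inc_link {v : V} (k : {c : C.Corner // C.inc c.leave = v} × Bool) :
    ((C.link v).inc k).1 = C.links.inc (k.1.1, k.2) := by
  obtain ⟨c, _ | _⟩ := k <;> rfl

theorem LocallyThreeConnected.fiberwise (h : C.LocallyThreeConnected) :
    FiberwiseThreeConnected C.links C.inc := by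
  have hloop : ∀ d, C.links.inc (opp d) ≠ C.links.inc d := by
    rintro ⟨c, b⟩ hd
    refine (h (C.inc c.leave)).no_loop ⟨c, rfl⟩ (Subtype.ext ?_)
    cases b
    · exact hd.symm
    · exact hd
  refine ⟨inc_inc_opp, hloop, ?_, ?_⟩
  · rintro ⟨c, b⟩ ⟨c', b'⟩ hd hd'
    have hv : C.inc c'.leave = C.inc c.leave := by
      rw [← inc_inc (c', b'), ← hd, inc_inc]
    have hc : (⟨c, rfl⟩ : {x : C.Corner // C.inc x.leave = C.inc c.leave}) = ⟨c', hv⟩ := by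
      refine (h (C.inc c.leave)).no_parallel _ _ ?_
      unfold MultiGraph.Parallel
      rw [Sym2.eq_iff]
      simp only [Subtype.ext_iff, coe_inc_link]
      cases b <;> cases b'
      · exact Or.inl ⟨hd, hd'⟩
      · exact Or.inr ⟨hd, hd'⟩
      · exact Or.inr ⟨hd', hd⟩
      · exact Or.inl ⟨hd', hd⟩
    obtain rfl : c = c' := congrArg Subtype.val hc
    by_cases hb : b = b'
    · rw [hb]
    · exfalso
      have : ((c, b') : C.Corner × Bool) = opp (c, b) := by
        revert hb
        cases b <;> cases b' <;> simp [opp]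
      rw [this] at hd
      exact hloop _ hd.symm
  · intro X hX x y hxy hx hy
    classical
    have := (h (C.inc x)).no_separator (X.subtype _)
      (lt_of_le_of_lt (by rw [Finset.card_subtype]; exact Finset.card_filter_le _ _) hX)
      ⟨x, rfl⟩ ⟨y, hxy.symm⟩ (by simpa using hx) (by simpa using hy)
    refine Relation.ReflTransGen.lift
      (p := fun a b => C.links.Adj a b ∧ a ∉ (X : Set _) ∧ b ∉ (X : Set _))
      Subtype.val ?_ _ _ this
    rintro a b ⟨⟨k, rfl, rfl⟩, ha, hb⟩
    refine ⟨⟨(k.1.1, k.2), (coe_inc_link k).symm, ?_⟩, by simpa using ha, by simpa using hb⟩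
    exact (coe_inc_link (opp k)).symm

/-! ### Families of rotation systems of the link graphs -/

variable (T : ∀ v, (C.link v).RotationSystem)

/-- Rotation systems of all link graphs, as one permutation. -/
def rotation : Equiv.Perm (C.Corner × Bool) :=
  ((Equiv.sigmaProdDistrib _ _).symm.trans (Equiv.prodCongr
    (Equiv.sigmaFiberEquiv fun c : C.Corner => C.inc c.leave) (Equiv.refl Bool))).permCongr
      (Equiv.Perm.sigmaCongrRight fun v => (T v).total)

theorem rotation_apply {v : V} (k : {c : C.Corner // C.inc c.leave = v} × Bool) :
    rotation T (k.1.1, k.2) = (((T v).total k).1.1, ((T v).total k).2) := by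
  obtain ⟨⟨c, rfl⟩, b⟩ := k
  rfl

theorem rotation_apply_mk (d : C.Corner × Bool) :
    rotation T d = (((T (C.inc d.1.leave)).total (⟨d.1, rfl⟩, d.2)).1.1,
      ((T (C.inc d.1.leave)).total (⟨d.1, rfl⟩, d.2)).2) :=
  rotation_apply T (⟨d.1, rfl⟩, d.2)

theorem isRotation_rotation [Finite F] : C.links.IsRotation (rotation T) := by
  refine isRotation_of (fun d => ?_) fun d d' h => ?_
  · rw [rotation_apply_mk, ← coe_inc_link, RotationSystem.inc_total, coe_inc_link]
  · have hv : C.inc d'.1.leave = C.inc d.1.leave := by rw [← inc_inc, ← h, inc_inc]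
    have := ((T (C.inc d.1.leave)).isRotation_total (⟨d.1, rfl⟩, d.2) (⟨d'.1, hv⟩, d'.2)).2
      (Subtype.ext (by rw [coe_inc_link, coe_inc_link]; exact h))
    obtain ⟨n, -, hn⟩ := this.exists_pow_eq'
    refine ⟨n, ?_⟩
    rw [zpow_natCast]
    have key : ∀ n : ℕ, ((rotation T) ^ n) d =
        ((((T (C.inc d.1.leave)).total ^ n) (⟨d.1, rfl⟩, d.2)).1.1,
          (((T (C.inc d.1.leave)).total ^ n) (⟨d.1, rfl⟩, d.2)).2) := by
      intro n
      induction n with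
      | zero => rfl
      | succ n ih => rw [pow_succ', Equiv.Perm.mul_apply, ih, rotation_apply, pow_succ',
          Equiv.Perm.mul_apply]
    rw [key, hn]

theorem trivialCohomology_rotation [Finite E] [Fintype F] {T : ∀ v, (C.link v).RotationSystem}
    (hT : ∀ v, (T v).Planar) : C.links.TrivialCohomology (rotation T) := by
  classical
  intro g hg
  have : ∀ v, ∃ p : {h // C.inc h = v} → ZMod 2,
      ∀ k, g k.1.1 = p ((C.link v).inc k) + p ((C.link v).inc (opp k)) := by
    intro v
    refine (hT v).trivialCohomology (fun c => g c.1) ?_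
    intro q hq
    let Q : C.Corner × Bool → ZMod 2 := fun d =>
      if hd : C.inc d.1.leave = v then q (⟨d.1, hd⟩, d.2) else 0
    rw [← hg Q]
    · refine Fintype.sum_of_injective
        (fun k : {c : C.Corner // C.inc c.leave = v} × Bool => (k.1.1, k.2)) ?_ _ _ ?_ ?_
      · rintro ⟨⟨c, hc⟩, b⟩ ⟨⟨c', hc'⟩, b'⟩ h
        simpa using h
      · intro d hd
        have : ¬ C.inc d.1.leave = v := fun h => hd ⟨(⟨d.1, h⟩, d.2), rfl⟩
        simp only [Q, dif_neg this, zero_mul]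
      · rintro ⟨⟨c, hc⟩, b⟩
        simp only [Q, dif_pos hc]
    · intro d
      by_cases hd : C.inc d.1.leave = v
      · have h1 := rotation_apply T (opp (⟨d.1, hd⟩, d.2))
        have h2 : ((opp ((⟨d.1, hd⟩, d.2) : {c : C.Corner // C.inc c.leave = v} × Bool)).1.1,
          (opp ((⟨d.1, hd⟩, d.2) : {c : C.Corner // C.inc c.leave = v} × Bool)).2) = opp d := rfl
        rw [h2] at h1
        rw [h1]
        have h3 := ((T v).total (opp (⟨d.1, hd⟩, d.2))).1.2
        simp only [Q, dif_pos h3, dif_pos hd]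
        exact hq (⟨d.1, hd⟩, d.2)
      · have : ¬ C.inc (rotation T (opp d)).1.leave = v := by
          rwa [← inc_inc, (isRotation_rotation T).inc_eq, inc_inc_opp, inc_inc]
        simp only [Q, dif_neg this, dif_neg hd]
  choose p hp using this
  refine ⟨fun h => p (C.inc h) ⟨h, rfl⟩, fun d => ?_⟩
  have hP : ∀ v h (hv : C.inc h = v), p (C.inc h) ⟨h, rfl⟩ = p v ⟨h, hv⟩ := by
    rintro v h rfl
    rfl
  change g d.1 = p _ ⟨C.links.inc d, rfl⟩ + p _ ⟨C.links.inc (opp d), rfl⟩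
  rw [hP (C.inc d.1.leave) _ (inc_inc d), hP (C.inc d.1.leave) _ (inc_inc (opp d)),
    hp (C.inc d.1.leave) (⟨d.1, rfl⟩, d.2)]
  congr 2
  · exact Subtype.ext (coe_inc_link _)
  · exact Subtype.ext (coe_inc_link _)

/-- The rotator at the half-edge `(e, b)`, as a cyclic orientation of the faces. -/
noncomputable def rotator (e : E) (b : Bool) : Equiv.Perm (C.FacesAt e) :=
  (faceEquiv ⟨(e, b), rfl⟩).permCongr ((T (C.inc (e, b))).rot ⟨(e, b), rfl⟩)

theorem rotator_eq {v : V} (e : E) (b : Bool) (hv : C.inc (e, b) = v) :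
    (faceEquiv ⟨(e, b), hv⟩).permCongr ((T v).rot ⟨(e, b), hv⟩) = rotator T e b := by
  subst hv
  rfl

theorem rotator_isCycleOn (e : E) (b : Bool) : (rotator T e b).IsCycleOn Set.univ :=
  isCycleOn_permCongr _ ((T _).cyclic _)

/-- The half-edge of the link graph at `(e, b)` that stands for the face `f`. -/
noncomputable def halfEdgeOf (e : E) (b : Bool) (f : C.FacesAt e) : C.Corner × Bool :=
  (((faceEquiv ⟨(e, b), rfl⟩).symm f).1.1.1, ((faceEquiv ⟨(e, b), rfl⟩).symm f).1.2)

theorem inc_halfEdgeOf (e : E) (b : Bool) (f : C.FacesAt e) :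
    C.links.inc (halfEdgeOf e b f) = (e, b) := by
  have := ((faceEquiv ⟨(e, b), rfl⟩).symm f).2
  rw [Subtype.ext_iff, coe_inc_link] at this
  exact this

theorem face_halfEdgeOf (e : E) (b : Bool) (f : C.FacesAt e) : (halfEdgeOf e b f).1.1 = f.1 :=
  congrArg Subtype.val ((faceEquiv ⟨(e, b), rfl⟩).apply_symm_apply f)

theorem halfEdgeOf_injective (e : E) (b : Bool) :
    Function.Injective (halfEdgeOf (C := C) e b) := by
  intro f f' hf
  apply Subtype.ext
  rw [← face_halfEdgeOf e b f, hf, face_halfEdgeOf]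

theorem mirror_halfEdgeOf (e : E) (b : Bool) (f : C.FacesAt e) :
    C.mirror (halfEdgeOf e b f) = halfEdgeOf e (!b) f := by
  apply halfEdge_ext
  · rw [mirror_face, face_halfEdgeOf, face_halfEdgeOf]
  · rw [inc_mirror, inc_halfEdgeOf, inc_halfEdgeOf]
    rfl

theorem exists_halfEdgeOf {d : C.Corner × Bool} {e : E} {b : Bool}
    (hd : C.links.inc d = (e, b)) : ∃ f, d = halfEdgeOf e b f := by
  have hv : C.inc d.1.leave = C.inc (e, b) := by rw [← inc_inc, hd]
  have hk : (C.link _).inc ((⟨d.1, hv⟩, d.2) :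
      {c : C.Corner // C.inc c.leave = C.inc (e, b)} × Bool) = ⟨(e, b), rfl⟩ :=
    Subtype.ext ((coe_inc_link _).trans hd)
  refine ⟨faceEquiv _ ⟨_, hk⟩, ?_⟩
  rw [halfEdgeOf, Equiv.symm_apply_apply]

theorem rotation_halfEdgeOf [Finite F] (e : E) (b : Bool) (f : C.FacesAt e) :
    rotation T (halfEdgeOf e b f) = halfEdgeOf e b (rotator T e b f) := by
  apply halfEdge_ext
  · rw [face_halfEdgeOf]
    unfold halfEdgeOf
    rw [rotation_apply, RotationSystem.total_coe]
    rfl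
  · rw [(isRotation_rotation T).inc_eq, inc_halfEdgeOf, inc_halfEdgeOf]

theorem reverseAt_rotation_iff [Finite F] (e : E) :
    C.ReverseAt (rotation T) e ↔ rotator T e true = (rotator T e false)⁻¹ := by
  have key : ∀ b f, rotation T (C.mirror (rotation T (halfEdgeOf e b f))) =
      C.mirror (halfEdgeOf e b f) ↔ rotator T e (!b) (rotator T e b f) = f := by
    intro b f
    rw [rotation_halfEdgeOf, mirror_halfEdgeOf, mirror_halfEdgeOf, rotation_halfEdgeOf]
    exact (halfEdgeOf_injective e (!b)).eq_iff
  constructor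
  · intro hR
    refine eq_inv_of_mul_eq_one_left ?_
    ext1 f
    exact (key false f).1 (hR _ (by rw [inc_halfEdgeOf]))
  · intro hR d hd
    obtain ⟨b, hb⟩ : ∃ b, C.links.inc d = (e, b) := ⟨_, Prod.ext hd rfl⟩
    obtain ⟨f, rfl⟩ := exists_halfEdgeOf hb
    rw [key]
    cases b
    · rw [Bool.not_false, hR, Equiv.Perm.inv_def, Equiv.symm_apply_apply]
    · rw [Bool.not_true, hR, Equiv.Perm.inv_def, Equiv.apply_symm_apply]

theorem LocallyPlanar.exists_rotations [Finite F] (h : C.LocallyPlanar) :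
    ∃ T : ∀ v, (C.link v).RotationSystem, (∀ v, (T v).Planar) ∧
      ∀ e, C.IsLoop e → C.ReverseAt (rotation T) e := by
  choose T hT hl using h
  refine ⟨T, hT, fun e he => ?_⟩
  rw [reverseAt_rotation_iff, ← rotator_eq T e true rfl, ← rotator_eq T e false he]
  exact hl _ e he rfl

theorem exists_planar_of_reverseAt [Finite F] (hT : ∀ v, (T v).Planar)
    (h : ∀ e, C.ReverseAt (rotation T) e) : ∃ S : C.RotationSystem, S.Planar := by
  refine ⟨⟨fun e => rotator T e true, fun e => rotator_isCycleOn T e true⟩, fun v => ?_⟩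
  have hTv : RotationSystem.induced
      ⟨fun e => rotator T e true, fun e => rotator_isCycleOn T e true⟩ v = T v := by
    have : ∀ S S' : (C.link v).RotationSystem, S.rot = S'.rot → S = S' := by
      rintro ⟨r, hr⟩ ⟨r', hr'⟩ rfl
      rfl
    apply this
    funext x
    obtain ⟨⟨e, b⟩, rfl⟩ := x
    change (faceEquiv _).symm.permCongr _ = _
    have hinv : ∀ (A : Equiv.Perm (C.FacesAt e)),
      A = (faceEquiv ⟨(e, b), rfl⟩).permCongr ((T _).rot ⟨(e, b), rfl⟩) →
      (faceEquiv ⟨(e, b), rfl⟩).symm.permCongr A = (T _).rot ⟨(e, b), rfl⟩ := by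
      rintro _ rfl
      ext1 k
      simp
    apply hinv
    cases b
    · have := (reverseAt_rotation_iff T e).1 (h e)
      simp only [cond_false]
      rw [this, inv_inv]
      rfl
    · rfl
  rw [hTv]
  exact hT v

end TwoComplex

namespace TwoComplex

open MultiGraph

variable {V E F : Type*} {C : TwoComplex V E F}

/-! ### The corners of a contraction -/

theorem val_finRotate {n : ℕ} (i : Fin n) : (finRotate n i).val = (i.val + 1) % n := by
  cases n with
  | zero => exact i.elim0
  | succ n =>
    rw [finRotate_apply, Fin.val_add]
    simp

theorem deleteEdges_append (X : Set E) (l l' : List (E × Bool)) :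
    deleteEdges X (l ++ l') = deleteEdges X l ++ deleteEdges X l' :=
  List.filterMap_append

theorem length_deleteEdges_take_succ {X : Set E} {l : List (E × Bool)} {j : ℕ} (hj : j < l.length)
    (hX : l[j].1 ∈ X) :
    (deleteEdges X (l.take (j + 1))).length = (deleteEdges X (l.take j)).length := by
  rw [List.take_succ_eq_append_getElem hj, deleteEdges_append]
  simp [deleteEdges, hX]

theorem length_deleteEdges_take_succ' {X : Set E} {l : List (E × Bool)} {j : ℕ} (hj : j < l.length)
    (hX : l[j].1 ∉ X) :
    (deleteEdges X (l.take (j + 1))).length = (deleteEdges X (l.take j)).length + 1 := by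
  rw [List.take_succ_eq_append_getElem hj, deleteEdges_append]
  simp [deleteEdges, hX]

theorem exists_getElem_deleteEdges {X : Set E} {l : List (E × Bool)} {j : ℕ} (hj : j < l.length)
    (hX : l[j].1 ∉ X) :
    ∃ h : (deleteEdges X (l.take j)).length < (deleteEdges X l).length,
      (deleteEdges X l)[(deleteEdges X (l.take j)).length] = (⟨l[j].1, hX⟩, l[j].2) := by
  have h1 : deleteEdges X l = deleteEdges X (l.take j) ++
      (⟨l[j].1, hX⟩, l[j].2) :: deleteEdges X (l.drop (j + 1)) := by
    conv_lhs => rw [← List.take_append_drop j l, List.drop_eq_getElem_cons hj, deleteEdges_append]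
    congr 1
    simp [deleteEdges, hX]
  simp only [h1]
  refine ⟨by simp, ?_⟩
  rw [List.getElem_append_right le_rfl]
  simp

/-- The half-edge of `C` from which a half-edge of a contraction comes. -/
def uncontract {X : Set E} (h : {e : E // e ∉ X} × Bool) : E × Bool := (h.1.1, h.2)

/-- If no face lies in `X`, then every corner of `C` becomes a part of a corner of the contraction:
corners that are consecutive across an edge in `X` are merged. -/
theorem exists_merge (C : TwoComplex V E F) (X : Set E)
    (hX : ∀ f, C.face f ≠ [] → ∃ d ∈ C.face f, d.1 ∉ X) :
    ∃ m : C.Corner → (C.contract X).Corner, (∀ c, (m c).1 = c.1) ∧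
      (∀ c, c.leave.1 ∉ X → uncontract (m c).leave = c.leave) ∧
      (∀ c, c.leave.1 ∈ X → m (C.next c) = m c) ∧
      (∀ c, c.leave.1 ∉ X → m (C.next c) = (C.contract X).next (m c)) := by
  have hpos : ∀ f, Fin (C.face f).length → 0 < ((C.contract X).face f).length := by
    intro f i
    obtain ⟨d, hd, hdX⟩ := hX f (by rintro h; rw [h] at i; exact i.elim0)
    obtain ⟨j, hj, rfl⟩ := List.mem_iff_getElem.1 hd
    exact lt_of_le_of_lt (Nat.zero_le _) (exists_getElem_deleteEdges hj hdX).1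
  let κ : F → ℕ → ℕ := fun f j => (deleteEdges X ((C.face f).take j)).length
  have hκ : ∀ f (j : Fin (C.face f).length), κ f (finRotate _ j).val %
      ((C.contract X).face f).length = κ f (j.val + 1) % ((C.contract X).face f).length := by
    intro f j
    rw [val_finRotate]
    rcases Nat.lt_or_ge (j.val + 1) (C.face f).length with h | h
    · rw [Nat.mod_eq_of_lt h]
    · have h1 : j.val + 1 = (C.face f).length := le_antisymm j.2 h
      have h2 : κ f (C.face f).length = ((C.contract X).face f).length := by
        simp only [κ, List.take_length]
        rfl
      rw [h1, h2, Nat.mod_self, Nat.mod_self]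
      simp [κ, deleteEdges]
  let m : C.Corner → (C.contract X).Corner := fun c => ⟨c.1, (finRotate _).symm
    ⟨κ c.1 (finRotate _ c.2).val % _, Nat.mod_lt _ (hpos c.1 c.2)⟩⟩
  refine ⟨m, fun c => rfl, ?_, ?_, ?_⟩
  · rintro ⟨f, i⟩ hc
    obtain ⟨h1, h2⟩ := exists_getElem_deleteEdges (X := X) (finRotate _ i).2 hc
    have h3 : (m ⟨f, i⟩).leave = (deleteEdges X (C.face f))[κ f (finRotate _ i).val] := by
      simp only [Corner.leave, m, Equiv.apply_symm_apply]
      change (deleteEdges X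
        (C.face f))[κ f (finRotate _ i).val % (deleteEdges X (C.face f)).length]'_ = _
      congr 1
      exact Nat.mod_eq_of_lt h1
    rw [h3, h2]
    rfl
  · rintro ⟨f, i⟩ hc
    refine Sigma.ext rfl (heq_of_eq ?_)
    refine congrArg (finRotate _).symm (Fin.ext ?_)
    refine (hκ f _).trans ?_
    congr 1
    exact length_deleteEdges_take_succ (finRotate _ i).2 hc
  · rintro ⟨f, i⟩ hc
    refine Sigma.ext rfl (heq_of_eq ?_)
    change (finRotate _).symm _ = (finRotate _) ((finRotate _).symm _)
    refine Eq.trans ?_ (Equiv.apply_symm_apply _ _).symm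
    refine (Equiv.symm_apply_eq _).2 (Fin.ext ?_)
    refine (hκ f _).trans (Eq.trans ?_ (val_finRotate _).symm)
    refine Eq.trans ?_ (Nat.mod_add_mod _ _ _).symm
    congr 1
    exact length_deleteEdges_take_succ' (finRotate _ i).2 hc

end TwoComplex

namespace TwoComplex

open MultiGraph

variable {V E F : Type*} {C : TwoComplex V E F} {X : Set E}

/-! ### Contracting forests -/

variable (C) in
/-- `a` and `b` are the endvertices of an edge in `X` different from `x`. -/
def JoinedWithout (X : Set E) (x : E) (a b : V) : Prop :=
  ∃ y ∈ X, y ≠ x ∧ C.inc (y, false) = a ∧ C.inc (y, true) = b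

variable (C) in
/-- The edges in `X` form a forest: each of them is a bridge of the graph with edge set `X`. -/
def IsForest (X : Set E) : Prop :=
  ∀ x ∈ X, ¬ Relation.EqvGen (C.JoinedWithout X x) (C.inc (x, false)) (C.inc (x, true))

variable (C) in
/-- The vertices that can be reached in the graph with edge set `X` by walks that start by leaving
along `h` and then avoid the edge of `h`. -/
def beyond (X : Set E) (h : E × Bool) : Set V :=
  {w | Relation.EqvGen (C.JoinedWithout X h.1) (C.inc (opp h)) w}

theorem inc_opp_mem_beyond (h : E × Bool) : C.inc (opp h) ∈ C.beyond X h := .refl _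

theorem IsForest.inc_notMem_beyond (hX : C.IsForest X) {h : E × Bool} (hh : h.1 ∈ X) :
    C.inc h ∉ C.beyond X h := by
  obtain ⟨x, b⟩ := h
  cases b
  · exact fun h' => hX x hh (.symm _ _ h')
  · exact hX x hh

theorem mem_beyond_iff {h k : E × Bool} (hk : k.1 ∈ X) (hne : k.1 ≠ h.1) :
    C.inc (opp k) ∈ C.beyond X h ↔ C.inc k ∈ C.beyond X h := by
  have key : Relation.EqvGen (C.JoinedWithout X h.1) (C.inc (k.1, false)) (C.inc (k.1, true)) :=
    .rel _ _ ⟨k.1, hk, hne, rfl, rfl⟩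
  obtain ⟨x, b⟩ := k
  cases b
  · exact ⟨fun h' => h'.trans _ _ _ (key.symm _ _), fun h' => h'.trans _ _ _ key⟩
  · exact ⟨fun h' => h'.trans _ _ _ key, fun h' => h'.trans _ _ _ (key.symm _ _)⟩

theorem IsForest.notMem_beyond_opp (hX : C.IsForest X) {h : E × Bool} (hh : h.1 ∈ X) {w : V}
    (hw : w ∈ C.beyond X h) : w ∉ C.beyond X (opp h) := by
  intro hw'
  refine hX.inc_notMem_beyond hh (hw.trans _ _ _ (.symm _ _ ?_))
  have : C.inc (opp (opp h)) = C.inc h := by rw [opp_opp]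
  rw [← this]
  exact hw'

theorem IsForest.beyond_ssubset (hX : C.IsForest X) {h y : E × Bool} (hh : h.1 ∈ X) (hy : y.1 ∈ X)
    (hyh : C.inc y = C.inc (opp h)) (hne : y ≠ opp h) : C.beyond X y ⊂ C.beyond X h := by
  have hne1 : y.1 ≠ h.1 := by
    intro h1
    rcases eq_or_eq_opp_of_fst_eq h1 with rfl | h2
    · apply hX.inc_notMem_beyond hh
      rw [hyh]
      exact inc_opp_mem_beyond _
    · exact hne h2
  have hstart : C.inc (opp y) ∈ C.beyond X h := by
    rw [mem_beyond_iff hy hne1, hyh]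
    exact inc_opp_mem_beyond _
  have hw : C.inc (opp h) ∉ C.beyond X y := by
    rw [← hyh]
    exact hX.inc_notMem_beyond hy
  refine (Set.ssubset_iff_of_subset ?_).2 ⟨_, inc_opp_mem_beyond h, hw⟩
  -- A walk beyond `y` does not visit the end of `h`, and therefore does not use `h`.
  have key : ∀ a b, Relation.EqvGen (C.JoinedWithout X y.1) a b → a ∈ C.beyond X y →
      (a ∈ C.beyond X h ↔ b ∈ C.beyond X h) := by
    intro a b hab
    induction hab with
    | rel a b hab =>
      intro ha
      obtain ⟨z, hz, hzy, rfl, rfl⟩ := hab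
      by_cases hzh : z = h.1
      · exfalso
        have hb := (mem_beyond_iff (C := C) (h := y) (k := (z, false)) hz hzy).2 ha
        apply hw
        rcases eq_or_eq_opp_of_fst_eq (d := (z, false)) (d' := h) hzh with h1 | h1
        · rw [← h1]
          exact hb
        · rw [← h1]
          exact ha
      · exact (mem_beyond_iff (C := C) (h := h) (k := (z, false)) hz hzh).symm
    | refl a => exact fun _ => Iff.rfl
    | symm a b hab ih =>
      intro hb
      exact (ih (hb.trans _ _ _ (.symm _ _ hab))).symm
    | trans a b c hab _ ih1 ih2 =>
      intro ha
      exact (ih1 ha).trans (ih2 (ha.trans _ _ _ hab))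
  intro u hu
  exact (key _ _ hu (inc_opp_mem_beyond y)).1 hstart

/-! ### Strands -/

variable (C) in
/-- Follow a face from a half-edge of a link graph across the edge at this half-edge, through the
next vertex. -/
def step : Equiv.Perm (C.Corner × Bool) := C.mirror.trans opp

theorem step_apply (d : C.Corner × Bool) : C.step d = opp (C.mirror d) := rfl

theorem step_face (d : C.Corner × Bool) : (C.step d).1.1 = d.1.1 := mirror_face d

theorem step_snd (d : C.Corner × Bool) : (C.step d).2 = d.2 := by
  rw [step_apply]
  change (!(C.mirror d).2) = _
  rw [mirror_snd, Bool.not_not]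

theorem inc_step (d : C.Corner × Bool) :
    C.inc (C.links.inc (C.step d)) = C.inc (opp (C.links.inc d)) := by
  rw [step_apply, inc_inc_opp, inc_mirror]

theorem step_pow_face (d : C.Corner × Bool) (n : ℕ) : ((C.step ^ n) d).1.1 = d.1.1 := by
  induction n with
  | zero => rfl
  | succ n ih => rw [pow_succ', Equiv.Perm.mul_apply, step_face, ih]

theorem step_pow_snd (d : C.Corner × Bool) (n : ℕ) : ((C.step ^ n) d).2 = d.2 := by
  induction n with
  | zero => rfl
  | succ n ih => rw [pow_succ', Equiv.Perm.mul_apply, step_snd, ih]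

/-- As long as a face runs in the forest `X`, it does not return to a vertex. -/
theorem IsForest.inc_step_pow_ne (hX : C.IsForest X) (d : C.Corner × Bool) {n : ℕ} (hn : 0 < n)
    (h : ∀ i < n, (C.links.inc ((C.step ^ i) d)).1 ∈ X) :
    C.inc (C.links.inc ((C.step ^ n) d)) ≠ C.inc (C.links.inc d) := by
  induction n using Nat.strong_induction_on with
  | _ n ih =>
    intro heq
    have key : ∀ j, 0 < j → j ≤ n →
        C.inc (C.links.inc ((C.step ^ j) d)) ∈ C.beyond X (C.links.inc d) := by
      intro j
      induction j with
      | zero => intro h0; exact absurd h0 (lt_irrefl _)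
      | succ j ihj =>
        intro _ hj
        rw [pow_succ', Equiv.Perm.mul_apply, inc_step]
        rcases Nat.eq_zero_or_pos j with rfl | hj0
        · exact inc_opp_mem_beyond _
        · rw [mem_beyond_iff (h j (by omega))]
          · exact ihj hj0 (by omega)
          · intro he
            refine ih j (by omega) hj0 (fun i hi => h i (by omega)) ?_
            rw [halfEdge_ext_of_fst (step_pow_face d j) he (step_pow_snd d j)]
    have := key n hn le_rfl
    rw [heq] at this
    exact hX.inc_notMem_beyond (h 0 hn) this

theorem IsForest.exists_exit [Finite F] (hX : C.IsForest X) (d : C.Corner × Bool) :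
    ∃ n, (∀ i < n, (C.links.inc ((C.step ^ i) d)).1 ∈ X) ∧
      (C.links.inc ((C.step ^ n) d)).1 ∉ X := by
  classical
  have hex : ∃ n, (C.links.inc ((C.step ^ n) d)).1 ∉ X := by
    by_contra hcon
    push Not at hcon
    refine hX.inc_step_pow_ne d (orderOf_pos C.step) (fun i _ => hcon i) ?_
    rw [pow_orderOf_eq_one]
    rfl
  exact ⟨Nat.find hex, fun i hi => not_not.1 (Nat.find_min hex hi), Nat.find_spec hex⟩

theorem inc_mem_face (d : C.Corner × Bool) :
    (C.links.inc d).1 ∈ (C.face d.1.1).map Prod.fst := by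
  obtain ⟨⟨f, i⟩, b⟩ := d
  cases b
  · exact List.mem_map.2 ⟨_, List.get_mem _ i, rfl⟩
  · exact List.mem_map.2 ⟨_, List.get_mem _ (finRotate _ i), rfl⟩

theorem IsForest.exists_notMem [Finite F] (hX : C.IsForest X) (f : F) (hf : C.face f ≠ []) :
    ∃ d ∈ C.face f, d.1 ∉ X := by
  obtain ⟨n, -, hn⟩ := hX.exists_exit
    ((⟨f, ⟨0, List.length_pos_of_ne_nil hf⟩⟩, true) : C.Corner × Bool)
  have := inc_mem_face ((C.step ^ n) ((⟨f, ⟨0, List.length_pos_of_ne_nil hf⟩⟩, true)))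
  rw [step_pow_face] at this
  obtain ⟨d, hd, hd'⟩ := List.mem_map.1 this
  exact ⟨d, hd, by rwa [hd']⟩

variable (C X) in
/-- A map from the corners of `C` to those of a contraction that merges the corners that are
consecutive across a contracted edge. -/
structure Merge where
  toFun : C.Corner → (C.contract X).Corner
  face_eq : ∀ c, (toFun c).1 = c.1
  leave_eq : ∀ c, c.leave.1 ∉ X → uncontract (toFun c).leave = c.leave
  next_of_mem : ∀ c, c.leave.1 ∈ X → toFun (C.next c) = toFun c
  next_of_notMem : ∀ c, c.leave.1 ∉ X → toFun (C.next c) = (C.contract X).next (toFun c)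

theorem uncontract_injective : Function.Injective (uncontract (X := X)) := by
  rintro ⟨⟨e, he⟩, b⟩ ⟨⟨e', he'⟩, b'⟩ h
  simpa [uncontract] using h

namespace Merge

variable (m : Merge C X)

/-- The half-edge of a link graph of the contraction in which the strand of `d`, followed in the
direction of `d`, ends. -/
def strandEnd (d : C.Corner × Bool) : (C.contract X).Corner × Bool := (m.toFun d.1, d.2)

theorem strandEnd_opp (d : C.Corner × Bool) : m.strandEnd (opp d) = opp (m.strandEnd d) := rfl

theorem strandEnd_mirror_of_mem {d : C.Corner × Bool} (hd : (C.links.inc d).1 ∈ X) :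
    m.strandEnd (C.mirror d) = m.strandEnd (opp d) := by
  obtain ⟨c, b⟩ := d
  cases b
  · obtain ⟨c, rfl⟩ := C.next.surjective c
    have : c.leave.1 ∈ X := hd
    change (m.toFun (C.next.symm (C.next c)), true) = (m.toFun (C.next c), true)
    rw [Equiv.symm_apply_apply, m.next_of_mem c this]
  · exact Prod.ext (m.next_of_mem c hd) rfl

theorem strandEnd_mirror_of_notMem {d : C.Corner × Bool} (hd : (C.links.inc d).1 ∉ X) :
    m.strandEnd (C.mirror d) = (C.contract X).mirror (m.strandEnd d) := by
  obtain ⟨c, b⟩ := d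
  cases b
  · obtain ⟨c, rfl⟩ := C.next.surjective c
    have : c.leave.1 ∉ X := hd
    change (m.toFun (C.next.symm (C.next c)), true) =
      ((C.contract X).next.symm (m.toFun (C.next c)), true)
    rw [Equiv.symm_apply_apply, m.next_of_notMem c this, Equiv.symm_apply_apply]
  · exact Prod.ext (m.next_of_notMem c hd) rfl

theorem strandEnd_step {d : C.Corner × Bool} (hd : (C.links.inc d).1 ∈ X) :
    m.strandEnd (C.step d) = m.strandEnd d := by
  rw [step_apply, strandEnd_opp, m.strandEnd_mirror_of_mem hd, strandEnd_opp, opp_opp]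

theorem strandEnd_step_pow {d : C.Corner × Bool} {n : ℕ}
    (h : ∀ i < n, (C.links.inc ((C.step ^ i) d)).1 ∈ X) :
    m.strandEnd ((C.step ^ n) d) = m.strandEnd d := by
  induction n with
  | zero => rfl
  | succ n ih =>
    rw [pow_succ', Equiv.Perm.mul_apply, m.strandEnd_step (h n (by omega)),
      ih fun i hi => h i (by omega)]

theorem uncontract_inc_strandEnd {d : C.Corner × Bool} (hd : (C.links.inc d).1 ∉ X) :
    uncontract ((C.contract X).links.inc (m.strandEnd d)) = C.links.inc d := by
  obtain ⟨c, b⟩ := d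
  cases b
  · obtain ⟨c, rfl⟩ := C.next.surjective c
    have : c.leave.1 ∉ X := hd
    change uncontract (m.toFun (C.next c)).arrive = (C.next c).arrive
    rw [m.next_of_notMem c this, arrive_next, arrive_next, ← m.leave_eq c this]
    rfl
  · exact m.leave_eq c hd

theorem eq_of_strandEnd_eq {d d' : C.Corner × Bool} (hd : (C.links.inc d).1 ∉ X)
    (hd' : (C.links.inc d').1 ∉ X) (h : m.strandEnd d = m.strandEnd d') : d = d' := by
  apply halfEdge_ext
  · rw [← m.face_eq, ← m.face_eq]
    exact congrArg (fun z => z.1.1) h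
  · rw [← m.uncontract_inc_strandEnd hd, h, m.uncontract_inc_strandEnd hd']

theorem exists_strandEnd_eq (z : (C.contract X).Corner × Bool) :
    ∃ d, (C.links.inc d).1 ∉ X ∧ m.strandEnd d = z := by
  obtain ⟨⟨⟨e, he⟩, b⟩, hz⟩ : ∃ h, (C.contract X).links.inc z = h := ⟨_, rfl⟩
  have hmem := inc_mem_face z
  rw [hz] at hmem
  have hmem' := mem_deleteEdges X hmem
  have hd := inc_halfEdgeOf e b ⟨z.1.1, hmem'⟩
  have hf := face_halfEdgeOf e b ⟨z.1.1, hmem'⟩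
  have hd1 : (C.links.inc (halfEdgeOf e b ⟨z.1.1, hmem'⟩)).1 ∉ X := by rwa [hd]
  refine ⟨_, hd1, halfEdge_ext ((m.face_eq _).trans hf) (uncontract_injective ?_)⟩
  rw [m.uncontract_inc_strandEnd hd1, hd, hz]
  rfl

variable [Finite F] (hX : C.IsForest X)
include hX

theorem exists_notMem_strandEnd_eq (d : C.Corner × Bool) :
    ∃ n, (∀ i < n, (C.links.inc ((C.step ^ i) d)).1 ∈ X) ∧
      (C.links.inc ((C.step ^ n) d)).1 ∉ X ∧
      m.strandEnd ((C.step ^ n) d) = m.strandEnd d := by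
  obtain ⟨n, hn, hn'⟩ := hX.exists_exit d
  exact ⟨n, hn, hn', m.strandEnd_step_pow hn⟩

/-- A strand passes every vertex at most once. -/
theorem eq_of_inc_eq {d d' : C.Corner × Bool}
    (hv : C.inc (C.links.inc d) = C.inc (C.links.inc d')) (h : m.strandEnd d = m.strandEnd d') :
    d = d' := by
  obtain ⟨n, hn, hn', hend⟩ := m.exists_notMem_strandEnd_eq hX d
  obtain ⟨k, hk, hk', hend'⟩ := m.exists_notMem_strandEnd_eq hX d'
  have heq := m.eq_of_strandEnd_eq hn' hk' (by rw [hend, hend', h])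
  have key : ∀ (d d' : C.Corner × Bool) (n k : ℕ), n ≤ k →
      C.inc (C.links.inc d) = C.inc (C.links.inc d') →
      (∀ i < k, (C.links.inc ((C.step ^ i) d')).1 ∈ X) → (C.step ^ n) d = (C.step ^ k) d' →
      d = d' := by
    intro d d' n k hnk hv hk heq
    rw [← Nat.add_sub_cancel' hnk, pow_add, Equiv.Perm.mul_apply] at heq
    have heq := (C.step ^ n).injective heq
    rcases Nat.eq_zero_or_pos (k - n) with h0 | h0
    · rw [h0] at heq
      exact heq
    · exfalso
      apply hX.inc_step_pow_ne d' h0 fun i hi => hk i (by omega)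
      rw [← heq, hv]
  rcases le_total n k with hnk | hnk
  · exact key d d' n k hnk hv hk heq
  · exact (key d' d k n hnk hv.symm hn heq.symm).symm

theorem fst_eq_of_inc_eq {d d' : C.Corner × Bool}
    (hv : C.inc (C.links.inc d) = C.inc (C.links.inc d')) (h : m.toFun d.1 = m.toFun d'.1) :
    d.1 = d'.1 := by
  by_cases hb : d.2 = d'.2
  · rw [m.eq_of_inc_eq hX hv (Prod.ext h hb)]
  · rw [m.eq_of_inc_eq hX (d := d) (d' := opp d') (by rw [hv, inc_inc_opp])
      (Prod.ext h (by revert hb; change _ → d.2 = !d'.2; cases d.2 <;> cases d'.2 <;> simp))]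
    rfl

/-- A strand that contains a vertex beyond `y` and one that is not beyond `y` passes through `y`. -/
theorem exists_of_mem_beyond {d d' : C.Corner × Bool} {y : E × Bool}
    (h : m.toFun d.1 = m.toFun d'.1) (hd : C.inc (C.links.inc d) ∈ C.beyond X y)
    (hd' : C.inc (C.links.inc d') ∉ C.beyond X y) :
    ∃ a, C.links.inc a = y ∧ m.toFun a.1 = m.toFun d.1 := by
  -- Within `X` the only way into or out of what lies beyond `y` is along the edge of `y`.
  have key : ∀ d : C.Corner × Bool, (¬ ∃ a, C.links.inc a = y ∧ m.toFun a.1 = m.toFun d.1) →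
      ∀ n, (∀ i < n, (C.links.inc ((C.step ^ i) d)).1 ∈ X) →
      (C.inc (C.links.inc ((C.step ^ n) d)) ∈ C.beyond X y ↔
        C.inc (C.links.inc d) ∈ C.beyond X y) := by
    intro d hno n
    induction n with
    | zero => intro _; rfl
    | succ n ih =>
      intro hn
      rw [← ih fun i hi => hn i (by omega), pow_succ', Equiv.Perm.mul_apply, inc_step]
      apply mem_beyond_iff (hn n (by omega))
      intro he
      have hs : m.toFun ((C.step ^ n) d).1 = m.toFun d.1 :=
        congrArg Prod.fst (m.strandEnd_step_pow fun i hi => hn i (by omega))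
      apply hno
      rcases eq_or_eq_opp_of_fst_eq he with h1 | h1
      · exact ⟨_, h1, hs⟩
      · refine ⟨C.mirror ((C.step ^ n) d), ?_, ?_⟩
        · rw [inc_mirror, h1, opp_opp]
        · rw [← hs]
          exact congrArg Prod.fst (m.strandEnd_mirror_of_mem (hn n (by omega)))
  by_contra hno
  obtain ⟨d₂, hd₂, hd₂', hb⟩ : ∃ d₂, m.toFun d.1 = m.toFun d₂.1 ∧
      C.inc (C.links.inc d₂) ∉ C.beyond X y ∧ d.2 = d₂.2 := by
    by_cases hb : d.2 = d'.2
    · exact ⟨d', h, hd', hb⟩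
    · refine ⟨opp d', h, by rwa [inc_inc_opp], ?_⟩
      change d.2 = !d'.2
      revert hb
      cases d.2 <;> cases d'.2 <;> simp
  obtain ⟨n, hn, hn', hend⟩ := m.exists_notMem_strandEnd_eq hX d
  obtain ⟨k, hk, hk', hend'⟩ := m.exists_notMem_strandEnd_eq hX d₂
  have heq := m.eq_of_strandEnd_eq hn' hk' (by rw [hend, hend']; exact Prod.ext hd₂ hb)
  apply hd₂'
  rw [← key d₂ (by rwa [← hd₂]) k hk, ← heq, key d hno n hn]
  exact hd

/-- The strand of a half-edge at `h` ends beyond `h`. -/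
theorem inc_strandEnd_mem_beyond {a : C.Corner × Bool} (ha : (C.links.inc a).1 ∈ X) :
    C.inc (uncontract ((C.contract X).links.inc (m.strandEnd a))) ∈
      C.beyond X (C.links.inc a) := by
  obtain ⟨n, hn, hn', hend⟩ := m.exists_notMem_strandEnd_eq hX a
  rw [← hend, m.uncontract_inc_strandEnd hn']
  have key : ∀ j, 0 < j → j ≤ n →
      C.inc (C.links.inc ((C.step ^ j) a)) ∈ C.beyond X (C.links.inc a) := by
    intro j
    induction j with
    | zero => intro h0; exact absurd h0 (lt_irrefl _)
    | succ j ihj =>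
      intro _ hj
      rw [pow_succ', Equiv.Perm.mul_apply, inc_step]
      rcases Nat.eq_zero_or_pos j with rfl | hj0
      · exact inc_opp_mem_beyond _
      · rw [mem_beyond_iff (hn j (by omega))]
        · exact ihj hj0 (by omega)
        · intro he
          apply hX.inc_step_pow_ne a hj0 fun i hi => hn i (by omega)
          rw [halfEdge_ext_of_fst (step_pow_face a j) he (step_pow_snd a j)]
  refine key n (Nat.pos_of_ne_zero ?_) le_rfl
  rintro rfl
  exact hn' ha

omit hX [Finite F] in
theorem toFun_mirror {a : C.Corner × Bool} (ha : (C.links.inc a).1 ∈ X) :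
    m.toFun (C.mirror a).1 = m.toFun a.1 :=
  congrArg Prod.fst (m.strandEnd_mirror_of_mem ha)

/-- In the link graphs of the contraction, what lies beyond `h` is connected. Functions `p` that are
constant along all edges beyond `h`, except for those that pass through `h`, are used to express
connectedness. The reason is that the parts of the link graphs of `C` of which it
consists remain connected when one vertex is deleted. -/
theorem eq_of_forall_beyond [Finite V] (hG : FiberwiseThreeConnected C.links C.inc) {α : Type*}
    (p : {e : E // e ∉ X} × Bool → α) (h : E × Bool) (hh : h.1 ∈ X)
    (hp : ∀ d, C.inc (C.links.inc d) ∈ C.beyond X h →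
      (∃ a, C.links.inc a = h ∧ m.toFun a.1 = m.toFun d.1) ∨
      p ((C.contract X).links.inc (m.strandEnd (opp d))) =
        p ((C.contract X).links.inc (m.strandEnd d)))
    {d d' : C.Corner × Bool} (hd : C.links.inc d = h) (hd' : C.links.inc d' = h) :
    p ((C.contract X).links.inc (m.strandEnd d)) =
      p ((C.contract X).links.inc (m.strandEnd d')) := by
  classical
  induction hn : (C.beyond X h).ncard using Nat.strong_induction_on generalizing h d d' with
  | _ n ih =>
    set P : C.Corner × Bool → α := fun d => p ((C.contract X).links.inc (m.strandEnd d)) with hP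
    -- The half-edges at `y` all lie on the same side of `p`: by induction if `y` belongs to `X`,
    -- and because `y` is a vertex of a link graph of the contraction otherwise.
    have hsame : ∀ y, C.inc y = C.inc (opp h) → y ≠ opp h → ∀ d d', C.links.inc d = y →
        C.links.inc d' = y → P d = P d' := by
      intro y hy hyne d d' hd hd'
      by_cases hyX : y.1 ∈ X
      · have hss := hX.beyond_ssubset hh hyX hy hyne
        refine ih _ ?_ y hyX ?_ hd hd' rfl
        · rw [← hn]
          exact Set.ncard_lt_ncard hss
        · intro k hk
          rcases hp k (hss.subset hk) with ⟨a, ha, hak⟩ | h1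
          · left
            refine m.exists_of_mem_beyond hX hak.symm hk ?_
            rw [ha]
            exact fun h' => hX.inc_notMem_beyond hh (hss.subset h')
          · exact Or.inr h1
      · simp only [hP]
        congr 1
        apply uncontract_injective
        rw [m.uncontract_inc_strandEnd (by rwa [hd]), m.uncontract_inc_strandEnd (by rwa [hd']),
          hd, hd']
    have hedge : ∀ k, C.inc (C.links.inc k) = C.inc (opp h) → C.links.inc k ≠ opp h →
        C.links.inc (opp k) ≠ opp h → P (opp k) = P k := by
      intro k hk h1 h2
      refine (hp k (by rw [hk]; exact inc_opp_mem_beyond h)).resolve_left ?_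
      rintro ⟨a, ha, hak⟩
      have haX : (C.links.inc a).1 ∈ X := by rwa [ha]
      have h3 := m.fst_eq_of_inc_eq hX (d := C.mirror a) (d' := k)
        (by rw [inc_mirror, ha, hk]) ((m.toFun_mirror haX).trans hak)
      rcases eq_or_eq_opp_of_fst_eq h3 with h4 | h4
      · apply h1
        rw [← h4, inc_mirror, ha]
      · apply h2
        rw [← h4, inc_mirror, ha]
    have hstep : ∀ d, C.links.inc d = h → P (C.step d) = P d ∧
        C.inc (C.links.inc (C.step d)) = C.inc (opp h) ∧ C.links.inc (C.step d) ≠ opp h := by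
      intro d hd
      refine ⟨?_, by rw [inc_step, hd], ?_⟩
      · simp only [hP, m.strandEnd_step (d := d) (by rwa [hd])]
      · rw [← hd, ← inc_mirror, step_apply]
        exact hG.no_loop _
    obtain ⟨e1, v1, n1⟩ := hstep d hd
    obtain ⟨e2, v2, n2⟩ := hstep d' hd'
    change P d = P d'
    rw [← e1, ← e2]
    have hone : ∀ k, C.links.inc k ≠ opp h → C.links.inc (opp k) ≠ opp h →
        (C.inc (C.links.inc k) = C.inc (opp h) →
          ∀ d₁, C.links.inc d₁ = C.links.inc k → P d₁ = P (C.step d)) →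
        (C.inc (C.links.inc (opp k)) = C.inc (opp h) →
          ∀ d₁, C.links.inc d₁ = C.links.inc (opp k) → P d₁ = P (C.step d)) := by
      intro k hk hk' hQ hv d₁ hd₁
      have hv' := hv
      rw [inc_inc_opp] at hv'
      rw [hsame _ hv hk' d₁ (opp k) hd₁ rfl, hedge k hv' hk hk']
      exact hQ hv' k rfl
    -- The link graph at the end of `h` remains connected when `opp h` is deleted.
    have := hG.conn_eq (p := fun y => C.inc y = C.inc (opp h) →
      ∀ d₁, C.links.inc d₁ = y → P d₁ = P (C.step d)) {opp h} (by simp) ?_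
      (v := C.links.inc (C.step d)) (w := C.links.inc (C.step d')) (v1.trans v2.symm)
      (by simpa using n1) (by simpa using n2)
    · exact (this.mp (fun _ d₁ hd₁ => hsame _ v1 n1 _ _ hd₁ rfl) v2 _ rfl).symm
    · intro k hk hk'
      simp only [Finset.mem_singleton] at hk hk'
      refine propext ⟨?_, hone k hk hk'⟩
      have := hone (opp k) hk' (by rwa [opp_opp])
      rwa [opp_opp] at this

end Merge

theorem IsForest.nonempty_merge [Finite F] (hX : C.IsForest X) : Nonempty (Merge C X) := by
  obtain ⟨m, h1, h2, h3, h4⟩ := C.exists_merge X hX.exists_notMem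
  exact ⟨⟨m, h1, h2, h3, h4⟩⟩

end TwoComplex

namespace TwoComplex

open MultiGraph

variable {V E F : Type*} {C : TwoComplex V E F} {X : Set E}

/-! ### Lifting a rotation system from a contraction -/

/-- A closed walk leaves a set `S` as often as it enters it. -/
theorem card_leave_eq_card_enter {Z : Type*} [Finite Z] (φ : Equiv.Perm Z) (o : Z → Z)
    (S Q : Z → Prop) (hS : ∀ z, S (φ z) ↔ S (o z)) (hQ : ∀ z, Q (φ z) ↔ Q z) :
    Nat.card {z // Q z ∧ S z ∧ ¬ S (o z)} = Nat.card {z // Q z ∧ ¬ S z ∧ S (o z)} := by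
  classical
  have := Fintype.ofFinite Z
  have h1 : Nat.card {z // Q z ∧ S (o z)} = Nat.card {z // Q z ∧ S z} :=
    Nat.card_congr (φ.subtypeEquiv fun z => by rw [hS, hQ])
  rw [Nat.card_eq_fintype_card, Nat.card_eq_fintype_card, Fintype.card_subtype,
    Fintype.card_subtype] at h1 ⊢
  have h2 := Finset.card_filter_add_card_filter_not (s := Finset.univ.filter fun z => Q z ∧ S z)
    (fun z => S (o z))
  have h3 := Finset.card_filter_add_card_filter_not
    (s := Finset.univ.filter fun z => Q z ∧ S (o z)) (fun z => S z)
  simp only [Finset.filter_filter, and_assoc] at h2 h3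
  have h4 : (Finset.univ.filter fun z => Q z ∧ S (o z) ∧ S z) =
      Finset.univ.filter fun z => Q z ∧ S z ∧ S (o z) :=
    Finset.filter_congr fun z _ => by tauto
  have h5 : (Finset.univ.filter fun z => Q z ∧ S (o z) ∧ ¬ S z) =
      Finset.univ.filter fun z => Q z ∧ ¬ S z ∧ S (o z) :=
    Finset.filter_congr fun z _ => by tauto
  rw [h4, h5] at h3
  omega

namespace Merge

variable (m : Merge C X) [Finite F] (hX : C.IsForest X)
include hX

omit [Finite F] hX in
/-- The vertex of `C` at which a half-edge of a link graph of the contraction is attached does not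
change along the rotation. -/
theorem inc_uncontract_rotation {σ : Equiv.Perm ((C.contract X).Corner × Bool)}
    (hσ : (C.contract X).links.IsRotation σ) (z : (C.contract X).Corner × Bool) :
    (C.contract X).links.inc (faceStep σ z) = (C.contract X).links.inc (opp z) :=
  hσ.inc_eq (opp z)

/-- Every face of the surface given by the rotation `σ` of the link graphs of the contraction passes
from what lies beyond `h` to the rest as often as the other way round. -/
theorem card_strandEnd_eq [Finite E] {σ : Equiv.Perm ((C.contract X).Corner × Bool)}
    (hσ : (C.contract X).links.IsRotation σ) {h : E × Bool} (hh : h.1 ∈ X)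
    (Q : (C.contract X).Corner × Bool → Prop) (hQ : ∀ z, Q (faceStep σ z) ↔ Q z) :
    Nat.card {a // C.links.inc a = h ∧ Q (m.strandEnd a)} =
      Nat.card {a // C.links.inc a = h ∧ Q (m.strandEnd (C.mirror a))} := by
  let S : (C.contract X).Corner × Bool → Prop := fun z =>
    C.inc (uncontract ((C.contract X).links.inc z)) ∈ C.beyond X h
  have hcard := card_leave_eq_card_enter (faceStep σ) opp S Q
    (fun z => by simp only [S, inc_uncontract_rotation hσ]) hQ
  have hin : ∀ a, C.links.inc a = h → S (m.strandEnd a) ∧ ¬ S (opp (m.strandEnd a)) := by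
    rintro a rfl
    refine ⟨m.inc_strandEnd_mem_beyond hX hh, fun h' => ?_⟩
    have h1 := m.inc_strandEnd_mem_beyond hX (a := C.mirror a) (by rw [inc_mirror]; exact hh)
    rw [inc_mirror, m.strandEnd_mirror_of_mem hh, strandEnd_opp] at h1
    exact hX.notMem_beyond_opp hh h' h1
  -- The corners at which a face leaves `S` are just those through which a strand at `h` runs.
  have hout : ∀ z, S z → ¬ S (opp z) → ∃ a, C.links.inc a = h ∧ m.strandEnd a = z := by
    intro z hz hz'
    obtain ⟨d, hd, rfl⟩ := m.exists_strandEnd_eq z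
    obtain ⟨d', hd', hdd'⟩ := m.exists_strandEnd_eq (opp (m.strandEnd d))
    rw [← hdd'] at hz'
    simp only [S, m.uncontract_inc_strandEnd hd, m.uncontract_inc_strandEnd hd'] at hz hz'
    have h1 : m.toFun d'.1 = m.toFun d.1 := congrArg Prod.fst hdd'
    obtain ⟨a, ha, had⟩ := m.exists_of_mem_beyond hX h1.symm hz hz'
    refine ⟨a, ha, ?_⟩
    rcases eq_or_eq_opp_of_fst_eq (d := m.strandEnd a) (d' := m.strandEnd d) had with h2 | h2
    · exact h2
    · exfalso
      have := (hin a ha).1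
      rw [h2, ← hdd'] at this
      simp only [S, m.uncontract_inc_strandEnd hd'] at this
      exact hz' this
  have e1 : Nat.card {a // C.links.inc a = h ∧ Q (m.strandEnd a)} =
      Nat.card {z // Q z ∧ S z ∧ ¬ S (opp z)} := by
    refine Nat.card_congr (Equiv.ofBijective
      (fun a => ⟨m.strandEnd a.1, a.2.2, hin a.1 a.2.1⟩) ⟨?_, ?_⟩)
    · rintro ⟨a, ha, _⟩ ⟨b, hb, _⟩ hab
      exact Subtype.ext (m.eq_of_inc_eq hX (by rw [ha, hb]) (congrArg Subtype.val hab))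
    · rintro ⟨z, hz, hzS, hzS'⟩
      obtain ⟨a, ha, rfl⟩ := hout z hzS hzS'
      exact ⟨⟨a, ha, hz⟩, rfl⟩
  have e2 : Nat.card {a // C.links.inc a = h ∧ Q (m.strandEnd (C.mirror a))} =
      Nat.card {z // Q z ∧ ¬ S z ∧ S (opp z)} := by
    have hm : ∀ a, C.links.inc a = h → m.strandEnd (C.mirror a) = opp (m.strandEnd a) := by
      intro a ha
      rw [m.strandEnd_mirror_of_mem (by rwa [ha]), strandEnd_opp]
    refine Nat.card_congr (Equiv.ofBijective
      (fun a => ⟨m.strandEnd (C.mirror a.1), a.2.2, ?_, ?_⟩) ⟨?_, ?_⟩)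
    · rw [hm a.1 a.2.1]
      exact (hin a.1 a.2.1).2
    · rw [hm a.1 a.2.1, opp_opp]
      exact (hin a.1 a.2.1).1
    · rintro ⟨a, ha, _⟩ ⟨b, hb, _⟩ hab
      have := congrArg Subtype.val hab
      simp only [hm a ha, hm b hb] at this
      exact Subtype.ext (m.eq_of_inc_eq hX (by rw [ha, hb]) (opp.injective this))
    · rintro ⟨z, hz, hzS, hzS'⟩
      obtain ⟨a, ha, haz⟩ := hout (opp z) hzS' (by rwa [opp_opp])
      have : m.strandEnd (C.mirror a) = z := by rw [hm a ha, haz, opp_opp]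
      exact ⟨⟨a, ha, by rwa [this]⟩, Subtype.ext this⟩
  rw [e1, e2, hcard]

/-- The rotators at the contracted edges: after the strand through an edge in `X` along which a face
of the surface enters one side, the rotator has a strand along which
this face leaves that side. -/
theorem exists_rotator [Finite E] {σ : Equiv.Perm ((C.contract X).Corner × Bool)}
    (hσ : (C.contract X).links.IsRotation σ) :
    ∃ ρ : Equiv.Perm {a : C.Corner × Bool // (C.links.inc a).1 ∈ X ∧ (C.links.inc a).2 = false},
      ∀ a, C.links.inc (ρ a).1 = C.links.inc a.1 ∧
        (faceStep σ).SameCycle (m.strandEnd (ρ a).1) (m.strandEnd (C.mirror a.1)) := by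
  let A := {a : C.Corner × Bool // (C.links.inc a).1 ∈ X ∧ (C.links.inc a).2 = false}
  let Orb := Quotient (Equiv.Perm.SameCycle.setoid (faceStep σ))
  let mk : (C.contract X).Corner × Bool → Orb := Quotient.mk _
  have hmk : ∀ z z', mk z = mk z' ↔ (faceStep σ).SameCycle z z' := fun z z' => Quotient.eq
  let f₁ : A → (E × Bool) × Orb := fun a => (C.links.inc a.1, mk (m.strandEnd a.1))
  let f₂ : A → (E × Bool) × Orb := fun a => (C.links.inc a.1, mk (m.strandEnd (C.mirror a.1)))
  -- On every face of the surface there are as many strands at `h` that leave as strands that enter.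
  have hne : ∀ c, Nonempty ({a // f₂ a = c} ≃ {a // f₁ a = c}) := by
    rintro ⟨h, Q⟩
    have hmove : ∀ g : C.Corner × Bool → Orb, (h.1 ∈ X ∧ h.2 = false) →
        Nat.card {a : A // (C.links.inc a.1, g a.1) = (h, Q)} =
          Nat.card {a // C.links.inc a = h ∧ g a = Q} := by
      intro g hh
      refine Nat.card_congr ⟨fun a => ⟨a.1.1, Prod.mk.inj a.2⟩,
        fun a => ⟨⟨a.1, by rw [a.2.1]; exact hh⟩, Prod.ext a.2.1 a.2.2⟩, fun a => rfl, fun a => rfl⟩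
    by_cases hh : h.1 ∈ X ∧ h.2 = false
    · refine Finite.card_eq.1 ?_
      rw [hmove (fun a => mk (m.strandEnd (C.mirror a))) hh,
        hmove (fun a => mk (m.strandEnd a)) hh]
      refine (m.card_strandEnd_eq hX hσ hh.1 (fun z => mk z = Q) fun z => ?_).symm
      have : mk (faceStep σ z) = mk z :=
        (hmk _ _).2 (Equiv.Perm.sameCycle_apply_left.2 (.refl _ _))
      rw [this]
    · have he : ∀ a : A, C.links.inc a.1 ≠ h := fun a ha => hh (ha ▸ a.2)
      have : IsEmpty {a // f₂ a = (h, Q)} := ⟨fun a => he a.1 (congrArg Prod.fst a.2)⟩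
      have : IsEmpty {a // f₁ a = (h, Q)} := ⟨fun a => he a.1 (congrArg Prod.fst a.2)⟩
      exact ⟨Equiv.equivOfIsEmpty _ _⟩
  refine ⟨Equiv.ofFiberEquiv fun c => (hne c).some, fun a => ?_⟩
  have := Equiv.ofFiberEquiv_map (fun c => (hne c).some) a
  exact ⟨congrArg Prod.fst this, (hmk _ _).1 (congrArg Prod.snd this)⟩

/-- The rotation system of the link graphs of `C` obtained from one of the contraction. -/
theorem exists_lift [Finite E] {σ : Equiv.Perm ((C.contract X).Corner × Bool)}
    (hσ : (C.contract X).links.IsRotation σ) :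
    ∃ τ : Equiv.Perm (C.Corner × Bool),
      (∀ d, C.links.inc (τ d) = C.links.inc d) ∧
      (∀ d, (C.links.inc d).1 ∉ X → m.strandEnd (τ d) = σ (m.strandEnd d)) ∧
      (∀ d, (faceStep σ).SameCycle (m.strandEnd (τ d)) (m.strandEnd (opp d))) ∧
      ∀ x ∈ X, C.ReverseAt τ x := by
  classical
  obtain ⟨ρ, hρ⟩ := m.exists_rotator hX hσ
  let N : (C.Corner × Bool) → Prop := fun d => (C.links.inc d).1 ∉ X
  let A : (C.Corner × Bool) → Prop := fun a => (C.links.inc a).1 ∈ X ∧ (C.links.inc a).2 = false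
  let E₀ : {d // N d} ≃ (C.contract X).Corner × Bool :=
    Equiv.ofBijective (fun d => m.strandEnd d.1)
      ⟨fun d d' h => Subtype.ext (m.eq_of_strandEnd_eq d.2 d'.2 h), fun z => by
        obtain ⟨d, hd, rfl⟩ := m.exists_strandEnd_eq z
        exact ⟨⟨d, hd⟩, rfl⟩⟩
  -- Away from `X` take over `σ`. At an edge in `X` take `ρ` at its first half, and the reverse of
  -- `ρ`, carried over by `mirror`, at its second half.
  let σ₁ : Equiv.Perm (C.Corner × Bool) := Equiv.Perm.ofSubtype (E₀.symm.permCongr σ)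
  let R : Equiv.Perm (C.Corner × Bool) := Equiv.Perm.ofSubtype ρ
  let τ : Equiv.Perm (C.Corner × Bool) := σ₁ * (R * (C.mirror * (R⁻¹ * C.mirror)))
  have hR : ∀ d, A d → A (R d) ∧ C.links.inc (R d) = C.links.inc d ∧
      (faceStep σ).SameCycle (m.strandEnd (R d)) (m.strandEnd (C.mirror d)) := by
    intro d hd
    simp only [R, Equiv.Perm.ofSubtype_apply_of_mem ρ hd]
    exact ⟨(ρ ⟨d, hd⟩).2, hρ ⟨d, hd⟩⟩
  have hR0 : ∀ d, ¬ A d → R d = d := fun d hd => Equiv.Perm.ofSubtype_apply_of_not_mem ρ hd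
  have hR0' : ∀ d, ¬ A d → R.symm d = d := fun d hd => by
    rw [Equiv.symm_apply_eq, hR0 d hd]
  have hR' : ∀ d, A d → A (R.symm d) := by
    intro d hd
    by_contra h
    have := hR0 _ h
    rw [Equiv.apply_symm_apply] at this
    rw [← this] at h
    exact h hd
  have hN : ∀ d, ¬ N d → σ₁ d = d := fun d hd => Equiv.Perm.ofSubtype_apply_of_not_mem _ hd
  have hNA : ∀ d, A d → ¬ N d := fun d hd h => h hd.1
  have hmX : ∀ d, (C.links.inc (C.mirror d)).1 = (C.links.inc d).1 := fun d => by
    rw [inc_mirror]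
    rfl
  have hmA : ∀ d, A d → ¬ A (C.mirror d) := by
    intro d hd h
    have := h.2
    rw [inc_mirror] at this
    change (!(C.links.inc d).2) = false at this
    rw [hd.2] at this
    exact absurd this (by simp)
  -- The three parts of the rotation.
  have t1 : ∀ d, N d → τ d = σ₁ d := by
    intro d hd
    have h1 : ¬ A (C.mirror d) := fun h => hd (by rw [← hmX]; exact h.1)
    change σ₁ (R (C.mirror (R.symm (C.mirror d)))) = _
    rw [hR0' _ h1, mirror_mirror, hR0 d fun h => hd h.1]
  have t2 : ∀ d, A d → τ d = R d := by
    intro d hd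
    change σ₁ (R (C.mirror (R.symm (C.mirror d)))) = _
    rw [hR0' _ (hmA d hd), mirror_mirror, hN _ (hNA _ (hR d hd).1)]
  have t3 : ∀ d, A d → τ (C.mirror d) = C.mirror (R.symm d) := by
    intro d hd
    change σ₁ (R (C.mirror (R.symm (C.mirror (C.mirror d))))) = _
    rw [mirror_mirror, hR0 _ (hmA _ (hR' d hd)), hN]
    exact fun h => h (by rw [hmX]; exact (hR' d hd).1)
  have hcases : ∀ d, N d ∨ A d ∨ ∃ a, A a ∧ d = C.mirror a := by
    intro d
    by_cases h : N d
    · exact Or.inl h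
    · refine Or.inr ?_
      have hd : (C.links.inc d).1 ∈ X := not_not.1 h
      by_cases hb : (C.links.inc d).2 = false
      · exact Or.inl ⟨hd, hb⟩
      · refine Or.inr ⟨C.mirror d, ⟨by rwa [hmX], ?_⟩, (mirror_mirror d).symm⟩
        rw [inc_mirror]
        change (!(C.links.inc d).2) = false
        simpa using hb
  have hem : ∀ d, N d → N (τ d) ∧ m.strandEnd (τ d) = σ (m.strandEnd d) := by
    intro d hd
    rw [t1 d hd]
    simp only [σ₁, Equiv.Perm.ofSubtype_apply_of_mem _ hd]
    refine ⟨Subtype.prop _, ?_⟩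
    rw [Equiv.permCongr_apply, Equiv.symm_symm]
    exact E₀.apply_symm_apply _
  refine ⟨τ, ?_, fun d hd => (hem d hd).2, ?_, ?_⟩
  · intro d
    rcases hcases d with hd | hd | ⟨a, ha, rfl⟩
    · obtain ⟨h1, h2⟩ := hem d hd
      rw [← m.uncontract_inc_strandEnd h1, h2, hσ.inc_eq, m.uncontract_inc_strandEnd hd]
    · rw [t2 d hd]
      exact (hR d hd).2.1
    · rw [t3 a ha, inc_mirror, inc_mirror, ← (hR _ (hR' a ha)).2.1, Equiv.apply_symm_apply]
  · intro d
    rcases hcases d with hd | hd | ⟨a, ha, rfl⟩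
    · rw [(hem d hd).2, strandEnd_opp, ← Equiv.Perm.sameCycle_apply_right (y := opp _),
        faceStep_apply, opp_opp]
    · rw [t2 d hd, ← m.strandEnd_mirror_of_mem hd.1]
      exact (hR d hd).2.2
    · have h1 := (hR _ (hR' a ha)).2.2
      rw [Equiv.apply_symm_apply] at h1
      rw [t3 a ha, ← m.strandEnd_mirror_of_mem (by rw [hmX]; exact ha.1), mirror_mirror]
      exact h1.symm
  · intro x hx d hd
    have hdX : (C.links.inc d).1 ∈ X := by rwa [hd]
    rcases hcases d with hd | hd | ⟨a, ha, rfl⟩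
    · exact absurd hdX hd
    · rw [t2 d hd, t3 _ (hR d hd).1, Equiv.symm_apply_apply]
    · rw [t3 a ha, mirror_mirror, t2 _ (hR' a ha), Equiv.apply_symm_apply, mirror_mirror]

end Merge

end TwoComplex

namespace TwoComplex

open MultiGraph

variable {V E F : Type*} {C : TwoComplex V E F} {X : Set E}

namespace Merge

variable (m : Merge C X) [Fintype F]

open Classical in
/-- The sum of `w` over all corners that are merged into one corner of the contraction. -/
noncomputable def push (w : C.Corner → ZMod 2) (c' : (C.contract X).Corner) : ZMod 2 :=
  ∑ c, if m.toFun c = c' then w c else 0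

theorem sum_push (w : C.Corner → ZMod 2) (q : (C.contract X).Corner × Bool → ZMod 2) :
    ∑ z, q z * m.push w z.1 = ∑ d : C.Corner × Bool, q (m.strandEnd d) * w d.1 := by
  classical
  rw [sum_halfEdges, sum_halfEdges]
  simp only [← add_mul]
  simp only [push, Finset.mul_sum]
  rw [Finset.sum_comm]
  refine Finset.sum_congr rfl fun c _ => ?_
  rw [Finset.sum_eq_single (m.toFun c)]
  · rw [if_pos rfl]
    rfl
  · intro c' _ hc'
    rw [if_neg hc'.symm, mul_zero]
  · simp

theorem exists_of_push_ne_zero {w : C.Corner → ZMod 2} {c' : (C.contract X).Corner}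
    (h : m.push w c' ≠ 0) : ∃ c, m.toFun c = c' ∧ w c ≠ 0 := by
  by_contra hcon
  push Not at hcon
  apply h
  refine Finset.sum_eq_zero fun c _ => ?_
  split_ifs with hc
  · exact hcon c hc
  · rfl

variable (hX : C.IsForest X)
include hX

/-- Strands pass every vertex at most once, so that there is at most one term in the sum if all
corners are at the same vertex. -/
theorem push_eq {w : C.Corner → ZMod 2} {v : V} (hw : ∀ c, C.inc c.leave ≠ v → w c = 0)
    {c : C.Corner} (hc : C.inc c.leave = v) : m.push w (m.toFun c) = w c := by
  classical
  rw [push, Finset.sum_eq_single c]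
  · rw [if_pos rfl]
  · intro c' _ hc'
    split_ifs with h
    · refine hw _ fun hv => hc' ?_
      exact m.fst_eq_of_inc_eq hX (d := (c', true)) (d' := (c, true)) (hv.trans hc.symm) h
    · rfl
  · simp

variable {σ : Equiv.Perm ((C.contract X).Corner × Bool)} {τ : Equiv.Perm (C.Corner × Bool)}

/-- The rotators of the lifted rotation system at the contracted edges are cyclic: by planarity,
the set of strands in one cycle is a cut, but as both sides are connected, there is only one cut
in which only these strands can lie. -/
theorem isRotation_lift [Finite V] (hG : FiberwiseThreeConnected C.links C.inc)
    (hσ : (C.contract X).links.IsRotation σ) (hc : (C.contract X).links.TrivialCohomology σ)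
    (hinc : ∀ d, C.links.inc (τ d) = C.links.inc d)
    (hend : ∀ d, (C.links.inc d).1 ∉ X → m.strandEnd (τ d) = σ (m.strandEnd d))
    (hface : ∀ d, (faceStep σ).SameCycle (m.strandEnd (τ d)) (m.strandEnd (opp d))) :
    C.links.IsRotation τ := by
  classical
  refine isRotation_of hinc fun d d' hdd' => ?_
  by_cases hd : (C.links.inc d).1 ∈ X
  · obtain ⟨h, hh⟩ : ∃ h, C.links.inc d = h := ⟨_, rfl⟩
    have hh' : C.links.inc d' = h := by rw [← hdd', hh]
    rw [hh] at hd
    -- The indicator function of the cycle of `d`, and the edge set `w` it gives.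
    let u : C.Corner × Bool → ZMod 2 := fun a =>
      if C.links.inc a = h ∧ τ.SameCycle d a then 1 else 0
    have huτ : ∀ a, u (τ a) = u a := by
      intro a
      simp only [u, hinc, Equiv.Perm.sameCycle_apply_right]
    let w : C.Corner → ZMod 2 := fun c => u (c, true) + u (c, false)
    have hwu : ∀ d : C.Corner × Bool, w d.1 = u d + u (opp d) := by
      rintro ⟨c, b⟩
      cases b
      · exact add_comm _ _
      · rfl
    have hw0 : ∀ c, w c ≠ 0 → ∃ a, C.links.inc a = h ∧ a.1 = c := by
      intro c hc
      by_contra hcon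
      push Not at hcon
      apply hc
      have : ∀ b, u (c, b) = 0 := fun b => if_neg fun h' => hcon (c, b) h'.1 rfl
      simp only [w, this, add_zero]
    -- Faces of the surface traverse `w` evenly, because they enter and leave along the same cycle
    -- of `τ`.
    obtain ⟨p, hp⟩ := hc (m.push w) (by
      intro q hq
      have h1 : ∀ d, q (m.strandEnd (opp d)) = q (m.strandEnd (τ d)) := fun d =>
        eq_of_sameCycle_face hq (hface d)
      have h2 : ∑ d, q (m.strandEnd d) * u (opp d) = ∑ d, q (m.strandEnd d) * u d := by
        rw [← sum_opp, ← Equiv.sum_comp τ fun d => q (m.strandEnd d) * u d]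
        simp only [opp_opp, h1, huτ]
      rw [m.sum_push]
      simp only [hwu, mul_add, Finset.sum_add_distrib]
      rw [h2, CharTwo.add_self_eq_zero])
    have hpush0 : ∀ c', (¬ ∃ a, C.links.inc a = h ∧ m.toFun a.1 = c') → m.push w c' = 0 := by
      intro c' hcon
      by_contra hne
      obtain ⟨c, hc1, hc2⟩ := m.exists_of_push_ne_zero hne
      obtain ⟨a, ha, rfl⟩ := hw0 c hc2
      exact hcon ⟨a, ha, hc1⟩
    have hpush : ∀ a, C.links.inc a = h → m.push w (m.toFun a.1) = u a := by
      intro a ha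
      rw [m.push_eq hX (v := C.inc h), hwu]
      · have : u (opp a) = 0 := if_neg fun h' => hG.no_loop a (h'.1.trans ha.symm)
        rw [this, add_zero]
      · intro c hc
        by_contra hne
        obtain ⟨b, hb, rfl⟩ := hw0 c hne
        exact hc (by rw [← inc_inc, hb])
      · rw [← inc_inc, ha]
    have hedge : ∀ d, (¬ ∃ a, C.links.inc a = h ∧ m.toFun a.1 = m.toFun d.1) →
        p ((C.contract X).links.inc (m.strandEnd (opp d))) =
          p ((C.contract X).links.inc (m.strandEnd d)) := by
      intro d hcon
      have := hp (m.strandEnd d)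
      rw [show m.push w (m.strandEnd d).1 = 0 from hpush0 _ hcon] at this
      exact (CharTwo.add_eq_zero.1 this.symm).symm
    -- Both sides of the cut are constant along the strands at `h`, and so is `u`.
    have s1 := m.eq_of_forall_beyond hX hG p h hd
      (fun d _ => or_iff_not_imp_left.2 (hedge d)) hh hh'
    have s2 := m.eq_of_forall_beyond hX hG p (opp h) hd
      (fun d _ => by
        by_cases hcon : ∃ a, C.links.inc a = h ∧ m.toFun a.1 = m.toFun d.1
        · obtain ⟨a, ha, had⟩ := hcon
          exact Or.inl ⟨C.mirror a, by rw [inc_mirror, ha],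
            (m.toFun_mirror (by rwa [ha])).trans had⟩
        · exact Or.inr (hedge d hcon))
      (d := C.mirror d) (d' := C.mirror d') (by rw [inc_mirror, hh]) (by rw [inc_mirror, hh'])
    have hu : ∀ a, C.links.inc a = h → u a = p ((C.contract X).links.inc (m.strandEnd a)) +
        p ((C.contract X).links.inc (m.strandEnd (C.mirror a))) := by
      intro a ha
      rw [← hpush a ha, m.strandEnd_mirror_of_mem (by rwa [ha])]
      exact hp (m.strandEnd a)
    have hud : u d' = 1 := by
      rw [hu d' hh', ← s1, ← s2, ← hu d hh]
      exact if_pos ⟨hh, .refl _ _⟩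
    by_contra hcon
    have : u d' = 0 := if_neg fun h' => hcon h'.2
    rw [this] at hud
    exact absurd hud (by decide)
  · have hd' : (C.links.inc d').1 ∉ X := by rwa [← hdd']
    have h1 : (C.contract X).links.inc (m.strandEnd d) =
        (C.contract X).links.inc (m.strandEnd d') := by
      apply uncontract_injective
      rw [m.uncontract_inc_strandEnd hd, m.uncontract_inc_strandEnd hd', hdd']
    obtain ⟨n, -, hn⟩ := ((hσ _ _).2 h1).exists_pow_eq'
    have key : ∀ n : ℕ, (C.links.inc ((τ ^ n) d)).1 ∉ X ∧
        m.strandEnd ((τ ^ n) d) = (σ ^ n) (m.strandEnd d) := by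
      intro n
      induction n with
      | zero => exact ⟨hd, rfl⟩
      | succ n ih =>
        rw [pow_succ', Equiv.Perm.mul_apply, hinc, hend _ ih.1, ih.2, pow_succ',
          Equiv.Perm.mul_apply]
        exact ⟨ih.1, rfl⟩
    refine ⟨n, ?_⟩
    rw [zpow_natCast]
    exact m.eq_of_strandEnd_eq (key n).1 hd' ((key n).2.trans hn)

theorem trivialCohomology_lift [Finite V] (hG : FiberwiseThreeConnected C.links C.inc)
    (hc : (C.contract X).links.TrivialCohomology σ)
    (hinc : ∀ d, C.links.inc (τ d) = C.links.inc d)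
    (hface : ∀ d, (faceStep σ).SameCycle (m.strandEnd (τ d)) (m.strandEnd (opp d))) :
    C.links.TrivialCohomology τ := by
  classical
  intro g hg
  -- The part of `g` in the link graph at one vertex `v` of `C` is a cut `p v` in the link graph of
  -- the contraction.
  let w : V → C.Corner → ZMod 2 := fun v c => if C.inc c.leave = v then g c else 0
  have hw : ∀ v c, C.inc c.leave ≠ v → w v c = 0 := fun v c h => if_neg h
  have : ∀ v, ∃ p : {e : E // e ∉ X} × Bool → ZMod 2, ∀ z, m.push (w v) z.1 =
      p ((C.contract X).links.inc z) + p ((C.contract X).links.inc (opp z)) := by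
    intro v
    refine hc _ fun q hq => ?_
    rw [m.sum_push, ← hg fun d => if C.inc d.1.leave = v then q (m.strandEnd d) else 0]
    · refine Finset.sum_congr rfl fun d _ => ?_
      simp only [w]
      split_ifs <;> simp
    · intro d
      have h1 : C.inc (τ (opp d)).1.leave = C.inc d.1.leave := by
        rw [← inc_inc, hinc, inc_inc]
        rfl
      have h2 := eq_of_sameCycle_face hq (hface (opp d))
      rw [opp_opp] at h2
      simp only [h1, h2]
  choose p hp using this
  -- The value of `p v` at a contracted half-edge of `v` is that at the end of any strand through
  -- it; all these ends agree, since what lies beyond this half-edge is connected and avoids `v`.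
  let P : E × Bool → ZMod 2 := fun h =>
    if hex : ∃ a, C.links.inc a = h then
      p (C.inc h) ((C.contract X).links.inc (m.strandEnd hex.choose)) else 0
  have hP : ∀ a v, C.inc (C.links.inc a) = v →
      P (C.links.inc a) = p v ((C.contract X).links.inc (m.strandEnd a)) := by
    rintro a v rfl
    have hex : ∃ b, C.links.inc b = C.links.inc a := ⟨a, rfl⟩
    simp only [P, dif_pos hex]
    have hb := hex.choose_spec
    by_cases ha : (C.links.inc a).1 ∈ X
    · refine m.eq_of_forall_beyond hX hG _ (C.links.inc a) ha ?_ hb rfl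
      intro d hd
      by_cases h0 : m.push (w (C.inc (C.links.inc a))) (m.toFun d.1) = 0
      · right
        have := hp (C.inc (C.links.inc a)) (m.strandEnd d)
        rw [show m.push _ (m.strandEnd d).1 = 0 from h0] at this
        exact (CharTwo.add_eq_zero.1 this.symm).symm
      · left
        obtain ⟨c, hc1, hc2⟩ := m.exists_of_push_ne_zero h0
        have hcv : C.inc c.leave = C.inc (C.links.inc a) := by
          by_contra h
          exact hc2 (hw _ _ h)
        refine m.exists_of_mem_beyond hX (d' := (c, true)) hc1.symm hd ?_
        change C.inc c.leave ∉ _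
        rw [hcv]
        exact hX.inc_notMem_beyond ha
    · congr 1
      apply uncontract_injective
      rw [m.uncontract_inc_strandEnd (by rwa [hb]), m.uncontract_inc_strandEnd ha, hb]
  refine ⟨P, fun d => ?_⟩
  rw [hP d _ rfl, hP (opp d) _ (inc_inc_opp d), strandEnd_opp, ← hp, inc_inc]
  refine Eq.trans ?_ (m.push_eq hX (hw _) rfl).symm
  simp [w]

omit [Fintype F] hX in
theorem reverseAt_lift (hinc : ∀ d, C.links.inc (τ d) = C.links.inc d)
    (hend : ∀ d, (C.links.inc d).1 ∉ X → m.strandEnd (τ d) = σ (m.strandEnd d))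
    {e : E} (he : e ∉ X) (h : (C.contract X).ReverseAt σ ⟨e, he⟩) : C.ReverseAt τ e := by
  rintro d rfl
  have h1 : (C.links.inc (C.mirror (τ d))).1 ∉ X := by
    rw [inc_mirror, hinc]
    exact he
  have h2 : (C.links.inc (C.mirror d)).1 ∉ X := by
    rw [inc_mirror]
    exact he
  apply m.eq_of_strandEnd_eq (by rwa [hinc]) h2
  rw [hend _ h1, m.strandEnd_mirror_of_notMem (by rwa [hinc]), hend _ he,
    m.strandEnd_mirror_of_notMem he]
  apply h
  exact Subtype.ext (congrArg Prod.fst (m.uncontract_inc_strandEnd he))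

end Merge

/-- If the contraction of a forest `X` is locally planar, then the link graphs of `C` have planar
rotation systems that are compatible along the edges of `X` and along the edges that become loops.
-/
theorem IsForest.exists_rotation [Finite V] [Finite E] [Fintype F] (hX : C.IsForest X)
    (hG : FiberwiseThreeConnected C.links C.inc) (hP : (C.contract X).LocallyPlanar) :
    ∃ τ : Equiv.Perm (C.Corner × Bool), C.links.IsRotation τ ∧ C.links.TrivialCohomology τ ∧
      (∀ x ∈ X, C.ReverseAt τ x) ∧
      ∀ (e : E) (he : e ∉ X), (C.contract X).IsLoop ⟨e, he⟩ → C.ReverseAt τ e := by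
  obtain ⟨T, hT, hl⟩ := hP.exists_rotations
  obtain ⟨m⟩ := hX.nonempty_merge
  have hσ := isRotation_rotation T
  have hc := trivialCohomology_rotation hT
  obtain ⟨τ, h1, h2, h3, h4⟩ := m.exists_lift hX hσ
  exact ⟨τ, m.isRotation_lift hX hG hσ hc h1 h2 h3, m.trivialCohomology_lift hX hG hc h1 h3, h4,
    fun e he hloop => m.reverseAt_lift h1 h2 he (hl _ hloop)⟩

end TwoComplex

namespace MultiGraph

variable {V E : Type*} {G : MultiGraph V E}

/-! ### Edge weights that are even on chordless cycles -/

theorem isWalk_append {l l' : List (E × Bool)} {v w : V} :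
    G.IsWalk v (l ++ l') w ↔ ∃ u, G.IsWalk v l u ∧ G.IsWalk u l' w := by
  induction l generalizing v with
  | nil => exact ⟨fun h => ⟨v, rfl, h⟩, by rintro ⟨u, rfl, h⟩; exact h⟩
  | cons d l ih =>
    constructor
    · rintro ⟨h, h'⟩
      obtain ⟨u, h1, h2⟩ := ih.1 h'
      exact ⟨u, ⟨h, h1⟩, h2⟩
    · rintro ⟨u, ⟨h, h1⟩, h2⟩
      exact ⟨h, ih.2 ⟨u, h1, h2⟩⟩

theorem isWalk_singleton {d : E × Bool} {v w : V} :
    G.IsWalk v [d] w ↔ G.inc d = v ∧ G.inc (opp d) = w := Iff.rfl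

theorem IsWalk.split {l : List (E × Bool)} {v w : V} (h : G.IsWalk v l w) {i : ℕ}
    (hi : i < l.length) :
    G.IsWalk v (l.take i) (G.inc l[i]) ∧ G.IsWalk (G.inc l[i]) (l.drop i) w := by
  rw [← List.take_append_drop i l, isWalk_append] at h
  obtain ⟨u, h1, h2⟩ := h
  have h3 : G.inc l[i] = u := by
    rw [List.drop_eq_getElem_cons hi] at h2
    exact h2.1
  rw [h3]
  exact ⟨h1, h2⟩

/-- The parity of the weight of a walk. -/
def walkWeight (col : E → ZMod 2) (l : List (E × Bool)) : ZMod 2 := (l.map fun d => col d.1).sum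

theorem walkWeight_append (col : E → ZMod 2) (l l' : List (E × Bool)) :
    walkWeight col (l ++ l') = walkWeight col l + walkWeight col l' := by
  simp [walkWeight]

theorem walkWeight_singleton (col : E → ZMod 2) (d : E × Bool) :
    walkWeight col [d] = col d.1 := by
  simp [walkWeight]

theorem IsWalk.exists_reverse (col : E → ZMod 2) {l : List (E × Bool)} {v w : V}
    (h : G.IsWalk v l w) : ∃ l', G.IsWalk w l' v ∧ walkWeight col l' = walkWeight col l := by
  induction l generalizing v with
  | nil => exact ⟨[], h.symm, rfl⟩
  | cons d l ih =>
    obtain ⟨l', h1, h2⟩ := ih h.2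
    refine ⟨l' ++ [opp d], isWalk_append.2 ⟨_, h1, rfl, ?_⟩, ?_⟩
    · rw [opp_opp]
      exact h.1
    · rw [walkWeight_append, h2, walkWeight_singleton, add_comm]
      simp [walkWeight, opp]

theorem Reachable.exists_walk {v w : V} (h : G.Reachable v w) : ∃ l, G.IsWalk v l w := by
  induction h with
  | refl => exact ⟨[], rfl⟩
  | tail _ h ih =>
    obtain ⟨l, hl⟩ := ih
    obtain ⟨⟨d, rfl, rfl⟩, -⟩ := h
    exact ⟨l ++ [d], isWalk_append.2 ⟨_, hl, rfl, rfl⟩⟩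

theorem sym2_inc (d : E × Bool) :
    s(G.inc (d.1, false), G.inc (d.1, true)) = s(G.inc d, G.inc (opp d)) := by
  obtain ⟨e, b⟩ := d
  cases b
  · rfl
  · exact Sym2.eq_swap

theorem parallel_of_inc_eq {k d : E × Bool} (h : G.inc k = G.inc d)
    (h' : G.inc (opp k) = G.inc (opp d)) : G.Parallel k.1 d.1 := by
  unfold Parallel
  rw [sym2_inc, sym2_inc, h, h']

section

variable {col : E → ZMod 2} {l : List (E × Bool)} {v : V} (hl : G.IsWalk v l v)
  (hmin : ∀ l' w, l'.length < l.length → G.IsWalk w l' w → walkWeight col l' = 0)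
  (hodd : walkWeight col l ≠ 0)
include hl hmin hodd

/-- A closed walk of odd weight that has minimal length visits no vertex twice. -/
theorem nodup_inc_of_minimal : (l.map G.inc).Nodup := by
  rw [List.nodup_iff_pairwise_ne, List.pairwise_iff_getElem]
  intro i j hi hj hij heq
  simp only [List.length_map] at hi hj
  simp only [List.getElem_map] at heq
  apply hodd
  obtain ⟨h1, h2⟩ := hl.split hi
  obtain ⟨h3, h4⟩ := hl.split hj
  obtain ⟨h5, h6⟩ := h3.split (i := i) (by simp; omega)
  rw [List.take_take, min_eq_left hij.le] at h5
  simp only [List.getElem_take] at h5 h6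
  have e1 := hmin _ _ (by simp; omega) (heq ▸ h6)
  have e2 := hmin (l.take i ++ l.drop j) v (by simp; omega)
    (isWalk_append.2 ⟨_, h1, heq ▸ h4⟩)
  have e3 : l = l.take i ++ ((l.take j).drop i ++ l.drop j) := by
    conv_lhs => rw [← List.take_append_drop j l, ← List.take_append_drop i (l.take j),
      List.take_take, min_eq_left hij.le, List.append_assoc]
  rw [walkWeight_append] at e2
  rw [e3, walkWeight_append, walkWeight_append, e1, zero_add, e2]

theorem isCycle_of_minimal : G.IsCycle l := by
  have hnd := nodup_inc_of_minimal hl hmin hodd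
  have hinj : ∀ i j (hi : i < l.length) (hj : j < l.length), G.inc l[i] = G.inc l[j] → i = j := by
    intro i j hi hj h
    exact (List.Nodup.getElem_inj_iff hnd (hi := by simpa) (hj := by simpa)).1 (by simpa using h)
  have hne : l ≠ [] := by
    rintro rfl
    exact hodd rfl
  refine ⟨hne, ⟨⟨v, hl⟩, ?_⟩, hnd⟩
  rw [List.nodup_iff_pairwise_ne, List.pairwise_iff_getElem]
  intro i j hi hj hij heq
  simp only [List.length_map] at hi hj
  simp only [List.getElem_map] at heq
  rcases eq_or_eq_opp_of_fst_eq heq with h | h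
  · exact hij.ne (hinj i j hi hj (by rw [h]))
  -- An edge traversed in both directions is traversed back at once, as no vertex is repeated; the
  -- same holds cyclically, so that the walk consists of these two steps.
  · have h1 : j = i + 1 := by
      apply hinj j (i + 1) hj (by omega)
      rw [← hl.succ i (by omega), h, opp_opp]
    subst h1
    have h2 : ¬ i + 1 + 1 < l.length := by
      intro h2
      have := hinj i (i + 1 + 1) hi h2 (by rw [← hl.succ (i + 1) h2, h])
      omega
    have h3 : i = 0 := by
      have h4 := hl.last hne
      rw [List.getLast_eq_getElem] at h4
      have h5 : l.length - 1 = i + 1 := by omega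
      simp only [h5] at h4
      have h6 : G.inc l[0] = v := by
        have := (hl.split (i := 0) (by omega)).1
        exact this.symm
      exact hinj i 0 hi (by omega) (by rw [h, h4, h6])
    subst h3
    have hlen : l.length = 2 := by omega
    clear hl hmin hinj hnd hne
    obtain ⟨a, b, rfl⟩ := List.length_eq_two.1 hlen
    apply hodd
    have h' : a = opp b := h
    rw [h']
    simp [walkWeight, opp, CharTwo.add_self_eq_zero]

theorem chordless_of_minimal : G.Chordless l := by
  rintro x ⟨-, hloop, h0, h1, hpar⟩
  -- One of the two orientations of the chord runs from an earlier vertex to a later one.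
  obtain ⟨k, hk, i, j, hi, hj, hij, hki, hkj⟩ : ∃ k : E × Bool, k.1 = x ∧
      ∃ i j, ∃ (hi : i < l.length) (hj : j < l.length), i < j ∧ G.inc k = G.inc l[i] ∧
        G.inc (opp k) = G.inc l[j] := by
    obtain ⟨d, hd, hdx⟩ := List.mem_map.1 h0
    obtain ⟨d', hd', hdx'⟩ := List.mem_map.1 h1
    obtain ⟨i, hi, rfl⟩ := List.mem_iff_getElem.1 hd
    obtain ⟨j, hj, rfl⟩ := List.mem_iff_getElem.1 hd'
    rcases lt_trichotomy i j with h | h | h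
    · exact ⟨(x, false), rfl, i, j, hi, hj, h, hdx.symm, hdx'.symm⟩
    · subst h
      exact absurd (hdx.symm.trans hdx') hloop
    · exact ⟨(x, true), rfl, j, i, hj, hi, h, hdx'.symm, hdx.symm⟩
  subst hk
  obtain ⟨w1, w2⟩ := hl.split hi
  obtain ⟨w3, w4⟩ := hl.split hj
  obtain ⟨w5, w6⟩ := w3.split (i := i) (by simp; omega)
  simp only [List.getElem_take] at w6
  have n1 : j ≠ i + 1 := by
    rintro rfl
    refine hpar l[i].1 (List.mem_map.2 ⟨_, List.getElem_mem hi, rfl⟩) ?_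
    exact parallel_of_inc_eq hki (by rw [hkj, hl.succ i hj])
  have n2 : ¬ (i = 0 ∧ j + 1 = l.length) := by
    rintro ⟨rfl, hj1⟩
    refine hpar l[j].1 (List.mem_map.2 ⟨_, List.getElem_mem hj, rfl⟩) ?_
    refine parallel_of_inc_eq (k := opp k) hkj ?_
    have h4 := hl.last (List.ne_nil_of_length_pos hi)
    rw [List.getLast_eq_getElem] at h4
    have h5 : l.length - 1 = j := by omega
    simp only [h5] at h4
    rw [opp_opp, hki, h4]
    exact w1.symm
  have e1 := hmin ((l.take j).drop i ++ [opp k]) _ (by simp; omega)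
    (isWalk_append.2 ⟨_, w6, isWalk_singleton.2 ⟨hkj, by rw [opp_opp, hki]⟩⟩)
  have e2 := hmin (l.take i ++ ([k] ++ l.drop j)) v (by simp; omega)
    (isWalk_append.2 ⟨_, w1, isWalk_append.2 ⟨_, isWalk_singleton.2 ⟨hki, hkj⟩, w4⟩⟩)
  have e3 : l = l.take i ++ ((l.take j).drop i ++ l.drop j) := by
    conv_lhs => rw [← List.take_append_drop j l, ← List.take_append_drop i (l.take j),
      List.take_take, min_eq_left hij.le, List.append_assoc]
  apply hodd
  rw [e3]
  simp only [walkWeight_append, walkWeight_singleton] at e1 e2 ⊢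
  have e4 : col (opp k).1 = col k.1 := rfl
  rw [e4] at e1
  linear_combination e1 + e2 - CharTwo.add_self_eq_zero (col k.1)

end

/-- A weight of the edges that is even on all loops and on all chordless cycles is given by the
cut of a vertex set. -/
theorem exists_cut_of_even {col : E → ZMod 2} (hloop : ∀ e, G.IsLoop e → col e = 0)
    (hcyc : ∀ o, G.IsCycle o → 2 ≤ o.length → G.Chordless o → walkWeight col o = 0) :
    ∃ ε : V → ZMod 2, ∀ e, col e = ε (G.inc (e, false)) + ε (G.inc (e, true)) := by
  classical
  have heven : ∀ n, ∀ (l : List (E × Bool)) (v : V), l.length = n → G.IsWalk v l v →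
      walkWeight col l = 0 := by
    intro n
    induction n using Nat.strong_induction_on with
    | _ n ih =>
      rintro l v rfl hl
      by_contra hodd
      have hmin : ∀ l' w, l'.length < l.length → G.IsWalk w l' w → walkWeight col l' = 0 :=
        fun l' w h hw => ih _ h l' w rfl hw
      refine hodd (hcyc l (isCycle_of_minimal hl hmin hodd) ?_
        (chordless_of_minimal hl hmin hodd))
      match l, hl, hodd with
      | [], _, hodd => exact absurd rfl hodd
      | [d], hl, hodd =>
        refine absurd ?_ hodd
        rw [walkWeight_singleton]
        apply hloop
        have h1 := isWalk_singleton.1 hl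
        have h2 : s(G.inc (d.1, false), G.inc (d.1, true)) = s(v, v) := by
          rw [sym2_inc, h1.1, h1.2]
        rcases Sym2.eq_iff.1 h2 with h3 | h3 <;> exact h3.1.trans h3.2.symm
      | _ :: _ :: _, _, _ => simp
  let A : V → Set V := fun v => {u | G.Reachable u v}
  have hA : ∀ v w, G.Reachable v w → A v = A w := fun v w hvw =>
    Set.ext fun h => ⟨fun h' => Reachable.trans h' hvw, fun h' => Reachable.trans h' hvw.symm⟩
  have hne : ∀ v, (A v).Nonempty := fun v => ⟨v, .refl⟩
  have hw : ∀ v, ∃ l, G.IsWalk (hne v).some l v := fun v => Reachable.exists_walk (hne v).some_mem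
  choose L hL using hw
  refine ⟨fun v => walkWeight col (L v), fun e => ?_⟩
  have h1 := hL (G.inc (e, false))
  have h2 := hL (G.inc (e, true))
  have h3 : (hne (G.inc (e, true))).some = (hne (G.inc (e, false))).some := by
    congr 1
    exact (hA _ _ (reachable_opp (e, false))).symm
  rw [h3] at h2
  obtain ⟨l', h4, h5⟩ := h2.exists_reverse col
  have h6 := heven _ (L (G.inc (e, false)) ++ ([(e, false)] ++ l')) _ rfl
    (isWalk_append.2 ⟨_, h1, isWalk_append.2 ⟨_, isWalk_singleton.2 ⟨rfl, rfl⟩, h4⟩⟩)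
  rw [walkWeight_append, walkWeight_append, walkWeight_singleton, h5] at h6
  linear_combination h6 - CharTwo.add_self_eq_zero (walkWeight col (L (G.inc (e, false)))) -
    CharTwo.add_self_eq_zero (walkWeight col (L (G.inc (e, true))))

end MultiGraph

namespace MultiGraph

/-! ### Signs of rotations -/

section

variable {V E I : Type*} {G : MultiGraph V E} {cl : V → I} {σ : Equiv.Perm (E × Bool)}

/-- If the rotator at one vertex equals its reverse, then this holds in its whole component; such
a component is small. -/
theorem FiberwiseThreeConnected.apply_apply_eq [Fintype E] (hG : FiberwiseThreeConnected G cl)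
    (hσ : G.IsRotation σ) {v : V} (h : ∀ d, G.inc d = v → σ (σ d) = d) {k : E × Bool}
    (hv : cl v = cl (G.inc k)) : σ (σ k) = k := by
  have key : ∀ d, (∀ d', G.inc d' = G.inc d → σ (σ d') = d') ↔ σ (σ d) = d := by
    refine fun d => ⟨fun h' => h' d rfl, fun hd d' hd' => ?_⟩
    rcases hσ.eq_or_eq_of_apply_apply_eq hd hd'.symm with rfl | rfl
    · exact hd
    · rw [hd]
  have step : ∀ d, σ (σ (opp d)) = opp d → σ (σ d) = d := by
    intro d hd
    by_contra hne
    refine hG.apply_apply_ne hσ (d := opp d) ?_ hd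
    rwa [opp_opp]
  have := hG.conn_eq (p := fun v => ∀ d', G.inc d' = v → σ (σ d') = d') ∅ (by simp)
    (fun d _ _ => by
      rw [eq_iff_iff, key, key]
      exact ⟨step d, fun h' => step (opp d) (by rwa [opp_opp])⟩) hv (by simp) (by simp)
  exact (this ▸ h) k rfl

end

variable {V E : Type*} {G : MultiGraph V E}

theorem IsWalk.walkWeight_eq {col : E → ZMod 2} {δ : V → ZMod 2} {l : List (E × Bool)} {v w : V}
    (hl : G.IsWalk v l w) (h : ∀ d ∈ l, col d.1 = δ (G.inc (d.1, false)) + δ (G.inc (d.1, true))) :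
    walkWeight col l = δ v + δ w := by
  induction l generalizing v with
  | nil =>
    obtain rfl : v = w := hl
    exact (CharTwo.add_self_eq_zero _).symm
  | cons d l ih =>
    obtain ⟨rfl, hl⟩ := hl
    have h1 := ih hl fun d' hd' => h d' (List.mem_cons_of_mem _ hd')
    have h2 : col d.1 = δ (G.inc d) + δ (G.inc (opp d)) := by
      rw [h d List.mem_cons_self]
      obtain ⟨e, b⟩ := d
      cases b
      · rfl
      · exact add_comm _ _
    have h3 : walkWeight col (d :: l) = col d.1 + walkWeight col l := by simp [walkWeight]
    rw [h3, h1, h2]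
    linear_combination CharTwo.add_self_eq_zero (δ (G.inc (opp d)))

theorem IsClosedTrail.inc_opp_getElem {l : List (E × Bool)} (hl : G.IsClosedTrail l) {j : ℕ}
    (hj : j < l.length) : (∃ h : j + 1 < l.length, G.inc (opp l[j]) = G.inc l[j + 1]) ∨
      (j + 1 = l.length ∧ G.inc (opp l[j]) = G.inc l[0]) := by
  obtain ⟨⟨v, hw⟩, -⟩ := hl
  rcases Nat.lt_or_ge (j + 1) l.length with h | h
  · exact Or.inl ⟨h, hw.succ j h⟩
  · refine Or.inr ⟨by omega, ?_⟩
    have h4 := hw.last (List.ne_nil_of_length_pos (by omega))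
    rw [List.getLast_eq_getElem] at h4
    have h5 : l.length - 1 = j := by omega
    simp only [h5] at h4
    rw [h4]
    exact (hw.split (i := 0) (by omega)).1

end MultiGraph

namespace TwoComplex

open MultiGraph

variable {V E F : Type*} {C : TwoComplex V E F}

/-! ### Cycles and paths -/

theorem isForest_of {X : Set E} (h : ∀ x ∈ X, ∃ s : V → Prop,
    (∀ y ∈ X, y ≠ x → (s (C.inc (y, false)) ↔ s (C.inc (y, true)))) ∧
      ¬ (s (C.inc (x, false)) ↔ s (C.inc (x, true)))) : C.IsForest X := by
  intro x hx hr
  obtain ⟨s, hs, hsx⟩ := h x hx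
  have key : ∀ a b, Relation.EqvGen (C.JoinedWithout X x) a b → (s a ↔ s b) := by
    intro a b hab
    induction hab with
    | rel a b hab =>
      obtain ⟨y, hy, hyx, rfl, rfl⟩ := hab
      exact hs y hy hyx
    | refl => exact Iff.rfl
    | symm _ _ _ ih => exact ih.symm
    | trans _ _ _ _ _ ih ih' => exact ih.trans ih'
  exact hsx (key _ _ hr)

theorem isForest_singleton {e : E} (he : ¬ C.IsLoop e) : C.IsForest {e} := by
  refine isForest_of ?_
  rintro x rfl
  refine ⟨fun w => w = C.inc (x, false), fun y hy hyx => absurd hy hyx, fun h => he ?_⟩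
  exact (h.1 rfl).symm

/-- A cycle becomes a path on deleting one of its edges. -/
theorem isForest_of_isCycle {o : List (E × Bool)} (ho : C.IsCycle o) {e : E}
    (he : e ∈ o.map Prod.fst) : C.IsForest {x | x ∈ o.map Prod.fst ∧ x ≠ e} := by
  obtain ⟨dₑ, hdₑ, rfl⟩ := List.mem_map.1 he
  obtain ⟨k, hk, rfl⟩ := List.mem_iff_getElem.1 hdₑ
  have hinj : ∀ i j (hi : i < o.length) (hj : j < o.length), C.inc o[i] = C.inc o[j] → i = j := by
    intro i j hi hj h
    exact (List.Nodup.getElem_inj_iff ho.2.2 (hi := by simpa) (hj := by simpa)).1 (by simpa using h)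
  -- The edges number `a` and `b` of the cycle are the only ones that leave the part between them.
  have key : ∀ a b, a < b → b < o.length → ∃ s : V → Prop, ∀ j (hj : j < o.length),
      (s (C.inc (o[j].1, false)) ↔ s (C.inc (o[j].1, true))) ↔ (j ≠ a ∧ j ≠ b) := by
    intro a b hab hb
    obtain ⟨s, h1⟩ : ∃ s : V → Prop, ∀ i (hi : i < o.length),
        s (C.inc o[i]) ↔ a < i ∧ i ≤ b := by
      refine ⟨fun w => ∃ t, ∃ ht : t < o.length, (a < t ∧ t ≤ b) ∧ C.inc o[t] = w, ?_⟩
      intro i hi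
      constructor
      · rintro ⟨t, ht, h, h'⟩
        rwa [← hinj t i ht hi h']
      · exact fun h => ⟨i, hi, h, rfl⟩
    refine ⟨s, fun j hj => ?_⟩
    have h2 : ∀ (d : E × Bool),
        (s (C.inc (d.1, false)) ↔ s (C.inc (d.1, true))) ↔ (s (C.inc d) ↔ s (C.inc (opp d))) := by
      rintro ⟨y, b⟩
      cases b
      · exact Iff.rfl
      · exact Iff.comm
    rw [h2]
    rcases ho.2.1.inc_opp_getElem hj with ⟨h, h3⟩ | ⟨h, h3⟩
    · rw [h3, h1, h1]
      omega
    · rw [h3, h1, h1]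
      omega
  refine isForest_of ?_
  rintro x ⟨hx, hxe⟩
  obtain ⟨d, hd, rfl⟩ := List.mem_map.1 hx
  obtain ⟨i, hi, rfl⟩ := List.mem_iff_getElem.1 hd
  have hik : i ≠ k := by
    rintro rfl
    exact hxe rfl
  obtain ⟨s, hs⟩ := key (min i k) (max i k) (by omega) (by omega)
  refine ⟨s, ?_, ?_⟩
  · rintro y ⟨hy, hye⟩ hyx
    obtain ⟨d, hd, rfl⟩ := List.mem_map.1 hy
    obtain ⟨j, hj, rfl⟩ := List.mem_iff_getElem.1 hd
    refine (hs j hj).2 ?_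
    have h1 : j ≠ i := by
      rintro rfl
      exact hyx rfl
    have h2 : j ≠ k := by
      rintro rfl
      exact hye rfl
    omega
  · rw [hs i hi]
    omega

theorem isLoop_contract_of_isCycle {o : List (E × Bool)} (ho : C.IsCycle o) {e : E}
    (he : e ∈ o.map Prod.fst) (he' : e ∉ {x | x ∈ o.map Prod.fst ∧ x ≠ e}) :
    (C.contract {x | x ∈ o.map Prod.fst ∧ x ≠ e}).IsLoop ⟨e, he'⟩ := by
  set X := {x | x ∈ o.map Prod.fst ∧ x ≠ e} with hX
  obtain ⟨d, hd, rfl⟩ := List.mem_map.1 he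
  obtain ⟨a, b, hab⟩ := List.append_of_mem hd
  obtain ⟨v, hw⟩ := ho.2.1.1
  have hnd := ho.2.1.2
  rw [hab, List.map_append, List.map_cons, List.nodup_append, List.nodup_cons] at hnd
  have hnil : ∀ l : List (E × Bool), (∀ x ∈ l, x.1 ∈ X) → deleteEdges X l = [] := by
    intro l hl
    refine List.filterMap_eq_nil_iff.2 fun x hx => ?_
    simp [hl x hx]
  have ha : deleteEdges X a = [] := by
    refine hnil a fun x hx => ⟨List.mem_map.2 ⟨x, by simp [hab, hx], rfl⟩, ?_⟩
    exact hnd.2.2 _ (List.mem_map_of_mem hx) _ List.mem_cons_self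
  have hb : deleteEdges X b = [] := by
    refine hnil b fun x hx => ⟨List.mem_map.2 ⟨x, by simp [hab, hx], rfl⟩, fun h => ?_⟩
    exact hnd.2.1.1 (h ▸ List.mem_map_of_mem hx)
  have hdel : deleteEdges X o = [(⟨d.1, he'⟩, d.2)] := by
    have h1 : deleteEdges X o = deleteEdges X a ++ deleteEdges X (d :: b) := by
      rw [hab]
      exact List.filterMap_append
    have h2 : deleteEdges X (d :: b) = (⟨d.1, he'⟩, d.2) :: deleteEdges X b := by
      simp [deleteEdges, he']
    rw [h1, h2, ha, hb]
    rfl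
  have hwalk := isWalk_deleteEdges X hw
  rw [hdel, isWalk_singleton] at hwalk
  obtain ⟨⟨e, c⟩, he⟩ : ∃ d', d' = d := ⟨d, rfl⟩
  subst he
  cases c
  · exact hwalk.1.trans hwalk.2.symm
  · exact hwalk.2.trans hwalk.1.symm

/-! ### Reversing rotations -/

variable {σ τ : Equiv.Perm (C.Corner × Bool)} {e : E}

theorem ReverseAt.congr (h : C.ReverseAt τ e) (hinc : ∀ d, C.links.inc (τ d) = C.links.inc d)
    (hστ : ∀ d, (C.links.inc d).1 = e → σ d = τ d) : C.ReverseAt σ e := by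
  intro d hd
  rw [hστ d hd, hστ _ ?_, h d hd]
  rw [inc_mirror, hinc]
  exact hd

theorem ReverseAt.symm (h : C.ReverseAt τ e) (hinc : ∀ d, C.links.inc (τ d) = C.links.inc d) :
    C.ReverseAt τ.symm e := by
  intro d hd
  rw [Equiv.symm_apply_eq, ← h _ ?_, Equiv.apply_symm_apply]
  rw [← hinc, Equiv.apply_symm_apply]
  exact hd

/-- If the rotators at `e` stay reverse to each other when just one of them is reversed, then they
equal their reverses. -/
theorem ReverseAt.apply_apply_eq (hσ : C.ReverseAt σ e) (hτ : C.ReverseAt τ e) {h : E × Bool}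
    (he : h.1 = e) (hinc : ∀ d, C.links.inc (σ d) = C.links.inc d)
    (h1 : ∀ d, C.links.inc d = h → τ d = σ d)
    (h2 : ∀ d, C.links.inc d = opp h → τ d = σ.symm d) {d : C.Corner × Bool}
    (hd : C.links.inc d = opp h) : σ (σ d) = d := by
  obtain ⟨k, rfl⟩ : ∃ k, C.mirror k = d := ⟨C.mirror d, mirror_mirror d⟩
  have hk : C.links.inc k = h := by
    rw [inc_mirror] at hd
    exact opp.injective hd
  have hke : (C.links.inc k).1 = e := by rw [hk, he]
  have h3 := hτ k hke
  rw [h1 k hk, h2 _ (by rw [inc_mirror, hinc, hk]), Equiv.symm_apply_eq] at h3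
  rw [← h3, hσ k hke]

end TwoComplex

namespace TwoComplex

open MultiGraph

variable {V E F : Type*} {C : TwoComplex V E F} {σ τ ρ : Equiv.Perm (C.Corner × Bool)}
  {δ ε : V → ZMod 2}

/-! ### Gluing the rotation systems of the link graphs -/

open Classical in
/-- The defect of `σ` at `e`: it is `0` if the two rotators at `e` are reverse to each other, and
`1` otherwise. -/
noncomputable def defect (σ : Equiv.Perm (C.Corner × Bool)) (e : E) : ZMod 2 :=
  if C.ReverseAt σ e then 0 else 1

theorem defect_eq_zero_iff {e : E} : defect σ e = 0 ↔ C.ReverseAt σ e := by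
  unfold defect
  split_ifs with h <;> simp [h]

/-- `τ` is obtained from `σ` by reversing the link graphs at the vertices `v` with `δ v = 1`. -/
def Twisted (σ τ : Equiv.Perm (C.Corner × Bool)) (δ : V → ZMod 2) : Prop :=
  ∀ d, (δ (C.inc (C.links.inc d)) = 0 → τ d = σ d) ∧
    (δ (C.inc (C.links.inc d)) = 1 → τ d = σ.symm d)

theorem twisted_self (σ : Equiv.Perm (C.Corner × Bool)) : Twisted σ σ 0 :=
  fun _ => ⟨fun _ => rfl, fun h => absurd h (by simp)⟩

theorem eq_zero_or_eq_one (a : ZMod 2) : a = 0 ∨ a = 1 := by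
  revert a
  decide

theorem Twisted.compare (hτ : Twisted σ τ δ) (hρ : Twisted σ ρ ε)
    (hinc : ∀ d, C.links.inc (σ d) = C.links.inc d) : Twisted τ ρ (δ + ε) := by
  have hinc' : ∀ d, C.links.inc (σ.symm d) = C.links.inc d := fun d => by
    rw [← hinc, Equiv.apply_symm_apply]
  intro d
  rw [Pi.add_apply, Equiv.eq_symm_apply]
  rcases eq_zero_or_eq_one (δ (C.inc (C.links.inc d))) with h | h <;>
    rcases eq_zero_or_eq_one (ε (C.inc (C.links.inc d))) with h' | h'
  · exact ⟨fun _ => by rw [(hτ d).1 h, (hρ d).1 h'], fun h1 => absurd h1 (by simp [h, h'])⟩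
  · refine ⟨fun h1 => absurd h1 (by simp [h, h']), fun _ => ?_⟩
    rw [(hρ d).2 h', (hτ _).1 (by rwa [hinc']), Equiv.apply_symm_apply]
  · refine ⟨fun h1 => absurd h1 (by simp [h, h']), fun _ => ?_⟩
    rw [(hρ d).1 h', (hτ _).2 (by rwa [hinc]), Equiv.symm_apply_apply]
  · refine ⟨fun _ => by rw [(hτ d).2 h, (hρ d).2 h'], fun h1 => absurd h1 ?_⟩
    rw [h, h', CharTwo.add_self_eq_zero]
    exact zero_ne_one

/-- Reversing the link graphs at both ends of `e`, or at none of them, preserves that the rotators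
at `e` are reverse to each other. -/
theorem ReverseAt.of_twisted {e : E} (h : C.ReverseAt τ e)
    (hinc : ∀ d, C.links.inc (τ d) = C.links.inc d) (ht : Twisted τ σ δ)
    (he : δ (C.inc (e, false)) = δ (C.inc (e, true))) : C.ReverseAt σ e := by
  have hδ : ∀ d, (C.links.inc d).1 = e → δ (C.inc (C.links.inc d)) = δ (C.inc (e, false)) := by
    intro d hd
    obtain ⟨b, hb⟩ : ∃ b, C.links.inc d = (e, b) := ⟨_, Prod.ext hd rfl⟩
    rw [hb]
    cases b
    · rfl
    · exact he.symm
  rcases eq_zero_or_eq_one (δ (C.inc (e, false))) with h0 | h1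
  · exact h.congr hinc fun d hd => (ht d).1 ((hδ d hd).trans h0)
  · refine (h.symm hinc).congr (fun d => ?_) fun d hd => (ht d).2 ((hδ d hd).trans h1)
    rw [← hinc, Equiv.apply_symm_apply]

/-- By Whitney's theorem any two planar rotation systems of the link graphs differ by reversing
some of them. Across an edge at which the rotators of `τ` are reverse to each other, the defect of
`σ` says whether just one of the two link graphs is reversed. -/
theorem exists_twisted [Finite V] [Finite E] [Fintype F]
    (hG : FiberwiseThreeConnected C.links C.inc)
    (hσ : C.links.IsRotation σ) (hτ : C.links.IsRotation τ)
    (hcσ : C.links.TrivialCohomology σ) (hcτ : C.links.TrivialCohomology τ) :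
    ∃ δ : V → ZMod 2, Twisted σ τ δ ∧ ∀ e, C.ReverseAt τ e →
      defect σ e = δ (C.inc (e, false)) + δ (C.inc (e, true)) := by
  classical
  let P : V → Prop := fun v => ∀ d, C.inc (C.links.inc d) = v → τ d = σ d
  let δ : V → ZMod 2 := fun v => if P v then 0 else 1
  have hδ0 : ∀ v, δ v = 0 ↔ P v := fun v => by
    change (if P v then (0 : ZMod 2) else 1) = 0 ↔ P v
    split_ifs with h <;> simp [h]
  have hrev : ∀ v, δ v = 1 → ∀ d, C.inc (C.links.inc d) = v → τ d = σ.symm d := by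
    intro v hv
    refine (hG.eq_or_reverse hσ hτ hcσ hcτ v).resolve_left fun h => ?_
    rw [(hδ0 v).2 h] at hv
    exact zero_ne_one hv
  have ht : Twisted σ τ δ := fun d => ⟨fun h => (hδ0 _).1 h d rfl, fun h => hrev _ h d rfl⟩
  have hmixed : ∀ h : E × Bool, C.ReverseAt τ h.1 → C.ReverseAt σ h.1 → δ (C.inc h) = 0 →
      δ (C.inc (opp h)) ≠ 1 := by
    intro h hτe hσe h0 h1
    refine zero_ne_one (α := ZMod 2) (Eq.trans ?_ h1)
    rw [eq_comm, hδ0]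
    intro d hd
    rw [hrev _ h1 d hd, Equiv.symm_apply_eq, eq_comm]
    refine hG.apply_apply_eq hσ (v := opp h) (fun k hk => ?_) hd.symm
    refine hσe.apply_apply_eq hτe rfl hσ.inc_eq (fun k hk => ?_) (fun k hk => ?_) hk
    · exact (hδ0 _).1 h0 k (by rw [hk])
    · exact hrev _ h1 k (by rw [hk])
  refine ⟨δ, ht, fun e he => ?_⟩
  have hsame : δ (C.inc (e, false)) = δ (C.inc (e, true)) → defect σ e = 0 := fun h =>
    defect_eq_zero_iff.2 (he.of_twisted hτ.inc_eq
      (ht.compare (twisted_self σ) hσ.inc_eq) (by simpa using h))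
  have hdiff : ∀ h : E × Bool, h.1 = e → δ (C.inc h) = 0 → δ (C.inc (opp h)) = 1 →
      defect σ e = 1 := by
    rintro h rfl h0 h1
    exact (eq_zero_or_eq_one _).resolve_left fun h2 =>
      hmixed h he (defect_eq_zero_iff.1 h2) h0 h1
  rcases eq_zero_or_eq_one (δ (C.inc (e, false))) with h | h <;>
    rcases eq_zero_or_eq_one (δ (C.inc (e, true))) with h' | h'
  · rw [hsame (h.trans h'.symm), h, h', add_zero]
  · rw [hdiff (e, false) rfl h h', h, h', zero_add]
  · rw [hdiff (e, true) rfl h' h, h, h', add_zero]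
  · rw [hsame (h.trans h'.symm), h, h', CharTwo.add_self_eq_zero]

theorem twisted_rotation [Finite F] (T : ∀ v, (C.link v).RotationSystem) (ε : V → ZMod 2) :
    Twisted (rotation T) (rotation fun v => if ε v = 0 then T v else (T v).reverse) ε := by
  intro d
  rw [inc_inc]
  constructor
  · intro h
    rw [rotation_apply_mk, if_pos h, ← rotation_apply_mk]
  · intro h
    have h0 : ε (C.inc d.1.leave) ≠ 0 := by
      rw [h]
      exact one_ne_zero
    rw [rotation_apply_mk, if_neg h0, RotationSystem.total_reverse, Equiv.eq_symm_apply,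
      rotation_apply, Equiv.apply_symm_apply]

end TwoComplex

theorem lemma4p1 {V E F : Type*} [Finite V] [Finite E] [Finite F] (C : TwoComplex V E F)
    (h3 : C.LocallyThreeConnected)
    (hC : C.LocallyPlanar)
    (he : ∀ e : E, ¬ C.IsLoop e → (C.contract {e}).LocallyPlanar)
    (ho : ∀ o : List (E × Bool), C.IsCycle o → 2 ≤ o.length → C.Chordless o →
      ∃ e ∈ o.map Prod.fst, (C.contract {x | x ∈ o.map Prod.fst ∧ x ≠ e}).LocallyPlanar) :
    ∃ S : C.RotationSystem, S.Planar := by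
  classical
  have := Fintype.ofFinite F
  have hG := h3.fiberwise
  obtain ⟨T, hT, hloop⟩ := hC.exists_rotations
  have hσ := TwoComplex.isRotation_rotation T
  have hcσ := TwoComplex.trivialCohomology_rotation hT
  -- The edges of defect one are a cut, by parity on the chordless cycles.
  obtain ⟨ε, hε⟩ : ∃ ε : V → ZMod 2, ∀ e,
      TwoComplex.defect (TwoComplex.rotation T) e = ε (C.inc (e, false)) + ε (C.inc (e, true)) := by
    refine MultiGraph.exists_cut_of_even (fun e h => TwoComplex.defect_eq_zero_iff.2 (hloop e h)) ?_
    intro o hoc h2 hch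
    obtain ⟨e, heo, hP⟩ := ho o hoc h2 hch
    obtain ⟨τ, hτ, hcτ, hX, hl⟩ := (TwoComplex.isForest_of_isCycle hoc heo).exists_rotation hG hP
    obtain ⟨δ, -, hδ⟩ := TwoComplex.exists_twisted hG hσ hτ hcσ hcτ
    obtain ⟨v, hv⟩ := hoc.2.1.1
    rw [hv.walkWeight_eq (δ := δ), CharTwo.add_self_eq_zero]
    intro d hd
    refine hδ _ ?_
    by_cases hde : d.1 = e
    · have he' : e ∉ {x | x ∈ o.map Prod.fst ∧ x ≠ e} := fun h => h.2 rfl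
      rw [hde]
      exact hl e he' (TwoComplex.isLoop_contract_of_isCycle hoc heo he')
    · exact hX _ ⟨List.mem_map_of_mem hd, hde⟩
  -- Reverse the link graphs on one side of this cut.
  have hεT := TwoComplex.twisted_rotation T ε
  refine TwoComplex.exists_planar_of_reverseAt (fun v => if ε v = 0 then T v else (T v).reverse)
    (fun v => ?_) fun e => ?_
  · split_ifs
    · exact hT v
    · exact (hT v).reverse
  · by_cases hle : C.IsLoop e
    · exact (hloop e hle).of_twisted hσ.inc_eq hεT (congrArg ε hle)
    · obtain ⟨τ, hτ, hcτ, hX, -⟩ :=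
        (TwoComplex.isForest_singleton hle).exists_rotation hG (he e hle)
      obtain ⟨δ, hδ, hδe⟩ := TwoComplex.exists_twisted hG hσ hτ hcσ hcτ
      have hτe := hX e rfl
      refine hτe.of_twisted hτ.inc_eq (hδ.compare hεT hσ.inc_eq) ?_
      have h1 := (hε e).symm.trans (hδe e hτe)
      simp only [Pi.add_apply]
      linear_combination h1 - CharTwo.add_self_eq_zero (ε (C.inc (e, true))) +
        CharTwo.add_self_eq_zero (δ (C.inc (e, false)))
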